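/- **Setting.** Write $f^*(z)=\overline{f(\bar z)}$, $\sigma_3=\mathrm{diag}(1,-1)$, and $I,II,III,IV$ for the open quadrants of $\mathbb C$. Let $L>0$, let $q_0:[0,L]\to\mathbb C$ be continuous, and put $U_1(y)=\begin{pmatrix}0&q_0(y)\\-\overline{q_0(y)}&0\end{pmatrix}$. *Spectral functions.* $a(z),b(z)$, $z\in\mathbb C$, are defined by $\Phi_3=\Phi_2\begin{pmatrix}a^*&b\\-b^*&a\end{pmatrix}$, where $\Phi_2,\Phi_3$ are the continuous solutions on $[0,L]$ of $$\Phi_2(x,z)=e^{-izx\sigma_3}+\int_0^xe^{-iz(x-y)\sigma_3}U_1(y)\Phi_2(y,z)\,dy,\qquad \Phi_3(x,z)=e^{-izx\sigma_3}-\int_x^Le^{-iz(x-y)\sigma_3}U_1(y)\Phi_3(y,z)\,dy.$$ Let $\Delta=e^{-izL}a+e^{izL}a^*$. Assume that the set of simple zeros of $\Delta^2-4$ is finite and consists of $z_0,\dots,z_N$ (distinct, $\operatorname{Im}z_j>0$, $\operatorname{Re}z_j\ne0$) and their conjugates. Let $\Sigma_j$ be the closed vertical segment joining $\bar z_j$ and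 $z_j$, and $\Sigma=\bigcup_j\Sigma_j$. *The function $R$.* Let $R$ be meromorphic in $\mathbb C\setminus\Sigma$ with $$e^{2izL}b^*R^2+(e^{2izL}a^*-a)R+b=0,\qquad R(z)\to0\ (z\to\infty).$$ Assume that $R$ has finite boundary values $R^\pm$ on the left ($+$) and right ($-$) sides of $\Sigma$ away from the points $z_j,\bar z_j$, that it has no poles on $\mathbb R\cup i\mathbb R$, and that its poles in $I\cup III$ are simple. Put $$r=\frac{b^*}{a},\quad\tilde r=\frac ba,\quad G=-\frac{R^*}{a(a+bR^*)},\quad G_2=R-\frac ba .$$ *The Riemann–Hilbert problem.* For $x\in[0,L]$, $t\ge0$ let $M(x,t,\cdot)$ be a $2\times2$ matrix solution of the following problem. $M$ is analytic off $\Gamma=\mathbb R\cup i\mathbb R\cup\Sigma$ except at the poles listed below, has one-sided limits at the points of $\Gamma$ other than $0,\operatorname{Re}z_j,z_j,\bar z_j$, is bounded near $0$ and $\operatorname{Re}z_j$, is $O(|z-p|^{-1/2})$ near $p=z_j,\bar z_j$, tends to the identity matrix as $z\to\infty$, and satisfies $M^+=M^-J$ on $\Gamma$ at all the points where $J$ is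 defined (i.e. off the zeros of the denominators $a$, $a^*$), with $$J=e^{-(izx+2iz^2t)\sigma_3}J_0(z)e^{(izx+2iz^2t)\sigma_3}.$$ Here $\mathbb R$ is oriented from left to right, $i\mathbb R_\pm$ towards infinity, $\Sigma_j$ upwards, the $+$ side is on the left, and $J_0$ equals - on $\mathbb R_+$: $\begin{pmatrix}1&0\\G_2^*&1\end{pmatrix}\begin{pmatrix}1&\tilde r\\\tilde r^*&1+|\tilde r|^2\end{pmatrix}\begin{pmatrix}1&G_2\\0&1\end{pmatrix}$; on $\mathbb R_-$: $\begin{pmatrix}1&G^*\\0&1\end{pmatrix}\begin{pmatrix}1+|r|^2&r^*\\r&1\end{pmatrix}\begin{pmatrix}1&0\\G&1\end{pmatrix}$; - on $i\mathbb R_+$: $\begin{pmatrix}1&-G_2\\0&1\end{pmatrix}\begin{pmatrix}a^{-1}&0\\0&a\end{pmatrix}\begin{pmatrix}1&0\\G&1\end{pmatrix}$; on $i\mathbb R_-$: $\begin{pmatrix}1&G^*\\0&1\end{pmatrix}\begin{pmatrix}(a^*)^{-1}&0\\0&a^*\end{pmatrix}\begin{pmatrix}1&0\\-G_2^*&1\end{pmatrix}$;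 - on $\Sigma\cap I$: $\begin{pmatrix}1&R^+-R^-\\0&1\end{pmatrix}$; on $\Sigma\cap II$: $\begin{pmatrix}1&0\\e^{-2izL}(R^{*-}-R^{*+})&1\end{pmatrix}$; on $\Sigma\cap III$: $\begin{pmatrix}1&e^{2izL}(R^+-R^-)\\0&1\end{pmatrix}$; on $\Sigma\cap IV$: $\begin{pmatrix}1&0\\R^{*-}-R^{*+}&1\end{pmatrix}$. Residue conditions ($M^{(k)}$ is the $k$-th column): at a pole $\xi$ of $R$ in $I$, resp. $III$, $M^{(1)}$ is analytic, $M^{(2)}$ has at most a simple pole, and $$\operatorname{Res}_\xi M^{(2)}=e^{-2i\xi x-4i\xi^2t}\operatorname{Res}_\xi R\;M^{(1)}(\xi),\quad\text{resp. } \operatorname{Res}_\xi M^{(2)}=e^{-2i\xi(x-L)-4i\xi^2t}\operatorname{Res}_\xi R\;M^{(1)}(\xi);$$ at a pole $\xi$ of $R^*$ in $II$, resp. $IV$, $M^{(2)}$ is analytic, $M^{(1)}$ has at most a simple pole, and $$\operatorname{Res}_\xi M^{(1)}=-e^{2i\xi(x-L)+4i\xi^2t}\operatorname{Res}_\xi R^*\;M^{(2)}(\xi),\quad\text{resp.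 } \operatorname{Res}_\xi M^{(1)}=-e^{2i\xi x+4i\xi^2t}\operatorname{Res}_\xi R^*\;M^{(2)}(\xi).$$ *The potential.* Let $q(x,t)=2i\lim z\,M_{12}(x,t,z)$ as $z\to\infty$, $z\in I$. *Transformation at the end points.* Let $P^{(t)}=\mathrm{Id}$ in $I\cup IV$, $\hat P^{(t)}=\mathrm{Id}$ in $II\cup III$, and $$P^{(t)}=\begin{pmatrix}a+bR^*&-be^{-4iz^2t}\\0&a^*+b^*R\end{pmatrix}\text{ in }II,\qquad P^{(t)}=\begin{pmatrix}a+bR^*&0\\b^*e^{4iz^2t}&a^*+b^*R\end{pmatrix}\text{ in }III,$$ $$\hat P^{(t)}=\begin{pmatrix}a^*+b^*R&0\\-b^*e^{2izL}e^{4iz^2t}&a+bR^*\end{pmatrix}\text{ in }I,\qquad \hat P^{(t)}=\begin{pmatrix}a^*+b^*R&be^{-2izL}e^{-4iz^2t}\\0&a+bR^*\end{pmatrix}\text{ in }IV.$$ **Proposition 4.2.** For every $t\ge0$ the matrix functions $M^{(t)}(t,z)=M(0,t,z)P^{(t)}(t,z)$ and $\hat M^{(t)}(t,z)=M(L,t,z)\hat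 P^{(t)}(t,z)$ coincide for all $z\notin\Gamma$ that are not poles of $R$ or $R^*$. Consequently, for every $t\ge0$, $q(0,t)=q(L,t)$, the one-sided $x$-derivatives $q_x(0,t)$ (from the right) and $q_x(L,t)$ (from the left) exist, and $q_x(0,t)=q_x(L,t)$. -/

import Mathlib

open Filter Topology Asymptotics

namespace PeriodicNLS

noncomputable section

/-- `2 × 2` complex matrices. -/
abbrev Mat2 : Type := Matrix (Fin 2) (Fin 2) ℂ

/-! ### Geometry of the spectral plane -/

/-- The open quadrants `I`, `II`, `III`, `IV`. -/
def Q1 : Set ℂ := {z | 0 < z.re ∧ 0 < z.im}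
def Q2 : Set ℂ := {z | z.re < 0 ∧ 0 < z.im}
def Q3 : Set ℂ := {z | z.re < 0 ∧ z.im < 0}
def Q4 : Set ℂ := {z | 0 < z.re ∧ z.im < 0}

/-- The union of the closed vertical segments connecting `e j` with its conjugate. -/
def cuts {N : ℕ} (e : Fin (N + 1) → ℂ) : Set ℂ :=
  {z | ∃ j, z.re = (e j).re ∧ |z.im| ≤ (e j).im}

/-- The branch points `e j` and their conjugates. -/
def branchPts {N : ℕ} (e : Fin (N + 1) → ℂ) : Set ℂ :=
  {z | ∃ j, z = e j ∨ z = (starRingEnd ℂ) (e j)}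

/-- The points where parts of the contour cross: the origin and the points where the cuts meet
the real axis. -/
def crossPts {N : ℕ} (e : Fin (N + 1) → ℂ) : Set ℂ :=
  {z | z = 0 ∨ ∃ j, z = (((e j).re : ℝ) : ℂ)}

/-- The jump contour: real axis, imaginary axis and cuts. -/
def contour {N : ℕ} (e : Fin (N + 1) → ℂ) : Set ℂ :=
  {z | z.im = 0} ∪ {z | z.re = 0} ∪ cuts e

/-- The Schwarz conjugate `f*(z) = conj (f (conj z))`. -/
def schwarz (f : ℂ → ℂ) (z : ℂ) : ℂ := (starRingEnd ℂ) (f ((starRingEnd ℂ) z))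

/-- `exp (w σ₃)`. -/
def expσ₃ (w : ℂ) : Mat2 := !![Complex.exp w, 0; 0, Complex.exp (-w)]

/-! ### The direct scattering problem for the Zakharov–Shabat equation on `[0, L]` -/

/-- The potential matrix `U₁ = (0, q₀; - conj q₀, 0)`. -/
def potential (q₀ : ℝ → ℂ) (y : ℝ) : Mat2 := !![0, q₀ y; -(starRingEnd ℂ) (q₀ y), 0]

/-- The (entrywise) integral `∫_u^v e^{-iz(x-y)σ₃} U₁(y) Φ(y) dy`. -/
def volterra (q₀ : ℝ → ℂ) (z : ℂ) (Φ : ℝ → Mat2) (x u v : ℝ) : Mat2 :=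
  Matrix.of fun i j => ∫ y in u..v,
    (expσ₃ (-(Complex.I * z * ((x - y : ℝ) : ℂ))) * potential q₀ y * Φ y) i j

/-- `a` and `b` are the spectral functions of `q₀` on `[0, L]`: the solutions `Φ₂`, `Φ₃` of the
Zakharov–Shabat equation normalised at `x = 0` and at `x = L` respectively are related by
`Φ₃ = Φ₂ s`, with `s = (a*, b; -b*, a)`. -/
def IsSpectralPair (L : ℝ) (q₀ : ℝ → ℂ) (a b : ℂ → ℂ) : Prop :=
  ∃ Φ₂ Φ₃ : ℂ → ℝ → Mat2, ∀ z : ℂ,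
    ContinuousOn (Φ₂ z) (Set.Icc 0 L) ∧
    ContinuousOn (Φ₃ z) (Set.Icc 0 L) ∧
    ∀ x ∈ Set.Icc (0 : ℝ) L,
      Φ₂ z x = expσ₃ (-(Complex.I * z * x)) + volterra q₀ z (Φ₂ z) x 0 x ∧
      Φ₃ z x = expσ₃ (-(Complex.I * z * x)) - volterra q₀ z (Φ₃ z) x x L ∧
      Φ₃ z x = Φ₂ z x * !![schwarz a z, b z; -schwarz b z, a z]

/-- The discriminant (trace of the monodromy matrix)
`Δ(z) = e^{-izL} a(z) + e^{izL} a*(z)`. -/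
def discr (L : ℝ) (a : ℂ → ℂ) (z : ℂ) : ℂ :=
  Complex.exp (-(Complex.I * z * L)) * a z + Complex.exp (Complex.I * z * L) * schwarz a z

/-- The points `e j` lie in the open upper half-plane off the imaginary axis, are distinct, and
together with their conjugates they are precisely the simple zeros of `Δ² - 4`. -/
structure IsMainSpectrum {N : ℕ} (L : ℝ) (a : ℂ → ℂ) (e : Fin (N + 1) → ℂ) : Prop where
  im_pos : ∀ j, 0 < (e j).im
  re_ne : ∀ j, (e j).re ≠ 0
  injective : Function.Injective e
  simple_zeros : ∀ w : ℂ,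
    analyticOrderAt (fun z => discr L a z ^ 2 - 4) w = 1 ↔ w ∈ branchPts e

/-! ### The function `R` -/

/-- Boundary values on a vertical segment oriented upwards: the `+` side is the left one. -/
def bvPlus (f : ℂ → ℂ) (p : ℂ) : ℂ := limUnder (𝓝[{w | w.re < p.re}] p) f
def bvMinus (f : ℂ → ℂ) (p : ℂ) : ℂ := limUnder (𝓝[{w | p.re < w.re}] p) f

/-- `ξ` is a pole of `f`. -/
def IsPole (f : ℂ → ℂ) (ξ : ℂ) : Prop := meromorphicOrderAt f ξ < 0

/-- The residue of `f` at a simple pole `ξ`. -/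
def residue (f : ℂ → ℂ) (ξ : ℂ) : ℂ := limUnder (𝓝[≠] ξ) fun z => (z - ξ) * f z

/-- `R` is the branch, meromorphic off the cuts and vanishing at infinity, of the solution of
`e^{2izL} b* R² + (e^{2izL} a* - a) R + b = 0`. (Meromorphic in normal form: removable
singularities are removed.) It has finite boundary values on both sides of the cuts away from
the branch points, no poles on the coordinate axes, and only simple poles in the quadrants
`I`, `III`. -/
structure IsBranch {N : ℕ} (L : ℝ) (a b : ℂ → ℂ) (e : Fin (N + 1) → ℂ) (R : ℂ → ℂ) :
    Prop where
  meromorphic : MeromorphicNFOn R (cuts e)ᶜ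
  equation : ∀ z ∉ cuts e, ¬ IsPole R z →
    Complex.exp (2 * Complex.I * z * L) * schwarz b z * R z ^ 2
      + (Complex.exp (2 * Complex.I * z * L) * schwarz a z - a z) * R z + b z = 0
  decay : Tendsto R (cocompact ℂ) (𝓝 0)
  left_values : ∀ p ∈ cuts e \ branchPts e, ∃ c, Tendsto R (𝓝[{w | w.re < p.re}] p) (𝓝 c)
  right_values : ∀ p ∈ cuts e \ branchPts e, ∃ c, Tendsto R (𝓝[{w | p.re < w.re}] p) (𝓝 c)
  poles_off_axes : ∀ ξ ∉ cuts e, IsPole R ξ → ξ.re ≠ 0 ∧ ξ.im ≠ 0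
  poles_simple : ∀ ξ ∈ (Q1 ∪ Q3) \ cuts e, IsPole R ξ → meromorphicOrderAt R ξ = -1

/-! ### The data of the Riemann–Hilbert problem -/

def funG (a b R : ℂ → ℂ) (z : ℂ) : ℂ :=
  -(schwarz R z) / (a z * (a z + b z * schwarz R z))

def funG₂ (a b R : ℂ → ℂ) (z : ℂ) : ℂ := R z - b z / a z

/-- `J₀` on the positive real half-axis. -/
def J₀RealPos (a b R : ℂ → ℂ) (z : ℂ) : Mat2 :=
  !![1, 0; schwarz (funG₂ a b R) z, 1] *
    !![1, b z / a z; schwarz (fun w => b w / a w) z, 1 + ((‖b z / a z‖ ^ 2 : ℝ) : ℂ)] *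
    !![1, funG₂ a b R z; 0, 1]

/-- `J₀` on the negative real half-axis. -/
def J₀RealNeg (a b R : ℂ → ℂ) (z : ℂ) : Mat2 :=
  !![1, schwarz (funG a b R) z; 0, 1] *
    !![1 + ((‖schwarz b z / a z‖ ^ 2 : ℝ) : ℂ), schwarz (fun w => schwarz b w / a w) z;
      schwarz b z / a z, 1] *
    !![1, 0; funG a b R z, 1]

/-- `J₀` on the positive imaginary half-axis. -/
def J₀ImagPos (a b R : ℂ → ℂ) (z : ℂ) : Mat2 :=
  !![1, -(funG₂ a b R z); 0, 1] * !![(a z)⁻¹, 0; 0, a z] * !![1, 0; funG a b R z, 1]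

/-- `J₀` on the negative imaginary half-axis. -/
def J₀ImagNeg (a b R : ℂ → ℂ) (z : ℂ) : Mat2 :=
  !![1, schwarz (funG a b R) z; 0, 1] * !![(schwarz a z)⁻¹, 0; 0, schwarz a z] *
    !![1, 0; -(schwarz (funG₂ a b R) z), 1]

open Classical in
/-- `J₀` on the cuts (four cases according to the quadrant). -/
def J₀Cut (L : ℝ) (R : ℂ → ℂ) (z : ℂ) : Mat2 :=
  if z ∈ Q1 then !![1, bvPlus R z - bvMinus R z; 0, 1]
  else if z ∈ Q2 then
    !![1, 0; Complex.exp (-(2 * Complex.I * z * L)) *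
      (bvMinus (schwarz R) z - bvPlus (schwarz R) z), 1]
  else if z ∈ Q3 then
    !![1, Complex.exp (2 * Complex.I * z * L) * (bvPlus R z - bvMinus R z); 0, 1]
  else !![1, 0; bvMinus (schwarz R) z - bvPlus (schwarz R) z, 1]

/-- `e^{-(izx + 2iz²t)σ₃} J e^{(izx + 2iz²t)σ₃}`. -/
def evolve (x t : ℝ) (z : ℂ) (J : Mat2) : Mat2 :=
  expσ₃ (-(Complex.I * z * x + 2 * Complex.I * z ^ 2 * t)) * J *
    expσ₃ (Complex.I * z * x + 2 * Complex.I * z ^ 2 * t)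

/-- At `p` the matrix function `m` has a limit from the `+` side `U` and a limit from the `-`
side `V`, and, provided that `J` is defined at `p` (condition `D`), `m⁺ = m⁻ J`. -/
def HasJump (m : ℂ → Mat2) (U V : Set ℂ) (p : ℂ) (D : Prop) (J : Mat2) : Prop :=
  ∃ A B : Mat2, Tendsto m (𝓝[U] p) (𝓝 A) ∧ Tendsto m (𝓝[V] p) (𝓝 B) ∧ (D → A = B * J)

/-- The column `k'` of `m` is analytic at `ξ`, the column `k` has at most a simple pole there and
its residue is `c` times the value of the column `k'`. -/
def HasResidue (m : ℂ → Mat2) (ξ : ℂ) (k k' : Fin 2) (c : ℂ) : Prop :=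
  ∀ i, AnalyticAt ℂ (fun z => m z i k') ξ ∧
    Tendsto (fun z => (z - ξ) * m z i k) (𝓝[≠] ξ) (𝓝 (c * m ξ i k'))

/-- The poles entering the residue conditions: poles of `R` in `I ∪ III` and poles of `R*` in
`II ∪ IV`. -/
def rhPoles {N : ℕ} (e : Fin (N + 1) → ℂ) (R : ℂ → ℂ) : Set ℂ :=
  {ξ | ξ ∉ cuts e ∧
    (ξ ∈ Q1 ∪ Q3 ∧ IsPole R ξ ∨ ξ ∈ Q2 ∪ Q4 ∧ IsPole (schwarz R) ξ)}

/-- `m = M(x, t, ·)` solves the basic Riemann–Hilbert problem with parameters `x`, `t`.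
Orientation: the real axis from left to right, both imaginary half-axes towards infinity, the
cuts upwards; the `+` side is on the left. At the points where `J₀` is discontinuous or
the contour is not smooth, `m` is bounded (crossing points) or has at most an inverse square root
singularity (branch points). -/
structure IsRHSolution {N : ℕ} (L : ℝ) (a b : ℂ → ℂ) (e : Fin (N + 1) → ℂ) (R : ℂ → ℂ)
    (x t : ℝ) (m : ℂ → Mat2) : Prop where
  analytic : ∀ z ∉ contour e, z ∉ rhPoles e R → ∀ i j, AnalyticAt ℂ (fun w => m w i j) z
  jump_real_pos : ∀ p : ℂ, p.im = 0 → 0 < p.re → p ∉ crossPts e →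
    HasJump m {z | 0 < z.im} {z | z.im < 0} p (a p ≠ 0) (evolve x t p (J₀RealPos a b R p))
  jump_real_neg : ∀ p : ℂ, p.im = 0 → p.re < 0 → p ∉ crossPts e →
    HasJump m {z | 0 < z.im} {z | z.im < 0} p (a p ≠ 0) (evolve x t p (J₀RealNeg a b R p))
  jump_imag_pos : ∀ p : ℂ, p.re = 0 → 0 < p.im →
    HasJump m {z | z.re < 0} {z | 0 < z.re} p (a p ≠ 0) (evolve x t p (J₀ImagPos a b R p))
  jump_imag_neg : ∀ p : ℂ, p.re = 0 → p.im < 0 →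
    HasJump m {z | 0 < z.re} {z | z.re < 0} p (schwarz a p ≠ 0)
      (evolve x t p (J₀ImagNeg a b R p))
  jump_cut : ∀ p ∈ cuts e, p ∉ branchPts e → p ∉ crossPts e →
    HasJump m {z | z.re < p.re} {z | p.re < z.re} p True (evolve x t p (J₀Cut L R p))
  res_I : ∀ ξ ∈ Q1 \ cuts e, IsPole R ξ →
    HasResidue m ξ 1 0
      (Complex.exp (-(2 * Complex.I * ξ * x) - 4 * Complex.I * ξ ^ 2 * t) * residue R ξ)
  res_II : ∀ ξ ∈ Q2 \ cuts e, IsPole (schwarz R) ξ →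
    HasResidue m ξ 0 1
      (-(Complex.exp (2 * Complex.I * ξ * (x - L) + 4 * Complex.I * ξ ^ 2 * t)
        * residue (schwarz R) ξ))
  res_III : ∀ ξ ∈ Q3 \ cuts e, IsPole R ξ →
    HasResidue m ξ 1 0
      (Complex.exp (-(2 * Complex.I * ξ * (x - L)) - 4 * Complex.I * ξ ^ 2 * t) * residue R ξ)
  res_IV : ∀ ξ ∈ Q4 \ cuts e, IsPole (schwarz R) ξ →
    HasResidue m ξ 0 1
      (-(Complex.exp (2 * Complex.I * ξ * x + 4 * Complex.I * ξ ^ 2 * t)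
        * residue (schwarz R) ξ))
  bounded_cross : ∀ p ∈ crossPts e, ∀ i j,
    (fun z => m z i j) =O[𝓝[(contour e)ᶜ] p] fun _ => (1 : ℝ)
  branch_sing : ∀ p ∈ branchPts e, ∀ i j,
    (fun z => m z i j) =O[𝓝[(contour e)ᶜ] p] fun z => ‖z - p‖ ^ (-(1 / 2) : ℝ)
  normalized : Tendsto m (cocompact ℂ ⊓ 𝓟 (contour e)ᶜ) (𝓝 1)

/-- `q(x,t) = 2i [M₁]₁₂(x,t)`, where `[M₁]₁₂` is the coefficient of `1/z` of the `12` entry of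
`M(x,t,z)` as `z → ∞`. It is read off in the first quadrant: for `t > 0` the other quadrants give
the same coefficient along non-tangential directions, but at the corners `t = 0`, `x ∈ {0, L}`
some of them do not. -/
def IsPotentialOf (L : ℝ) (M : ℝ → ℝ → ℂ → Mat2) (q : ℝ → ℝ → ℂ) : Prop :=
  ∀ x ∈ Set.Icc (0 : ℝ) L, ∀ t : ℝ, 0 ≤ t →
    Tendsto (fun z : ℂ => 2 * Complex.I * (z * M x t z 0 1)) (cocompact ℂ ⊓ 𝓟 Q1) (𝓝 (q x t))

/-! ### The transformation matrices at `x = 0` and `x = L` -/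

open Classical in
/-- The piecewise analytic matrix `P^{(t)}(t,z)`. -/
def matP (a b R : ℂ → ℂ) (t : ℝ) (z : ℂ) : Mat2 :=
  if z ∈ Q2 then
    !![a z + b z * schwarz R z, -(b z * Complex.exp (-(4 * Complex.I * z ^ 2 * t)));
      0, schwarz a z + schwarz b z * R z]
  else if z ∈ Q3 then
    !![a z + b z * schwarz R z, 0;
      schwarz b z * Complex.exp (4 * Complex.I * z ^ 2 * t), schwarz a z + schwarz b z * R z]
  else 1

open Classical in
/-- The piecewise analytic matrix `P̂^{(t)}(t,z)`. -/
def matPhat (L : ℝ) (a b R : ℂ → ℂ) (t : ℝ) (z : ℂ) : Mat2 :=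
  if z ∈ Q1 then
    !![schwarz a z + schwarz b z * R z, 0;
      -(schwarz b z * Complex.exp (2 * Complex.I * z * L) *
        Complex.exp (4 * Complex.I * z ^ 2 * t)), a z + b z * schwarz R z]
  else if z ∈ Q4 then
    !![schwarz a z + schwarz b z * R z,
        b z * Complex.exp (-(2 * Complex.I * z * L)) * Complex.exp (-(4 * Complex.I * z ^ 2 * t));
      0, a z + b z * schwarz R z]
  else 1

end

end PeriodicNLS

namespace PeriodicNLS

noncomputable section

/-! ### Analytic continuation across contours -/

/-! The jumps of `M(x,t,·)` are trivial up to explicit factors. Multiplied on the right by the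
quadrantwise matrix `dress` (the free exponential, a triangular factor built from `R` or `R*`, and
in the left half-plane the inverse of the scattering matrix), `M` loses all its jumps and poles.
What remains are isolated points where the product grows more slowly than a simple pole, so the
product extends to an entire matrix `F(x,t,·)`, of determinant one by Liouville's theorem
(`extendsAt_dressed`, `exists_entire`).

The columns of `blochMat` are eigenvectors of the monodromy matrix `T = s e^{izLσ₃}`, with
eigenvalues `e^{izL}(a* + b*R)` and `e^{-izL}(a + bR*)`. For `0 ≤ x ≤ L` and `t ≥ 0` every
exponential left over in `F · blochMat` is bounded in its quadrant. Hence `F · blochMat = A ·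
e^{-(izx+2iz²t)σ₃} · blochNorm` near infinity, with `A → 1` in all directions off the contour
(`exists_entire_asymptotics`).

Comparing the two ends, `F(L) T F(0)⁻¹` is entire. The asymptotics turn it into `A₁ D A₀⁻¹` with `D`
the diagonal matrix of Floquet multipliers, which is bounded near infinity and tends to the identity
as `Im z → ∞`. By Liouville's theorem `F(0) = F(L) T` (`entire_eq_mul_monodromy`). Undoing the
dressings quadrant by quadrant gives the first assertion (`transformed_eq`), and its `12` entry in
`Q1` gives the equality of the end values of `q`.

For the derivative no differential equation in `x` is used. For a base point `x₀` put `V = F(x₀) ·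
blochMat`. The entire matrix `F(x) F(x₀)⁻¹`, times the loop `V e^{iz(x-x₀)σ₃} V⁻¹`, is analytic near
infinity and tends to `1` there: a Birkhoff factorisation of a loop close to the identity. An `L²`
argument on a circle (`factorization_estimate`) shows that the `1/z` coefficient is linear in the
loop up to a quadratic error. So `q` has a one-sided derivative at `x₀`, given by a circle average
of the generator `loopGen` (`exists_potential_estimate`). Since `T` acts diagonally on the Bloch
vectors, `F(0) = F(L) T` forces equal generators at the two ends, hence equal derivatives.

The inputs on the scattering side are that `a`, `b` are entire with half-plane bounds
(`IsSpectralPair.spectralData`), that `R` is milder than a pole at the branch points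
(`IsBranch.branch_point`), and that the two multipliers are mutually inverse
(`IsBranch.multiplier`). -/

/-- Near `p`, the restriction of `f` to `S` is the restriction of an analytic function. -/
def ExtendsAt (f : ℂ → ℂ) (S : Set ℂ) (p : ℂ) : Prop :=
  ∃ h : ℂ → ℂ, AnalyticAt ℂ h p ∧ ∀ᶠ z in 𝓝 p, z ∈ S → f z = h z

/-- If the line crosses the rectangle, cut along it. Cauchy's theorem needs only continuity on each
closed half, and the two contributions along the cut cancel. -/
theorem rect_integral_eq_zero_of_off_vertical {f : ℂ → ℂ} {c : ℝ} {z w : ℂ}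
    (hc : ContinuousOn f (Set.uIcc z.re w.re ×ℂ Set.uIcc z.im w.im))
    (hd : ∀ u ∈ Set.uIcc z.re w.re ×ℂ Set.uIcc z.im w.im, u.re ≠ c → DifferentiableAt ℂ f u) :
    (∫ x : ℝ in z.re..w.re, f (x + z.im * Complex.I)) -
      (∫ x : ℝ in z.re..w.re, f (x + w.im * Complex.I)) +
      Complex.I • (∫ y : ℝ in z.im..w.im, f (w.re + y * Complex.I)) -
      Complex.I • (∫ y : ℝ in z.im..w.im, f (z.re + y * Complex.I)) = 0 := by
  by_cases hcm : c ∈ Set.uIcc z.re w.re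
  · have key : ∀ u v : ℂ, Set.uIcc u.re v.re ⊆ Set.uIcc z.re w.re → u.im = z.im → v.im = w.im →
        c ∉ Set.Ioo (min u.re v.re) (max u.re v.re) →
        (∫ x : ℝ in u.re..v.re, f (x + u.im * Complex.I)) -
          (∫ x : ℝ in u.re..v.re, f (x + v.im * Complex.I)) +
          Complex.I • (∫ y : ℝ in u.im..v.im, f (v.re + y * Complex.I)) -
          Complex.I • (∫ y : ℝ in u.im..v.im, f (u.re + y * Complex.I)) = 0 := by
      intro u v huv hu hv hcuv
      apply Complex.integral_boundary_rect_eq_zero_of_continuousOn_of_differentiableOn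
      · rw [hu, hv]
        exact hc.mono fun s hs => ⟨huv hs.1, hs.2⟩
      · intro s hs
        refine (hd s ⟨huv (Set.Ioo_subset_Icc_self hs.1), ?_⟩ ?_).differentiableWithinAt
        · rw [← hu, ← hv]; exact Set.Ioo_subset_Icc_self hs.2
        · rintro rfl; exact hcuv hs.1
    have hs1 : Set.uIcc z.re c ⊆ Set.uIcc z.re w.re := Set.uIcc_subset_uIcc_left hcm
    have hs2 : Set.uIcc c w.re ⊆ Set.uIcc z.re w.re := Set.uIcc_subset_uIcc_right hcm
    have k1 := key z ⟨c, w.im⟩ hs1 rfl rfl (by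
      simp only [Set.mem_Ioo, not_and, not_lt]; intro h
      rcases le_total z.re c with h1 | h1
      · simp [h1]
      · simp [h1] at h)
    have k2 := key ⟨c, z.im⟩ w hs2 rfl rfl (by
      simp only [Set.mem_Ioo, not_and, not_lt]; intro h
      rcases le_total w.re c with h1 | h1
      · simp [h1]
      · simp [h1] at h)
    simp only at k1 k2
    have hint : ∀ (y : ℝ), y ∈ Set.uIcc z.im w.im → ∀ a b : ℝ,
        Set.uIcc a b ⊆ Set.uIcc z.re w.re →
        IntervalIntegrable (fun x : ℝ => f (x + y * Complex.I)) MeasureTheory.volume a b := by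
      intro y hy a b hab
      refine ContinuousOn.intervalIntegrable ?_
      refine hc.comp (by fun_prop) fun x hx => ?_
      rw [Complex.mem_reProdIm]
      simpa using ⟨hab hx, hy⟩
    have a1 := intervalIntegral.integral_add_adjacent_intervals
      (hint z.im Set.left_mem_uIcc _ _ hs1) (hint z.im Set.left_mem_uIcc _ _ hs2)
    have a2 := intervalIntegral.integral_add_adjacent_intervals
      (hint w.im Set.right_mem_uIcc _ _ hs1) (hint w.im Set.right_mem_uIcc _ _ hs2)
    rw [← a1, ← a2]
    linear_combination k1 + k2
  · apply Complex.integral_boundary_rect_eq_zero_of_continuousOn_of_differentiableOn _ _ _ hc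
    intro s hs
    have h1 : s ∈ Set.uIcc z.re w.re ×ℂ Set.uIcc z.im w.im :=
      ⟨Set.Ioo_subset_Icc_self hs.1, Set.Ioo_subset_Icc_self hs.2⟩
    exact (hd s h1 fun h => hcm (h ▸ h1.1)).differentiableWithinAt

/-- Morera's theorem: a vertical line is invisible to rectangle integrals of a continuous function.
-/
theorem differentiableOn_ball_of_off_vertical {f : ℂ → ℂ} {p : ℂ} {r c : ℝ}
    (hc : ContinuousOn f (Metric.ball p r))
    (hd : ∀ u ∈ Metric.ball p r, u.re ≠ c → DifferentiableAt ℂ f u) :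
    DifferentiableOn ℂ f (Metric.ball p r) := by
  refine (Complex.isConservativeOn_and_continuousOn_iff_isDifferentiableOn Metric.isOpen_ball).1
    ⟨fun z w hzw => ?_, hc⟩
  rw [← add_eq_zero_iff_eq_neg, Complex.wedgeIntegral_add_wedgeIntegral_eq]
  exact rect_integral_eq_zero_of_off_vertical (hc.mono hzw) fun u hu => hd u (hzw hu)

theorem vertical_compl (c : ℝ) :
    {z : ℂ | z.re ≠ c} = {z | z.re < c} ∪ {z | c < z.re} := by
  ext z; simp [lt_or_lt_iff_ne]

theorem mem_closure_vertical_compl (c : ℝ) (z : ℂ) : z ∈ closure {w : ℂ | w.re ≠ c} := by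
  by_cases h : z.re = c
  · have h1 : z ∈ closure {w : ℂ | w.re < c} := by
      rw [Complex.closure_setOfPred_re_lt]; exact h.le
    exact closure_mono (fun w hw => ne_of_lt hw) h1
  · exact subset_closure h

/-- Two-sided continuation across a vertical line. -/
theorem extendsAt_vertical {f : ℂ → ℂ} {p : ℂ} {r : ℝ} (hr : 0 < r)
    (hd : ∀ z ∈ Metric.ball p r, z.re ≠ p.re → DifferentiableAt ℂ f z)
    (hl : ∀ z ∈ Metric.ball p r, z.re = p.re → ∃ c,
      Tendsto f (𝓝[{w | w.re < p.re}] z) (𝓝 c) ∧ Tendsto f (𝓝[{w | p.re < w.re}] z) (𝓝 c)) :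
    ExtendsAt f {z | z.re ≠ p.re} p := by
  set A : Set ℂ := {z | z.re ≠ p.re} with hA
  have hAo : IsOpen A := by
    rw [hA, vertical_compl]
    exact (isOpen_lt Complex.continuous_re continuous_const).union
      (isOpen_lt continuous_const Complex.continuous_re)
  have hlim : ∀ z ∈ Metric.ball p r, ∃ y, Tendsto f (𝓝[A] z) (𝓝 y) := by
    intro z hz
    by_cases h : z.re = p.re
    · obtain ⟨c, h1, h2⟩ := hl z hz h
      refine ⟨c, ?_⟩
      rw [hA, vertical_compl, nhdsWithin_union]
      exact h1.sup h2
    · exact ⟨f z, (hd z hz h).continuousAt.continuousWithinAt⟩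
  have hcont : ContinuousOn (extendFrom A f) (Metric.ball p r) :=
    continuousOn_extendFrom (fun z _ => mem_closure_vertical_compl _ z) hlim
  have heq : ∀ z ∈ Metric.ball p r, z ∈ A → extendFrom A f z = f z := fun z hz hzA =>
    extendFrom_eq (mem_closure_vertical_compl _ z)
      (hd z hz hzA).continuousAt.continuousWithinAt
  have hdiff := differentiableOn_ball_of_off_vertical (c := p.re) hcont fun u hu hne => by
    refine (hd u hu hne).congr_of_eventuallyEq ?_
    filter_upwards [Metric.isOpen_ball.mem_nhds hu, hAo.mem_nhds hne] with v h1 h2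
      using heq v h1 h2
  refine ⟨extendFrom A f, hdiff.analyticAt (Metric.ball_mem_nhds p hr), ?_⟩
  filter_upwards [Metric.ball_mem_nhds p hr] with z hz hzA using (heq z hz hzA).symm

/-- Two-sided continuation across a horizontal line. -/
theorem extendsAt_horizontal {f : ℂ → ℂ} {p : ℂ} {r : ℝ} (hr : 0 < r)
    (hd : ∀ z ∈ Metric.ball p r, z.im ≠ p.im → DifferentiableAt ℂ f z)
    (hl : ∀ z ∈ Metric.ball p r, z.im = p.im → ∃ c,
      Tendsto f (𝓝[{w | w.im < p.im}] z) (𝓝 c) ∧ Tendsto f (𝓝[{w | p.im < w.im}] z) (𝓝 c)) :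
    ExtendsAt f {z | z.im ≠ p.im} p := by
  have hI : ∀ z w : ℂ, dist (Complex.I * z) (Complex.I * w) = dist z w := by
    intro z w; rw [dist_eq_norm, ← mul_sub]; simp [dist_eq_norm]
  have hp : Complex.I * (-Complex.I * p) = p := by
    rw [← mul_assoc]; simp
  have hre : (-Complex.I * p).re = p.im := by simp
  have hmem : ∀ z ∈ Metric.ball (-Complex.I * p) r, Complex.I * z ∈ Metric.ball p r := by
    intro z hz
    rw [Metric.mem_ball, ← hp, hI]; exact hz
  have hrot : ∀ (z : ℂ) (U V : Set ℂ), (∀ w ∈ U, Complex.I * w ∈ V) →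
      Tendsto (fun w => Complex.I * w) (𝓝[U] z) (𝓝[V] (Complex.I * z)) := by
    intro z U V hUV
    refine tendsto_nhdsWithin_iff.2 ⟨?_, ?_⟩
    · exact ((continuous_const.mul continuous_id).tendsto z).mono_left nhdsWithin_le_nhds
    · filter_upwards [self_mem_nhdsWithin] with w hw using hUV w hw
  have key : ExtendsAt (fun z => f (Complex.I * z)) {z | z.re ≠ (-Complex.I * p).re}
      (-Complex.I * p) := by
    refine extendsAt_vertical hr ?_ ?_
    · intro z hz hne
      refine DifferentiableAt.fun_comp' z (hd _ (hmem z hz) ?_) (by fun_prop)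
      simpa [hre] using hne
    · intro z hz heq
      obtain ⟨c, h1, h2⟩ := hl _ (hmem z hz) (by simpa [hre] using heq)
      exact ⟨c, h1.comp (hrot z _ _ fun w hw => by simpa using hw),
        h2.comp (hrot z _ _ fun w hw => by simpa using hw)⟩
  obtain ⟨h, ha, he⟩ := key
  refine ⟨fun z => h (-Complex.I * z), ?_, ?_⟩
  · exact AnalyticAt.fun_comp (f := fun z => -Complex.I * z) ha (by fun_prop)
  · have ht : Tendsto (fun z : ℂ => -Complex.I * z) (𝓝 p) (𝓝 (-Complex.I * p)) :=
      (continuous_const.mul continuous_id).tendsto p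
    filter_upwards [ht.eventually he] with z hz hzS
    rw [← hz (by simpa using hzS)]
    congr 1
    linear_combination z * Complex.I_mul_I

theorem ExtendsAt.mono {f : ℂ → ℂ} {S S' : Set ℂ} {p : ℂ} (h : ExtendsAt f S' p)
    (hS : ∀ᶠ z in 𝓝 p, z ∈ S → z ∈ S') : ExtendsAt f S p := by
  obtain ⟨g, hg, he⟩ := h
  refine ⟨g, hg, ?_⟩
  filter_upwards [hS, he] with z h1 h2 h3 using h2 (h1 h3)

theorem ExtendsAt.congr {f g : ℂ → ℂ} {S : Set ℂ} {p : ℂ} (h : ExtendsAt f S p)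
    (hS : ∀ᶠ z in 𝓝 p, z ∈ S → g z = f z) : ExtendsAt g S p := by
  obtain ⟨k, hk, he⟩ := h
  refine ⟨k, hk, ?_⟩
  filter_upwards [hS, he] with z h1 h2 h3
  rw [h1 h3, h2 h3]

theorem ExtendsAt.tendsto {f : ℂ → ℂ} {S : Set ℂ} {p : ℂ} (h : ExtendsAt f S p) :
    ∃ c, Tendsto f (𝓝[S] p) (𝓝 c) := by
  obtain ⟨k, hk, he⟩ := h
  refine ⟨k p, (hk.continuousAt.tendsto.mono_left nhdsWithin_le_nhds).congr' ?_⟩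
  filter_upwards [nhdsWithin_le_nhds he, self_mem_nhdsWithin] with z h1 h2 using (h1 h2).symm

/-- Density of `S` forces every local continuation to coincide with `extendFrom S f`, so the local
continuations glue into one global function. -/
theorem ExtendsAt.extendFrom {f : ℂ → ℂ} {S : Set ℂ} {p : ℂ} (hS : Dense S)
    (h : ExtendsAt f S p) :
    AnalyticAt ℂ (extendFrom S f) p ∧ ∀ᶠ z in 𝓝 p, z ∈ S → extendFrom S f z = f z := by
  obtain ⟨k, hk, he⟩ := h
  have h1 : ∀ᶠ z in 𝓝 p, k z = _root_.extendFrom S f z := by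
    filter_upwards [he.eventually_nhds, hk.eventually_analyticAt] with z hz hkz
    refine (extendFrom_eq (hS z) ?_).symm
    refine (hkz.continuousAt.tendsto.mono_left nhdsWithin_le_nhds).congr' ?_
    filter_upwards [nhdsWithin_le_nhds hz, self_mem_nhdsWithin] with z h1 h2 using (h1 h2).symm
  refine ⟨hk.congr h1, ?_⟩
  filter_upwards [h1, he] with z h2 h3 h4
  rw [← h2, h3 h4]

/-- Removable singularities of a function known on a dense set. -/
theorem extendsAt_of_removable {f : ℂ → ℂ} {S : Set ℂ} {p : ℂ} (hS : Dense S) (hp : p ∉ S)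
    (h1 : ∀ᶠ z in 𝓝[≠] p, ExtendsAt f S z)
    (h2 : Tendsto (fun z => (z - p) * f z) (𝓝[S] p) (𝓝 0)) : ExtendsAt f S p := by
  set F := extendFrom S f with hF
  set G : ℂ → ℂ := fun z => (z - p) * F z with hG
  have hFan : ∀ᶠ z in 𝓝[≠] p, AnalyticAt ℂ F z ∧ ∀ᶠ w in 𝓝 z, w ∈ S → F w = f w := by
    filter_upwards [h1] with z hz using hz.extendFrom hS
  have hGd : ∀ᶠ z in 𝓝[≠] p, DifferentiableAt ℂ G z := by
    filter_upwards [hFan] with z hz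
    exact ((differentiableAt_id.sub_const p).mul hz.1.differentiableAt)
  have hGc : ContinuousAt G p := by
    rw [continuousAt_iff_punctured_nhds]
    have : G p = 0 := by simp [hG]
    rw [this, Metric.tendsto_nhdsWithin_nhds]
    intro ε hε
    obtain ⟨δ, hδ, hb⟩ := (Metric.tendsto_nhdsWithin_nhds.1 h2) (ε / 2) (half_pos hε)
    obtain ⟨δ', hδ', hb'⟩ := Metric.mem_nhdsWithin_iff.1 hFan
    refine ⟨min δ δ', lt_min hδ hδ', fun {z} hz hzd => ?_⟩
    obtain ⟨hz1, hz2⟩ := hb' ⟨lt_of_lt_of_le hzd (min_le_right _ _), hz⟩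
    -- The growth bound is known on `S` only. At a nearby point where `F` is already analytic,
    -- density carries it over to `G`.
    have hcl : Tendsto (fun w => (w - p) * F w) (𝓝[S] z) (𝓝 (G z)) :=
      (((continuousAt_id.sub continuousAt_const).mul hz1.continuousAt).tendsto).mono_left
        nhdsWithin_le_nhds
    have : (𝓝[S] z).NeBot := mem_closure_iff_nhdsWithin_neBot.1 (hS z)
    have hle : ‖G z‖ ≤ ε / 2 := by
      refine le_of_tendsto hcl.norm ?_
      filter_upwards [nhdsWithin_le_nhds hz2, self_mem_nhdsWithin, nhdsWithin_le_nhds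
        (Metric.isOpen_ball.mem_nhds (lt_of_lt_of_le hzd (min_le_left _ _) :
          z ∈ Metric.ball p δ))] with w hw1 hw2 hw3
      have := hb hw2 hw3
      rw [dist_zero_right] at this
      rw [hw1 hw2]; exact this.le
    rw [dist_zero_right]; linarith
  have hGan : AnalyticAt ℂ G p :=
    Complex.analyticAt_of_differentiable_on_punctured_nhds_of_continuousAt hGd hGc
  -- `G` vanishes at `p`, so dividing it by `z - p` gives the continuation of `f`.
  have hds : AnalyticAt ℂ (dslope G p) p := by
    rw [Complex.analyticAt_iff_eventually_differentiableAt] at hGan ⊢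
    obtain ⟨U, hU, hUo, hpU⟩ := eventually_nhds_iff.1 hGan
    have hUn := hUo.mem_nhds hpU
    have := (Complex.differentiableOn_dslope hUn).2
      fun z hz => (hU z hz).differentiableWithinAt
    filter_upwards [hUn] with z hz using this.differentiableAt (hUo.mem_nhds hz)
  refine ⟨dslope G p, hds, ?_⟩
  rw [eventually_nhdsWithin_iff] at hFan
  filter_upwards [hFan] with z hz hzS
  have hne : z ≠ p := fun h => hp (h ▸ hzS)
  rw [dslope_of_ne _ hne, slope_def_field, ← (hz hne).2.self_of_nhds hzS, hG]
  have : z - p ≠ 0 := sub_ne_zero.2 hne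
  field_simp
  ring

theorem differentiable_extendFrom {f : ℂ → ℂ} {S : Set ℂ} (hS : Dense S)
    (h : ∀ p, ExtendsAt f S p) :
    Differentiable ℂ (extendFrom S f) ∧ ∀ z ∈ S, extendFrom S f z = f z :=
  ⟨fun p => ((h p).extendFrom hS).1.differentiableAt,
    fun z hz => ((h z).extendFrom hS).2.self_of_nhds hz⟩

/-- Liouville's theorem for functions controlled on a dense set. -/
theorem eq_const_of_eventually_bounded {F : ℂ → ℂ} {S : Set ℂ} (hF : Differentiable ℂ F)
    (hS : Dense S) {C : ℝ} (hb : ∀ᶠ z in cocompact ℂ ⊓ 𝓟 S, ‖F z‖ ≤ C) (z w : ℂ) :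
    F z = F w := by
  rw [eventually_inf_principal] at hb
  obtain ⟨r, hr⟩ : ∃ r : ℝ, ∀ z : ℂ, r < ‖z‖ → z ∈ S → ‖F z‖ ≤ C := by
    rw [← Metric.cobounded_eq_cocompact, ← comap_norm_atTop, eventually_comap] at hb
    obtain ⟨r, hr⟩ := eventually_atTop.1 hb
    exact ⟨r, fun z hz => hr _ hz.le z rfl⟩
  have hout : ∀ z : ℂ, r < ‖z‖ → ‖F z‖ ≤ C := by
    intro z hz
    have : (𝓝[S] z).NeBot := mem_closure_iff_nhdsWithin_neBot.1 (hS z)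
    refine le_of_tendsto ((hF z).continuousAt.tendsto.norm.mono_left
      (nhdsWithin_le_nhds (s := S))) ?_
    filter_upwards [self_mem_nhdsWithin, nhdsWithin_le_nhds
      ((isOpen_lt continuous_const continuous_norm).mem_nhds hz)] with w h1 h2 using hr w h2 h1
  obtain ⟨C', hC'⟩ := (isCompact_closedBall (0 : ℂ) r).exists_bound_of_continuousOn
    hF.continuous.continuousOn
  refine hF.apply_eq_apply_of_bounded ?_ z w
  refine (isBounded_iff_forall_norm_le.2 ⟨max C C', ?_⟩)
  rintro _ ⟨u, rfl⟩
  rcases le_or_gt ‖u‖ r with h | h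
  · exact (hC' u (by simpa using h)).trans (le_max_right _ _)
  · exact (hout u h).trans (le_max_left _ _)

theorem eq_const_of_tendsto {F : ℂ → ℂ} {S : Set ℂ} (hF : Differentiable ℂ F)
    (hS : Dense S) [(cocompact ℂ ⊓ 𝓟 S).NeBot] {c : ℂ}
    (hb : Tendsto F (cocompact ℂ ⊓ 𝓟 S) (𝓝 c)) (z : ℂ) : F z = c := by
  have h1 : ∀ᶠ z in cocompact ℂ ⊓ 𝓟 S, ‖F z‖ ≤ ‖c‖ + 1 := by
    filter_upwards [hb.norm.eventually (gt_mem_nhds (lt_add_one ‖c‖))] with z hz using hz.le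
  refine tendsto_nhds_unique (tendsto_const_nhds.congr fun w => ?_) hb
  exact eq_const_of_eventually_bounded hF hS h1 z w

end

end PeriodicNLS

namespace PeriodicNLS

noncomputable section

/-! ### The spectral functions -/

theorem schwarz_schwarz (f : ℂ → ℂ) (z : ℂ) : schwarz (schwarz f) z = f z := by
  simp [schwarz]

theorem _root_.Differentiable.schwarz {f : ℂ → ℂ} (hf : Differentiable ℂ f) :
    Differentiable ℂ (schwarz f) := fun _ =>
  differentiableAt_conj_conj_iff.2 (hf _)

theorem schwarz_ofReal (f : ℂ → ℂ) {z : ℂ} (hz : z.im = 0) :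
    schwarz f z = (starRingEnd ℂ) (f z) := by
  rw [schwarz, Complex.conj_eq_iff_im.2 hz]

/-- The scalar first order equation satisfied by a Volterra integral. -/
theorem hasDerivAt_volterra {L : ℝ} {k : ℝ → ℂ} (hk : Continuous k) (c f₀ : ℂ) (x : ℝ) :
    HasDerivAt (fun x : ℝ => Complex.exp (c * x) *
        (f₀ - ∫ y in x..L, Complex.exp (-(c * y)) * k y))
      (c * (Complex.exp (c * x) * (f₀ - ∫ y in x..L, Complex.exp (-(c * y)) * k y)) + k x) x := by
  have hc : Continuous fun y : ℝ => Complex.exp (-(c * y)) * k y := by fun_prop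
  have h1 : HasDerivAt (fun x : ℝ => ∫ y in x..L, Complex.exp (-(c * y)) * k y)
      (-(Complex.exp (-(c * x)) * k x)) x :=
    intervalIntegral.integral_hasDerivAt_left (hc.intervalIntegrable _ _)
      (hc.stronglyMeasurableAtFilter _ _) hc.continuousAt
  have h2 : HasDerivAt (fun x : ℝ => Complex.exp (c * x)) (Complex.exp (c * x) * (c * 1)) x :=
    (((hasDerivAt_id x).ofReal_comp).const_mul c).cexp
  have h3 := h2.mul (h1.const_sub f₀)
  refine h3.congr_deriv ?_
  have : Complex.exp (c * x) * Complex.exp (-(c * x)) = 1 := by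
    rw [← Complex.exp_add]; simp
  linear_combination (k x) * this

/-- Solutions of the Volterra equation normalised at `x = L` solve the Zakharov–Shabat equation. -/
theorem exists_hasDerivAt_of_volterra {L : ℝ} (hL : 0 < L) {q₀ : ℝ → ℂ}
    (hq₀ : ContinuousOn q₀ (Set.Icc 0 L)) {z : ℂ} {Φ : ℝ → Mat2}
    (hΦ : ContinuousOn Φ (Set.Icc 0 L))
    (h : ∀ x ∈ Set.Icc (0 : ℝ) L,
      Φ x = expσ₃ (-(Complex.I * z * x)) - volterra q₀ z Φ x x L) :
    ∃ F : Fin 2 → Fin 2 → ℝ → ℂ, (∀ x ∈ Set.Icc (0 : ℝ) L, ∀ i j, F i j x = Φ x i j) ∧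
      ∀ x ∈ Set.Icc (0 : ℝ) L, ∀ j,
        HasDerivAt (F 0 j) (-(Complex.I * z) * F 0 j x + q₀ x * F 1 j x) x ∧
        HasDerivAt (F 1 j) (Complex.I * z * F 1 j x - (starRingEnd ℂ) (q₀ x) * F 0 j x) x := by
  -- Clamping the argument to `[0, L]` makes the integrands continuous on the whole line, so the
  -- extended solution has two-sided derivatives even at `0` and `L`.
  set π : ℝ → ℝ := fun x => (Set.projIcc 0 L hL.le x : ℝ) with hπ
  have hπc : Continuous π := continuous_subtype_val.comp continuous_projIcc
  have hπm : ∀ x, π x ∈ Set.Icc (0 : ℝ) L := fun x => (Set.projIcc 0 L hL.le x).2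
  have hπe : ∀ x ∈ Set.Icc (0 : ℝ) L, π x = x := fun x hx => by
    simp [hπ, Set.projIcc_of_mem hL.le hx]
  have hq : Continuous fun x => q₀ (π x) := hq₀.comp_continuous hπc hπm
  have hΦc : ∀ i j, Continuous fun x => Φ (π x) i j := fun i j =>
    ((continuous_apply_apply i j).comp (hΦ.comp_continuous hπc hπm))
  have hq' : Continuous fun x => (starRingEnd ℂ) (q₀ (π x)) := Complex.continuous_conj.comp hq
  set k : Fin 2 → Fin 2 → ℝ → ℂ := ![fun j x => q₀ (π x) * Φ (π x) 1 j,
    fun j x => -((starRingEnd ℂ) (q₀ (π x)) * Φ (π x) 0 j)] with hk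
  have hk0 : ∀ j, Continuous (k 0 j) := fun j => hq.mul (hΦc 1 j)
  have hk1 : ∀ j, Continuous (k 1 j) := fun j => (hq'.mul (hΦc 0 j)).neg
  set c : Fin 2 → ℂ := ![-(Complex.I * z), Complex.I * z] with hc
  have hF : ∀ x ∈ Set.Icc (0 : ℝ) L, ∀ i j, Complex.exp (c i * x) *
        ((1 : Mat2) i j - ∫ y in x..L, Complex.exp (-(c i * y)) * k i j y) = Φ x i j := by
    intro x hx i j
    have hint : ∀ g g' : ℝ → ℂ, (∀ y ∈ Set.Icc (0 : ℝ) L, g y = g' y) →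
        ∫ y in x..L, g y = ∫ y in x..L, g' y := by
      intro g g' hgg
      refine intervalIntegral.integral_congr fun y hy => hgg y ?_
      rw [Set.uIcc_of_le hx.2] at hy
      exact ⟨hx.1.trans hy.1, hy.2⟩
    conv_rhs => rw [h x hx]
    have e0 : ∀ y : ℝ, Complex.exp (-(Complex.I * z * x)) * Complex.exp (Complex.I * z * y)
        = Complex.exp (-(Complex.I * z * (x - y))) := fun y => by
      rw [← Complex.exp_add]; ring_nf
    have e1 : ∀ y : ℝ, Complex.exp (Complex.I * z * x) * Complex.exp (-(Complex.I * z * y))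
        = Complex.exp (Complex.I * z * (x - y)) := fun y => by
      rw [← Complex.exp_add]; ring_nf
    fin_cases i <;> simp only [volterra, Matrix.sub_apply, Matrix.of_apply] <;>
      rw [mul_sub, ← intervalIntegral.integral_const_mul]
    · congr 1
      · fin_cases j <;> simp [hc, expσ₃]
      · refine hint _ _ fun y hy => ?_
        fin_cases j <;> simp [hc, hk, expσ₃, potential, Matrix.mul_apply, Fin.sum_univ_two,
          hπe y hy, ← e0 y] <;> ring
    · congr 1
      · fin_cases j <;> simp [hc, expσ₃]
      · refine hint _ _ fun y hy => ?_
        fin_cases j <;> simp [hc, hk, expσ₃, potential, Matrix.mul_apply, Fin.sum_univ_two,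
          hπe y hy, ← e1 y] <;> ring
  refine ⟨fun i j x => Complex.exp (c i * x) *
        ((1 : Mat2) i j - ∫ y in x..L, Complex.exp (-(c i * y)) * k i j y), hF, ?_⟩
  intro x hx j
  constructor
  · refine (hasDerivAt_volterra (hk0 j) (c 0) _ x).congr_deriv ?_
    simp only [hF x hx]
    simp [hc, hk, hπe x hx]
  · refine (hasDerivAt_volterra (hk1 j) (c 1) _ x).congr_deriv ?_
    simp only [hF x hx]
    simp [hc, hk, hπe x hx]
    ring

/-! ### Wronskian and energy identities; the spectral functions are entire -/

/-- `(p₁, p₂)` solves the Zakharov–Shabat equation with spectral parameter `z` on `[0, L]`. -/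
structure IsZSSolution (L : ℝ) (q : ℝ → ℂ) (z : ℂ) (p₁ p₂ : ℝ → ℂ) : Prop where
  fst : ∀ x ∈ Set.Icc (0 : ℝ) L,
    HasDerivAt p₁ (-(Complex.I * z) * p₁ x + q x * p₂ x) x
  snd : ∀ x ∈ Set.Icc (0 : ℝ) L,
    HasDerivAt p₂ (Complex.I * z * p₂ x - (starRingEnd ℂ) (q x) * p₁ x) x

/-- The potential terms cancel because the coefficient matrix is traceless; only the difference of
the spectral parameters survives. For `w = z` the Wronskian is constant. -/
theorem IsZSSolution.hasDerivAt_wronskian {L : ℝ} {q : ℝ → ℂ} {z w : ℂ} {u₁ u₂ v₁ v₂ : ℝ → ℂ}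
    (hu : IsZSSolution L q w u₁ u₂) (hv : IsZSSolution L q z v₁ v₂) {x : ℝ}
    (hx : x ∈ Set.Icc (0 : ℝ) L) :
    HasDerivAt (fun x => u₁ x * v₂ x - u₂ x * v₁ x)
      (Complex.I * (z - w) * (u₁ x * v₂ x + u₂ x * v₁ x)) x := by
  refine (((hu.fst x hx).mul (hv.snd x hx)).sub ((hu.snd x hx).mul (hv.fst x hx))).congr_deriv ?_
  ring

theorem hasDerivAt_normSq {p : ℝ → ℂ} {p' : ℂ} {x : ℝ} (h : HasDerivAt p p' x) :
    HasDerivAt (fun x => ‖p x‖ ^ 2) (2 * ((starRingEnd ℂ) (p x) * p').re) x := by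
  have h1 : HasDerivAt (fun x => ((starRingEnd ℂ) (p x) * p x).re)
      (((starRingEnd ℂ) p' * p x + (starRingEnd ℂ) (p x) * p').re) x :=
    (Complex.reCLM.hasFDerivAt.comp_hasDerivAt x
      ((Complex.conjCLE.toContinuousLinearMap.hasFDerivAt.comp_hasDerivAt x h).mul h))
  have h2 : (fun x => ‖p x‖ ^ 2) = fun x => ((starRingEnd ℂ) (p x) * p x).re := by
    funext y
    rw [mul_comm, Complex.mul_conj, Complex.ofReal_re, Complex.normSq_eq_norm_sq]
  rw [h2]
  refine h1.congr_deriv ?_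
  simp only [Complex.add_re, Complex.mul_re, Complex.conj_re, Complex.conj_im]
  ring

theorem hasDerivAt_exp_mul (s x : ℝ) :
    HasDerivAt (fun x : ℝ => Real.exp (s * x)) (s * Real.exp (s * x)) x := by
  have := ((hasDerivAt_id x).const_mul s).exp
  refine this.congr_deriv ?_
  simp [mul_comm]

/-- `q` drops out because the potential matrix is skew-Hermitian. The weight then makes the energy
monotone as soon as `s` dominates `2 |Im z|`. -/
theorem IsZSSolution.hasDerivAt_energy {L : ℝ} {q : ℝ → ℂ} {z : ℂ} {p₁ p₂ : ℝ → ℂ}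
    (hp : IsZSSolution L q z p₁ p₂) (s : ℝ) {x : ℝ} (hx : x ∈ Set.Icc (0 : ℝ) L) :
    HasDerivAt (fun x => Real.exp (s * x) * (‖p₁ x‖ ^ 2 + ‖p₂ x‖ ^ 2))
      (Real.exp (s * x) * ((s + 2 * z.im) * ‖p₁ x‖ ^ 2 + (s - 2 * z.im) * ‖p₂ x‖ ^ 2)) x := by
  refine ((hasDerivAt_exp_mul s x).mul ((hasDerivAt_normSq (hp.fst x hx)).add
    (hasDerivAt_normSq (hp.snd x hx)))).congr_deriv ?_
  rw [← Complex.normSq_eq_norm_sq, ← Complex.normSq_eq_norm_sq]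
  simp only [Pi.add_apply, ← Complex.normSq_eq_norm_sq]
  simp only [Complex.normSq_apply, Complex.mul_re, Complex.add_re, Complex.sub_re, Complex.add_im,
    Complex.sub_im, Complex.mul_im, Complex.conj_re, Complex.conj_im, Complex.neg_re,
    Complex.neg_im, Complex.I_re, Complex.I_im]
  ring

theorem IsZSSolution.energy_le {L : ℝ} {q : ℝ → ℂ} {z : ℂ} {p₁ p₂ : ℝ → ℂ}
    (hp : IsZSSolution L q z p₁ p₂) {s : ℝ} (h1 : 0 ≤ s + 2 * z.im) (h2 : 0 ≤ s - 2 * z.im)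
    {x : ℝ} (hx : x ∈ Set.Icc (0 : ℝ) L) :
    Real.exp (s * x) * (‖p₁ x‖ ^ 2 + ‖p₂ x‖ ^ 2) ≤
      Real.exp (s * L) * (‖p₁ L‖ ^ 2 + ‖p₂ L‖ ^ 2) := by
  refine monotoneOn_of_deriv_nonneg (convex_Icc 0 L)
    (f := fun x => Real.exp (s * x) * (‖p₁ x‖ ^ 2 + ‖p₂ x‖ ^ 2))
    (fun y hy => (hp.hasDerivAt_energy s hy).continuousAt.continuousWithinAt) ?_ ?_ hx
    (Set.right_mem_Icc.2 (hx.1.trans hx.2)) hx.2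
  · intro y hy
    exact (hp.hasDerivAt_energy s
      (interior_subset hy)).differentiableAt.differentiableWithinAt
  · intro y hy
    rw [(hp.hasDerivAt_energy s (interior_subset hy)).deriv]
    positivity

theorem IsZSSolution.continuousOn {L : ℝ} {q : ℝ → ℂ} {z : ℂ} {p₁ p₂ : ℝ → ℂ}
    (hp : IsZSSolution L q z p₁ p₂) :
    ContinuousOn p₁ (Set.Icc 0 L) ∧ ContinuousOn p₂ (Set.Icc 0 L) :=
  ⟨fun x hx => (hp.fst x hx).continuousAt.continuousWithinAt,
    fun x hx => (hp.snd x hx).continuousAt.continuousWithinAt⟩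

/-- The second component of the solution normalised at `L` is nearly free for large `Im z`. -/
theorem IsZSSolution.norm_sub_le {L Q ε : ℝ} (hL : 0 < L) (hε : 0 < ε) {q : ℝ → ℂ}
    (hQ : ∀ x ∈ Set.Icc (0 : ℝ) L, ‖q x‖ ≤ Q) {z : ℂ} (hz : 0 < z.im) {p₁ p₂ : ℝ → ℂ}
    (hp : IsZSSolution L q z p₁ p₂) (h1 : p₁ L = 0) (h2 : p₂ L = Complex.exp (Complex.I * z * L)) :
    ‖p₂ 0 - 1‖ ≤ Q * (ε * L / 2 + 1 / (8 * ε * z.im)) := by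
  have hQ0 : 0 ≤ Q := (norm_nonneg _).trans (hQ 0 (Set.left_mem_Icc.2 hL.le))
  set H : ℝ → ℝ := fun x => Real.exp (2 * z.im * x) * (‖p₁ x‖ ^ 2 + ‖p₂ x‖ ^ 2) with hH
  set φ : ℝ → ℂ := fun x => Complex.exp (-(Complex.I * z) * x) * p₂ x with hφ
  have hexp : ∀ x : ℝ, ‖Complex.exp (-(Complex.I * z) * x)‖ = Real.exp (z.im * x) := by
    intro x; rw [Complex.norm_exp]; congr 1; simp
  have hφd : ∀ x ∈ Set.Icc (0 : ℝ) L, HasDerivAt φ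
      (-(Complex.exp (-(Complex.I * z) * x) * ((starRingEnd ℂ) (q x) * p₁ x))) x := by
    intro x hx
    have h3 : HasDerivAt (fun x : ℝ => Complex.exp (-(Complex.I * z) * x))
        (Complex.exp (-(Complex.I * z) * x) * (-(Complex.I * z) * 1)) x :=
      (((hasDerivAt_id x).ofReal_comp).const_mul _).cexp
    refine (h3.mul (hp.snd x hx)).congr_deriv ?_
    ring
  have hBd : ∀ x ∈ Set.Icc (0 : ℝ) L, HasDerivAt
      (fun x => Q * (ε * x / 2 + (H x - H 0) / (8 * ε * z.im)))
      (Q * (ε / 2 + Real.exp (2 * z.im * x) * (4 * z.im * ‖p₁ x‖ ^ 2) / (8 * ε * z.im))) x := by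
    intro x hx
    have h4 := hp.hasDerivAt_energy (2 * z.im) hx
    refine ((((hasDerivAt_id x).const_mul ε).div_const 2).add
      ((h4.sub_const (H 0)).div_const (8 * ε * z.im)) |>.const_mul Q).congr_deriv ?_
    ring
  -- `φ` would be constant for `q = 0`. Its variation is compared with a majorant in which the
  -- energy `H` telescopes, since `H' = 4 Im z · e^{2 Im z x} |p₁|²`.
  have hmain := image_norm_le_of_norm_deriv_right_le_deriv_boundary' (a := 0) (b := L)
    (f := fun x => φ x - φ 0)
    (f' := fun x => -(Complex.exp (-(Complex.I * z) * x) * ((starRingEnd ℂ) (q x) * p₁ x)))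
    (B := fun x => Q * (ε * x / 2 + (H x - H 0) / (8 * ε * z.im)))
    (B' := fun x =>
      Q * (ε / 2 + Real.exp (2 * z.im * x) * (4 * z.im * ‖p₁ x‖ ^ 2) / (8 * ε * z.im)))
    (fun x hx => ((hφd x hx).sub_const _).continuousAt.continuousWithinAt)
    (fun x hx => ((hφd x (Set.Ico_subset_Icc_self hx)).sub_const _).hasDerivWithinAt)
    (by simp) (fun x hx => (hBd x hx).continuousAt.continuousWithinAt)
    (fun x hx => (hBd x (Set.Ico_subset_Icc_self hx)).hasDerivWithinAt)
    (by
      intro x hx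
      rw [norm_neg, norm_mul, norm_mul, hexp, RCLike.norm_conj]
      have e1 : Real.exp (2 * z.im * x) = Real.exp (z.im * x) ^ 2 := by
        rw [← Real.exp_nat_mul]; push_cast; ring_nf
      have e2 : Real.exp (2 * z.im * x) * (4 * z.im * ‖p₁ x‖ ^ 2) / (8 * ε * z.im) =
          (Real.exp (z.im * x) * ‖p₁ x‖) ^ 2 / (2 * ε) := by
        rw [e1]; field_simp; ring
      rw [e2]
      set y := Real.exp (z.im * x) * ‖p₁ x‖ with hy
      have hy0 : 0 ≤ y := by positivity
      -- Young's inequality turns the first power of `p₁` in the equation into the square that the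
      -- energy controls.
      have e3 : y ≤ ε / 2 + y ^ 2 / (2 * ε) := by
        have : ε / 2 + y ^ 2 / (2 * ε) - y = (y - ε) ^ 2 / (2 * ε) := by field_simp; ring
        have : 0 ≤ (y - ε) ^ 2 / (2 * ε) := by positivity
        linarith
      calc Real.exp (z.im * x) * (‖q x‖ * ‖p₁ x‖) = ‖q x‖ * y := by rw [hy]; ring
        _ ≤ Q * y := mul_le_mul_of_nonneg_right (hQ x (Set.Ico_subset_Icc_self hx)) hy0
        _ ≤ _ := mul_le_mul_of_nonneg_left e3 hQ0)
    (Set.right_mem_Icc.2 hL.le)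
  have hφL : φ L = 1 := by
    simp only [hφ, h2, ← Complex.exp_add]; simp
  have hφ0 : φ 0 = p₂ 0 := by simp [hφ]
  have hHL : H L = 1 := by
    have hn : ‖Complex.exp (Complex.I * z * L)‖ = Real.exp (-(z.im * L)) := by
      rw [Complex.norm_exp]; congr 1; simp
    simp only [hH, h1, h2, hn, norm_zero]
    rw [← Real.exp_nat_mul]
    have : (0 : ℝ) ^ 2 = 0 := by norm_num
    rw [this, zero_add, ← Real.exp_add, ← Real.exp_zero]; congr 1; push_cast; ring
  have hH0 : 0 ≤ H 0 := by positivity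
  simp only [hφL, hφ0, hHL] at hmain
  rw [norm_sub_rev]
  refine hmain.trans (mul_le_mul_of_nonneg_left ?_ hQ0)
  gcongr
  linarith

/-- No regularity of `v` in `z` is assumed beyond a local bound. Integrating the derivative of the
Wronskian over `[0, L]` and replacing `v z` by `e z` times the solution `p` at `z₀` costs only `O(|z
- z₀|²)`, because a factor `z - z₀` is already in front. What is left is differentiable by
inspection. -/
theorem differentiableAt_wronskian {L : ℝ} (hL : 0 < L) {q : ℝ → ℂ} {z₀ : ℂ}
    {u₁ u₂ r₁ r₂ p₁ p₂ : ℝ → ℂ} {v₁ v₂ : ℂ → ℝ → ℂ} {e : ℂ → ℂ}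
    (hu : IsZSSolution L q z₀ u₁ u₂) (hr : IsZSSolution L q z₀ r₁ r₂)
    (hp : IsZSSolution L q z₀ p₁ p₂) (hv : ∀ z, IsZSSolution L q z (v₁ z) (v₂ z))
    (hdet : ∀ y ∈ Set.Icc (0 : ℝ) L, r₁ y * p₂ y - r₂ y * p₁ y = 1)
    {C : ℝ} (hC : ∀ z, ‖z - z₀‖ ≤ 1 → ∀ y ∈ Set.Icc (0 : ℝ) L, ‖v₁ z y‖ ≤ C ∧ ‖v₂ z y‖ ≤ C)
    (he : DifferentiableAt ℂ e z₀) (hrL : ∀ z, r₁ L * v₂ z L - r₂ L * v₁ z L = e z)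
    (hpL : ∀ z, p₁ L * v₂ z L - p₂ L * v₁ z L = 0)
    (huL : DifferentiableAt ℂ (fun z => u₁ L * v₂ z L - u₂ L * v₁ z L) z₀) :
    DifferentiableAt ℂ (fun z => u₁ 0 * v₂ z 0 - u₂ 0 * v₁ z 0) z₀ := by
  have h0 : (0 : ℝ) ∈ Set.Icc 0 L := Set.left_mem_Icc.2 hL.le
  have hLm : L ∈ Set.Icc 0 L := Set.right_mem_Icc.2 hL.le
  have bd : ∀ f : ℝ → ℂ, ContinuousOn f (Set.Icc 0 L) → ∃ B, ∀ y ∈ Set.Icc (0 : ℝ) L, ‖f y‖ ≤ B :=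
    fun f hf => isCompact_Icc.exists_bound_of_continuousOn hf
  obtain ⟨B₁, hB₁⟩ := bd _ hu.continuousOn.1
  obtain ⟨B₂, hB₂⟩ := bd _ hu.continuousOn.2
  obtain ⟨B₃, hB₃⟩ := bd _ hr.continuousOn.1
  obtain ⟨B₄, hB₄⟩ := bd _ hr.continuousOn.2
  obtain ⟨B₅, hB₅⟩ := bd _ hp.continuousOn.1
  obtain ⟨B₆, hB₆⟩ := bd _ hp.continuousOn.2
  obtain ⟨B, hB⟩ : ∃ B, ∀ y ∈ Set.Icc (0 : ℝ) L, ‖u₁ y‖ ≤ B ∧ ‖u₂ y‖ ≤ B ∧ ‖r₁ y‖ ≤ B ∧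
      ‖r₂ y‖ ≤ B ∧ ‖p₁ y‖ ≤ B ∧ ‖p₂ y‖ ≤ B :=
    ⟨B₁ ⊔ B₂ ⊔ B₃ ⊔ B₄ ⊔ B₅ ⊔ B₆, fun y hy => by
      have := hB₁ y hy; have := hB₂ y hy; have := hB₃ y hy
      have := hB₄ y hy; have := hB₅ y hy; have := hB₆ y hy
      simp only [le_sup_iff]; tauto⟩
  have hB0 : 0 ≤ B := (norm_nonneg _).trans (hB 0 h0).1
  have hC0 : 0 ≤ C := (norm_nonneg _).trans (hC z₀ (by simp) 0 h0).1
  set D : ℝ := B * (2 * B * C) * L with hD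
  have hD0 : 0 ≤ D := by positivity
  have hW : ∀ {w₁ w₂ : ℝ → ℂ}, IsZSSolution L q z₀ w₁ w₂ →
      (∀ y ∈ Set.Icc (0 : ℝ) L, ‖w₁ y‖ ≤ B ∧ ‖w₂ y‖ ≤ B) → ∀ z, ‖z - z₀‖ ≤ 1 →
      ∀ y ∈ Set.Icc (0 : ℝ) L, ‖(w₁ y * v₂ z y - w₂ y * v₁ z y) -
        (w₁ L * v₂ z L - w₂ L * v₁ z L)‖ ≤ ‖z - z₀‖ * (2 * B * C) * L := by
    intro w₁ w₂ hw hwB z hz y hy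
    have h1 := (convex_Icc (0 : ℝ) L).norm_image_sub_le_of_norm_hasDerivWithin_le
      (f := fun y => w₁ y * v₂ z y - w₂ y * v₁ z y) (C := ‖z - z₀‖ * (2 * B * C))
      (fun x hx => (hw.hasDerivAt_wronskian (hv z) hx).hasDerivWithinAt)
      (fun x hx => by
        rw [norm_mul, norm_mul, Complex.norm_I, one_mul]
        refine mul_le_mul_of_nonneg_left ?_ (norm_nonneg _)
        refine (norm_add_le _ _).trans ?_
        rw [norm_mul, norm_mul]
        have h1 := mul_le_mul (hwB x hx).1 (hC z hz x hx).2 (norm_nonneg _) hB0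
        have h2 := mul_le_mul (hwB x hx).2 (hC z hz x hx).1 (norm_nonneg _) hB0
        linarith) hLm hy
    refine h1.trans (mul_le_mul_of_nonneg_left ?_ (by positivity))
    rw [Real.norm_eq_abs, abs_sub_comm, abs_of_nonneg (by linarith [hy.2])]
    linarith [hy.1]
  -- Cramer's rule in the basis `(r, p)`: the coefficients of `v z` are Wronskians, which by `hW`
  -- stay close to their values `e z` and `0` at `L`.
  have hvp : ∀ z, ‖z - z₀‖ ≤ 1 → ∀ y ∈ Set.Icc (0 : ℝ) L,
      ‖v₁ z y - e z * p₁ y‖ ≤ 2 * D * ‖z - z₀‖ ∧ ‖v₂ z y - e z * p₂ y‖ ≤ 2 * D * ‖z - z₀‖ := by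
    intro z hz y hy
    have h1 := hW hr (fun y hy => ⟨(hB y hy).2.2.1, (hB y hy).2.2.2.1⟩) z hz y hy
    have h2 := hW hp (fun y hy => (hB y hy).2.2.2.2) z hz y hy
    rw [hrL] at h1
    rw [hpL, sub_zero] at h2
    set X := (r₁ y * v₂ z y - r₂ y * v₁ z y) - e z with hX
    set Y := p₁ y * v₂ z y - p₂ y * v₁ z y with hY
    have hb := hB y hy
    have est : ∀ s s' : ℂ, ‖s‖ ≤ B → ‖s'‖ ≤ B → ‖X * s - Y * s'‖ ≤ 2 * D * ‖z - z₀‖ := by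
      intro s s' hs hs'
      refine (norm_sub_le _ _).trans ?_
      rw [norm_mul, norm_mul]
      have h3 := mul_le_mul h1 hs (norm_nonneg _) (by positivity)
      have h4 := mul_le_mul h2 hs' (norm_nonneg _) (by positivity)
      calc _ ≤ _ := add_le_add h3 h4
        _ = _ := by rw [hD]; ring
    constructor
    · convert est (p₁ y) (r₁ y) hb.2.2.2.2.1 hb.2.2.1 using 2
      linear_combination (-v₁ z y) * hdet y hy
    · convert est (p₂ y) (r₂ y) hb.2.2.2.2.2 hb.2.2.2.1 using 2
      linear_combination (-v₂ z y) * hdet y hy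
  set K : ℂ := ∫ y in (0 : ℝ)..L, (u₁ y * p₂ y + u₂ y * p₁ y) with hK
  have huI : Set.uIcc 0 L = Set.Icc 0 L := Set.uIcc_of_le hL.le
  have hint : ∀ f g : ℝ → ℂ, ContinuousOn f (Set.Icc 0 L) → ContinuousOn g (Set.Icc 0 L) →
      IntervalIntegrable (fun y => u₁ y * f y + u₂ y * g y) MeasureTheory.volume 0 L := by
    intro f g hf hg
    refine ContinuousOn.intervalIntegrable ?_
    rw [huI]
    exact (hu.continuousOn.1.mul hf).add (hu.continuousOn.2.mul hg)
  -- The second-order remainder which yields differentiability at `z₀`.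
  have hrem : (fun z => (u₁ 0 * v₂ z 0 - u₂ 0 * v₁ z 0) - (u₁ L * v₂ z L - u₂ L * v₁ z L) +
      Complex.I * (z - z₀) * (e z * K)) =O[𝓝 z₀] fun z => ‖z - z₀‖ ^ 2 := by
    refine IsBigO.of_bound (4 * B * D * L) ?_
    filter_upwards [Metric.closedBall_mem_nhds z₀ one_pos] with z hz
    rw [mem_closedBall_iff_norm] at hz
    have hftc := intervalIntegral.integral_eq_sub_of_hasDerivAt
      (fun y hy => hu.hasDerivAt_wronskian (hv z) (by rwa [huI] at hy))
      ((hint _ _ (hv z).continuousOn.2 (hv z).continuousOn.1).const_mul _)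
    have hsplit : (u₁ 0 * v₂ z 0 - u₂ 0 * v₁ z 0) - (u₁ L * v₂ z L - u₂ L * v₁ z L) +
      Complex.I * (z - z₀) * (e z * K) = -∫ y in (0 : ℝ)..L, Complex.I * (z - z₀) *
        (u₁ y * (v₂ z y - e z * p₂ y) + u₂ y * (v₁ z y - e z * p₁ y)) := by
      have h3 : ∫ y in (0 : ℝ)..L, Complex.I * (z - z₀) *
          (u₁ y * (v₂ z y - e z * p₂ y) + u₂ y * (v₁ z y - e z * p₁ y)) =
          (∫ y in (0 : ℝ)..L, Complex.I * (z - z₀) * (u₁ y * v₂ z y + u₂ y * v₁ z y)) -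
          ∫ y in (0 : ℝ)..L, Complex.I * (z - z₀) * (e z * (u₁ y * p₂ y + u₂ y * p₁ y)) := by
        rw [← intervalIntegral.integral_sub
          ((hint _ _ (hv z).continuousOn.2 (hv z).continuousOn.1).const_mul _)
          (((hint _ _ hp.continuousOn.2 hp.continuousOn.1).const_mul _).const_mul _)]
        refine intervalIntegral.integral_congr fun y _ => ?_
        ring
      rw [h3, hftc, intervalIntegral.integral_const_mul, intervalIntegral.integral_const_mul]
      ring
    rw [hsplit, norm_neg]
    have h4 := intervalIntegral.norm_integral_le_of_norm_le_const (a := 0) (b := L)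
      (f := fun y => Complex.I * (z - z₀) *
        (u₁ y * (v₂ z y - e z * p₂ y) + u₂ y * (v₁ z y - e z * p₁ y)))
      (C := ‖z - z₀‖ * (4 * B * D * ‖z - z₀‖)) (fun y hy => by
        have hy' : y ∈ Set.Icc 0 L := by
          rw [← huI]; exact Set.uIoc_subset_uIcc hy
        rw [norm_mul, norm_mul, Complex.norm_I, one_mul]
        refine mul_le_mul_of_nonneg_left ?_ (norm_nonneg _)
        refine (norm_add_le _ _).trans ?_
        rw [norm_mul, norm_mul]
        have h1 := mul_le_mul (hB y hy').1 (hvp z hz y hy').2 (norm_nonneg _) hB0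
        have h2 := mul_le_mul (hB y hy').2.1 (hvp z hz y hy').1 (norm_nonneg _) hB0
        linarith)
    refine h4.trans (le_of_eq ?_)
    rw [sub_zero, abs_of_pos hL, norm_pow, norm_norm]
    ring
  have hd := (hrem.hasFDerivAt (𝕜 := ℂ) (by norm_num)).differentiableAt
  have h5 : DifferentiableAt ℂ (fun z => Complex.I * (z - z₀) * (e z * K)) z₀ := by fun_prop
  refine ((hd.add huL).sub h5).congr_of_eventuallyEq (Eventually.of_forall fun z => ?_)
  simp only [Pi.add_apply, Pi.sub_apply]
  ring

/-- The properties of the spectral functions used below. -/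
structure SpectralData (L : ℝ) (a b : ℂ → ℂ) : Prop where
  diff_a : Differentiable ℂ a
  diff_b : Differentiable ℂ b
  det : ∀ z, a z * schwarz a z + b z * schwarz b z = 1
  bound_upper : ∀ z : ℂ, 0 ≤ z.im → ‖b z‖ ^ 2 + ‖a z‖ ^ 2 ≤ 1
  bound_lower : ∀ z : ℂ, z.im ≤ 0 → ‖b z‖ ^ 2 + ‖a z‖ ^ 2 ≤ Real.exp (-(4 * z.im * L))
  tendsto_one : ∀ δ > 0, ∃ K : ℝ, ∀ z : ℂ, K < z.im → ‖a z - 1‖ < δ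

/-- `b` and `a` are the values at `x = 0` of the second column of `Φ₃`, which equals `(0, e^{izL})`
at `x = L`. Each property transports this terminal value back to `0`. -/
theorem IsSpectralPair.spectralData {L : ℝ} (hL : 0 < L) {q₀ : ℝ → ℂ}
    (hq₀ : ContinuousOn q₀ (Set.Icc 0 L)) {a b : ℂ → ℂ} (h : IsSpectralPair L q₀ a b) :
    SpectralData L a b := by
  obtain ⟨Φ₂, Φ₃, H⟩ := h
  have h0 : (0 : ℝ) ∈ Set.Icc 0 L := Set.left_mem_Icc.2 hL.le
  have hLm : L ∈ Set.Icc 0 L := Set.right_mem_Icc.2 hL.le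
  choose F hF hFd using fun z => exists_hasDerivAt_of_volterra hL hq₀ (H z).2.1
    fun x hx => ((H z).2.2 x hx).2.1
  have sol : ∀ z j, IsZSSolution L q₀ z (F z 0 j) (F z 1 j) := fun z j =>
    ⟨fun x hx => (hFd z x hx j).1, fun x hx => (hFd z x hx j).2⟩
  have vol : ∀ z Φ x, volterra q₀ z Φ x x x = 0 := by
    intro z Φ x; ext i j; simp [volterra]
  have vol' : ∀ z, volterra q₀ z (Φ₃ z) L L L = 0 := fun z => vol z _ L
  have at0 : ∀ z i j, F z i j 0 = !![schwarz a z, b z; -schwarz b z, a z] i j := by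
    intro z i j
    have e1 : Φ₂ z 0 = 1 := by
      rw [((H z).2.2 0 h0).1, vol]
      ext i j; fin_cases i <;> fin_cases j <;> simp [expσ₃]
    rw [hF z 0 h0, ((H z).2.2 0 h0).2.2, e1, one_mul]
  have atL : ∀ z i j, F z i j L = expσ₃ (-(Complex.I * z * L)) i j := by
    intro z i j
    rw [hF z L hLm, ((H z).2.2 L hLm).2.1, vol', sub_zero]
  have det1 : ∀ z, ∀ x ∈ Set.Icc (0 : ℝ) L,
      F z 0 0 x * F z 1 1 x - F z 1 0 x * F z 0 1 x = 1 := by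
    intro z x hx
    have := (convex_Icc (0 : ℝ) L).norm_image_sub_le_of_norm_hasDerivWithin_le
      (f := fun y => F z 0 0 y * F z 1 1 y - F z 1 0 y * F z 0 1 y) (C := 0)
      (fun x hx => ((sol z 0).hasDerivAt_wronskian (sol z 1) hx).hasDerivWithinAt)
      (fun x hx => by simp) hLm hx
    rw [zero_mul, norm_le_zero_iff, sub_eq_zero] at this
    rw [this, atL, atL, atL, atL]
    simp only [expσ₃, Matrix.of_apply, Matrix.cons_val', Matrix.cons_val_zero,
      Matrix.cons_val_one, Matrix.cons_val_fin_one, neg_neg]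
    rw [← Complex.exp_add]
    simp
  have L01 : ∀ z, F z 0 1 L = 0 := fun z => by rw [atL]; simp [expσ₃]
  have L11 : ∀ z, F z 1 1 L = Complex.exp (Complex.I * z * L) := fun z => by
    rw [atL]; simp [expσ₃]
  have L10 : ∀ z, F z 1 0 L = 0 := fun z => by rw [atL]; simp [expσ₃]
  have Z00 : ∀ z, F z 0 0 0 = schwarz a z := fun z => by rw [at0]; simp
  have Z01 : ∀ z, F z 0 1 0 = b z := fun z => by rw [at0]; simp
  have Z10 : ∀ z, F z 1 0 0 = -schwarz b z := fun z => by rw [at0]; simp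
  have Z11 : ∀ z, F z 1 1 0 = a z := fun z => by rw [at0]; simp
  have nL : ∀ z : ℂ, ‖F z 0 1 L‖ ^ 2 + ‖F z 1 1 L‖ ^ 2 = Real.exp (-(2 * z.im * L)) := by
    intro z
    rw [L01, L11, Complex.norm_exp, norm_zero, ← Real.exp_nat_mul]
    have : (0 : ℝ) ^ 2 = 0 := by norm_num
    rw [this, zero_add]; congr 1; simp; ring
  have hdet : ∀ z, a z * schwarz a z + b z * schwarz b z = 1 := by
    intro z
    have := det1 z 0 h0
    rw [Z00, Z01, Z10, Z11] at this
    linear_combination this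
  have hbd : ∀ z₀ z : ℂ, ‖z - z₀‖ ≤ 1 → ∀ y ∈ Set.Icc (0 : ℝ) L,
      ‖F z 0 1 y‖ ≤ Real.exp (4 * (|z₀.im| + 1) * L) ∧
      ‖F z 1 1 y‖ ≤ Real.exp (4 * (|z₀.im| + 1) * L) := by
    intro z₀ z hz y hy
    have h1 := (sol z 1).energy_le (s := 2 * |z.im|) (by linarith [neg_abs_le z.im])
      (by linarith [le_abs_self z.im]) hy
    rw [nL, ← Real.exp_add] at h1
    have h2 : |z.im| ≤ |z₀.im| + 1 := by
      have := (Complex.abs_im_le_norm (z - z₀)).trans hz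
      rw [Complex.sub_im] at this
      linarith [abs_sub_abs_le_abs_sub z.im z₀.im]
    have h3 : ‖F z 0 1 y‖ ^ 2 + ‖F z 1 1 y‖ ^ 2 ≤ Real.exp (4 * (|z₀.im| + 1) * L) := by
      have h4 : 1 ≤ Real.exp (2 * |z.im| * y) := Real.one_le_exp (by have := hy.1; positivity)
      have h5 : 0 ≤ ‖F z 0 1 y‖ ^ 2 + ‖F z 1 1 y‖ ^ 2 := by positivity
      have h6 : 2 * |z.im| * L + -(2 * z.im * L) ≤ 4 * (|z₀.im| + 1) * L := by
        nlinarith [neg_abs_le z.im]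
      calc _ ≤ Real.exp (2 * |z.im| * y) * (‖F z 0 1 y‖ ^ 2 + ‖F z 1 1 y‖ ^ 2) := by nlinarith
        _ ≤ _ := h1.trans (Real.exp_le_exp.2 h6)
    have h7 : 1 ≤ Real.exp (4 * (|z₀.im| + 1) * L) := Real.one_le_exp (by positivity)
    constructor
    · refine abs_le_of_sq_le_sq' ?_ (by positivity) |>.2
      nlinarith [sq_nonneg ‖F z 1 1 y‖]
    · refine abs_le_of_sq_le_sq' ?_ (by positivity) |>.2
      nlinarith [sq_nonneg ‖F z 0 1 y‖]
  have hWd : ∀ z₀ j, DifferentiableAt ℂ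
      (fun z => F z₀ 0 j 0 * F z 1 1 0 - F z₀ 1 j 0 * F z 0 1 0) z₀ := by
    intro z₀ j
    -- With this choice `e z = e^{i(z - z₀)L}`, the ratio of the terminal values at `z` and `z₀`.
    refine differentiableAt_wronskian hL (sol z₀ j) (sol z₀ 0) (sol z₀ 1)
      (v₁ := fun z => F z 0 1) (v₂ := fun z => F z 1 1)
      (e := fun z => F z₀ 0 0 L * Complex.exp (Complex.I * z * L)) (fun z => sol z 1) (det1 z₀)
      (hbd z₀) (by fun_prop) ?_ ?_ ?_
    · intro z; rw [L10, L11]; ring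
    · intro z; rw [L01, L01]; ring
    · simp only [L11, L01]; fun_prop
  have hDa : ∀ z₀, DifferentiableAt ℂ a z₀ := by
    intro z₀
    -- The two Wronskians are a linear system for `a z`, `b z` with coefficients frozen at `z₀` and
    -- determinant `-1`; it is solved by the determinant relation.
    have := ((hWd z₀ 0).const_mul (a z₀)).add ((hWd z₀ 1).const_mul (schwarz b z₀))
    refine this.congr_of_eventuallyEq (Eventually.of_forall fun z => ?_)
    simp only [Pi.add_apply, Z00, Z01, Z10, Z11]
    linear_combination (-a z) * hdet z₀
  have hDb : ∀ z₀, DifferentiableAt ℂ b z₀ := by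
    intro z₀
    have := ((hWd z₀ 0).const_mul (b z₀)).sub ((hWd z₀ 1).const_mul (schwarz a z₀))
    refine this.congr_of_eventuallyEq (Eventually.of_forall fun z => ?_)
    simp only [Pi.sub_apply, Z00, Z01, Z10, Z11]
    linear_combination (-b z) * hdet z₀
  refine ⟨hDa, hDb, hdet, ?_, ?_, ?_⟩
  · intro z hz
    have h1 := (sol z 1).energy_le (s := 2 * z.im) (by linarith) (by linarith) h0
    rw [nL, ← Real.exp_add, mul_zero, Real.exp_zero, one_mul, Z01, Z11] at h1
    refine h1.trans (le_of_eq ?_)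
    rw [← Real.exp_zero]; congr 1; ring
  · intro z hz
    have h1 := (sol z 1).energy_le (s := -(2 * z.im)) (by linarith) (by linarith) h0
    rw [nL, ← Real.exp_add, mul_zero, Real.exp_zero, one_mul, Z01, Z11] at h1
    refine h1.trans (le_of_eq ?_)
    congr 1; ring
  · intro δ hδ
    obtain ⟨Q, hQ⟩ := isCompact_Icc.exists_bound_of_continuousOn hq₀
    have hQ0 : 0 ≤ Q := (norm_nonneg _).trans (hQ 0 h0)
    -- The two error terms become at most `δ/4` and `δ/2`; `Q + 1` replaces `Q`, which may be zero.
    set ε : ℝ := δ / (2 * (Q + 1) * L) with hε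
    have hε0 : 0 < ε := by positivity
    refine ⟨(Q + 1) / (4 * ε * δ), fun z hz => ?_⟩
    have hK : 0 < (Q + 1) / (4 * ε * δ) := by positivity
    have hz0 : 0 < z.im := hK.trans hz
    have h1 := (sol z 1).norm_sub_le hL hε0 hQ hz0 (L01 z) (L11 z)
    rw [Z11] at h1
    have h2 : 1 / (8 * ε * z.im) < δ / (2 * (Q + 1)) := by
      rw [div_lt_iff₀ (by positivity)] at hz
      rw [div_lt_div_iff₀ (by positivity) (by positivity)]
      linarith
    have h3 : ε * L / 2 = δ / (4 * (Q + 1)) := by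
      rw [hε]; field_simp; ring
    rw [h3] at h1
    have h4 : δ / (4 * (Q + 1)) + δ / (2 * (Q + 1)) = 3 / 4 * (δ / (Q + 1)) := by
      field_simp; ring
    have h5 : (Q + 1) * (δ / (Q + 1)) = δ := by field_simp
    have h6 : 0 < δ / (Q + 1) := by positivity
    nlinarith

end

end PeriodicNLS

namespace PeriodicNLS

noncomputable section

/-! ### Geometry of the cuts -/

section Cuts

variable {N : ℕ} {e : Fin (N + 1) → ℂ}

theorem isClosed_cuts (e : Fin (N + 1) → ℂ) : IsClosed (cuts e) := by
  have : cuts e = ⋃ j, {z : ℂ | z.re = (e j).re ∧ |z.im| ≤ (e j).im} := by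
    ext z; simp [cuts]
  rw [this]
  refine isClosed_iUnion_of_finite fun j => ?_
  exact (isClosed_eq Complex.continuous_re continuous_const).inter
    (isClosed_le (Complex.continuous_im.abs) continuous_const)

theorem conj_mem_cuts {z : ℂ} : (starRingEnd ℂ) z ∈ cuts e ↔ z ∈ cuts e := by
  simp [cuts]

theorem conj_mem_branchPts {z : ℂ} : (starRingEnd ℂ) z ∈ branchPts e ↔ z ∈ branchPts e := by
  simp only [branchPts, Set.mem_ofPred_eq]
  refine exists_congr fun j => ?_
  constructor
  · rintro (h | h)
    · right; rw [← h, Complex.conj_conj]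
    · left; simpa using congrArg (starRingEnd ℂ) h
  · rintro (h | h)
    · right; rw [h]
    · left; rw [h, Complex.conj_conj]

theorem finite_branchPts (e : Fin (N + 1) → ℂ) : (branchPts e).Finite := by
  have : branchPts e = ⋃ j, {e j, (starRingEnd ℂ) (e j)} := by
    ext z; simp [branchPts]
  rw [this]
  exact Set.finite_iUnion fun j => by simp

theorem finite_crossPts (e : Fin (N + 1) → ℂ) : (crossPts e).Finite := by
  have : crossPts e = {0} ∪ ⋃ j, {(((e j).re : ℝ) : ℂ)} := by
    ext z; simp [crossPts, eq_comm]
  rw [this]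
  exact (Set.finite_singleton _).union (Set.finite_iUnion fun j => by simp)

/-- Moving along the diagonal one leaves every vertical line and the real axis. -/
theorem dense_compl_contour_diff (e : Fin (N + 1) → ℂ) (p : ℂ) :
    (𝓝[(contour e ∪ {p})ᶜ] p).NeBot := by
  have hfin : (({p.im, 0} : Set ℝ) ∪ ({0} ∪ Set.range fun j => (e j).re)).Finite := by
    refine Set.Finite.union (by simp) (Set.Finite.union (by simp) (Set.finite_range _))
  set γ : ℝ → ℂ := fun s => p + (s : ℂ) * (1 + Complex.I) with hγ
  have hγc : Tendsto γ (𝓝[>] 0) (𝓝 p) := by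
    have : Continuous γ := by fun_prop
    simpa [hγ] using (this.tendsto 0).mono_left (nhdsWithin_le_nhds (s := Set.Ioi 0))
  have hre : ∀ s, (γ s).re = p.re + s := fun s => by simp [hγ]
  have him : ∀ s, (γ s).im = p.im + s := fun s => by simp [hγ]
  have hbad : ∀ (c x : ℝ), ∀ᶠ s in 𝓝[>] (0 : ℝ), x + s ≠ c := by
    intro c x
    rcases eq_or_ne x c with h | h
    · filter_upwards [self_mem_nhdsWithin] with s hs
      have : 0 < s := hs
      intro h'; linarith
    · have : Tendsto (fun s : ℝ => x + s) (𝓝[>] 0) (𝓝 (x + 0)) :=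
        ((continuous_const.add continuous_id).tendsto 0).mono_left nhdsWithin_le_nhds
      rw [add_zero] at this
      exact this.eventually_ne h
  have hall : ∀ᶠ s in 𝓝[>] (0 : ℝ), γ s ∈ (contour e ∪ {p})ᶜ := by
    have h1 : ∀ᶠ s in 𝓝[>] (0 : ℝ), ∀ j, p.re + s ≠ (e j).re :=
      eventually_all.2 fun j => hbad _ _
    filter_upwards [h1, hbad 0 p.im, hbad 0 p.re, hbad p.re p.re] with s h1 h2 h3 h4
    simp only [contour, Set.mem_compl_iff, Set.mem_union, Set.mem_ofPred_eq,
      Set.mem_singleton_iff, not_or]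
    refine ⟨⟨⟨by rwa [him], by rwa [hre]⟩, ?_⟩, ?_⟩
    · rintro ⟨j, hj, -⟩
      exact h1 j (by rw [← hre]; exact hj)
    · intro h; exact h4 (by rw [← hre, h])
  exact (tendsto_nhdsWithin_iff.2 ⟨hγc, hall⟩).neBot

theorem eventually_mem_cuts {p : ℂ} (hp : p ∈ cuts e) (hb : p ∉ branchPts e) :
    ∀ᶠ z in 𝓝 p, z.re = p.re → z ∈ cuts e := by
  obtain ⟨j, hj, hj'⟩ := hp
  have hlt : |p.im| < (e j).im := by
    refine lt_of_le_of_ne hj' fun h => hb ⟨j, ?_⟩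
    rcases abs_choice p.im with h1 | h1
    · left; exact Complex.ext hj (by linarith)
    · right; exact Complex.ext (by simpa using hj) (by simp; linarith)
  filter_upwards [(isOpen_lt Complex.continuous_im.abs continuous_const).mem_nhds hlt] with z hz h
  exact ⟨j, h.trans hj, le_of_lt hz⟩

theorem branchPts_subset_cuts (him : ∀ j, 0 < (e j).im) : branchPts e ⊆ cuts e := by
  rintro z ⟨j, rfl | rfl⟩
  · exact ⟨j, rfl, (abs_of_pos (him j)).le⟩
  · exact ⟨j, by simp, by simp [(abs_of_pos (him j)).le]⟩

theorem eventually_notMem_cuts (e : Fin (N + 1) → ℂ) : ∀ᶠ z in cocompact ℂ, z ∉ cuts e := by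
  have hb : Bornology.IsBounded (cuts e) := by
    refine isBounded_iff_forall_norm_le.2 ⟨∑ j, (|(e j).re| + |(e j).im|), ?_⟩
    rintro z ⟨j, h1, h2⟩
    have h3 : |(e j).re| + |(e j).im| ≤ ∑ j, (|(e j).re| + |(e j).im|) :=
      Finset.single_le_sum (f := fun j => |(e j).re| + |(e j).im|) (fun i _ => by positivity)
        (Finset.mem_univ j)
    refine (Complex.norm_le_abs_re_add_abs_im z).trans (le_trans ?_ h3)
    rw [h1]
    linarith [le_abs_self (e j).im]
  rw [← Metric.cobounded_eq_cocompact]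
  exact hb

end Cuts

/-! ### The branch `R` -/

theorem tendsto_conj_nhdsWithin {U V : Set ℂ} (h : ∀ z ∈ U, (starRingEnd ℂ) z ∈ V) (p : ℂ) :
    Tendsto (starRingEnd ℂ) (𝓝[U] p) (𝓝[V] ((starRingEnd ℂ) p)) :=
  tendsto_nhdsWithin_iff.2 ⟨(Complex.continuous_conj.tendsto p).mono_left nhdsWithin_le_nhds, by
    filter_upwards [self_mem_nhdsWithin] with z hz using h z hz⟩

theorem tendsto_conj_nhdsNE (p : ℂ) :
    Tendsto (starRingEnd ℂ) (𝓝[≠] p) (𝓝[≠] ((starRingEnd ℂ) p)) :=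
  tendsto_conj_nhdsWithin (V := {(starRingEnd ℂ) p}ᶜ) (by
    intro z hz h
    simp only [Set.mem_compl_iff, Set.mem_singleton_iff] at hz h
    exact hz (by simpa using congrArg (starRingEnd ℂ) h)) p

theorem _root_.AnalyticAt.schwarz {f : ℂ → ℂ} {p : ℂ} (h : AnalyticAt ℂ f ((starRingEnd ℂ) p)) :
    AnalyticAt ℂ (schwarz f) p := by
  rw [Complex.analyticAt_iff_eventually_differentiableAt] at h ⊢
  filter_upwards [(Complex.continuous_conj.tendsto p).eventually h] with z hz
  exact differentiableAt_conj_conj_iff.2 hz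

theorem _root_.MeromorphicAt.schwarz {f : ℂ → ℂ} {p : ℂ}
    (h : MeromorphicAt f ((starRingEnd ℂ) p)) : MeromorphicAt (schwarz f) p := by
  obtain ⟨n, hn⟩ := h
  refine ⟨n, hn.schwarz.congr (Eventually.of_forall fun z => ?_)⟩
  simp [PeriodicNLS.schwarz]

/-- Roots of a quadratic equation whose lower coefficients tend to zero tend to zero. -/
theorem tendsto_zero_of_quadratic {l : Filter ℂ} {A B C w : ℂ → ℂ} {A₀ : ℂ} (hA₀ : A₀ ≠ 0)
    (hA : Tendsto A l (𝓝 A₀)) (hB : Tendsto B l (𝓝 0)) (hC : Tendsto C l (𝓝 0))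
    (h : ∀ᶠ z in l, A z * w z ^ 2 + B z * w z + C z = 0) : Tendsto w l (𝓝 0) := by
  have h1 : Tendsto (fun z => B z ^ 2 - 4 * A z * C z) l (𝓝 0) := by
    have := (hB.pow 2).sub ((hA.const_mul 4).mul hC)
    simpa using this
  -- Completing the square: `(2Aw + B)² = B² - 4AC`.
  have h2 : Tendsto (fun z => ‖2 * A z * w z + B z‖ ^ 2) l (𝓝 0) := by
    have h3 := h1.norm
    rw [norm_zero] at h3
    refine h3.congr' ?_
    filter_upwards [h] with z hz
    rw [← norm_pow]; congr 1
    linear_combination (-4 * A z) * hz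
  have h3 : Tendsto (fun z => 2 * A z * w z + B z) l (𝓝 0) := by
    rw [tendsto_zero_iff_norm_tendsto_zero]
    have := h2.sqrt
    simpa using this
  have h4 : Tendsto (fun z => (2 * A z * w z + B z - B z) / (2 * A z)) l (𝓝 ((0 - 0) / (2 * A₀))) :=
    (h3.sub hB).div (hA.const_mul 2) (by simpa using hA₀)
  rw [sub_zero, zero_div] at h4
  refine h4.congr' ?_
  filter_upwards [hA.eventually_ne hA₀] with z hz
  field_simp
  ring

theorem deriv_ne_zero_of_analyticOrderAt_eq_one {f : ℂ → ℂ} {p : ℂ} (hf : AnalyticAt ℂ f p)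
    (h : analyticOrderAt f p = 1) : f p = 0 ∧ deriv f p ≠ 0 := by
  obtain ⟨g, hg, hg0, he⟩ := (hf.analyticOrderAt_eq_natCast (n := 1)).1 (by exact_mod_cast h)
  refine ⟨by simpa using he.self_of_nhds, ?_⟩
  have h1 : HasDerivAt (fun z => (z - p) ^ 1 • g z) (g p) p := by
    have := ((hasDerivAt_id p).sub_const p).mul hg.differentiableAt.hasDerivAt
    refine (this.congr_deriv (by simp)).congr_of_eventuallyEq (Eventually.of_forall fun z => ?_)
    simp
  rw [(h1.congr_of_eventuallyEq he).deriv]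
  exact hg0

theorem analyticAt_dslope {G : ℂ → ℂ} {p : ℂ} (hG : Differentiable ℂ G) :
    AnalyticAt ℂ (dslope G p) p := by
  have := (Complex.differentiableOn_dslope (s := Set.univ) (c := p) univ_mem).2
    hG.differentiableOn
  exact this.analyticAt univ_mem

/-- The exponential `e^{2izL}`. -/
def expL (L : ℝ) (z : ℂ) : ℂ := Complex.exp (2 * Complex.I * z * L)

theorem expL_ne_zero (L : ℝ) (z : ℂ) : expL L z ≠ 0 := Complex.exp_ne_zero _

theorem differentiable_expL (L : ℝ) : Differentiable ℂ (expL L) := by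
  unfold expL; fun_prop

theorem schwarz_expL (L : ℝ) (z : ℂ) : schwarz (expL L) z = (expL L z)⁻¹ := by
  rw [schwarz, expL, expL, ← Complex.exp_conj, ← Complex.exp_neg]
  congr 1
  simp [Complex.conj_ofNat]

section Branch

variable {N : ℕ} {L : ℝ} {a b R : ℂ → ℂ} {e : Fin (N + 1) → ℂ}

theorem IsBranch.analyticAt (hR : IsBranch L a b e R) {z : ℂ} (hz : z ∉ cuts e)
    (hp : ¬ IsPole R z) : AnalyticAt ℂ R z :=
  (hR.meromorphic hz).meromorphicOrderAt_nonneg_iff_analyticAt.1 (not_lt.1 hp)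

theorem _root_.AnalyticAt.not_isPole {f : ℂ → ℂ} {z : ℂ} (h : AnalyticAt ℂ f z) : ¬ IsPole f z :=
  not_lt.2 h.meromorphicOrderAt_nonneg

theorem IsBranch.isPole_schwarz (hR : IsBranch L a b e R) {z : ℂ} (hz : z ∉ cuts e) :
    IsPole (schwarz R) z ↔ IsPole R ((starRingEnd ℂ) z) := by
  have hz' : (starRingEnd ℂ) z ∉ cuts e := fun h => hz (conj_mem_cuts.1 h)
  constructor
  · intro h
    by_contra h'
    exact (hR.analyticAt hz' h').schwarz.not_isPole h
  · intro h
    have hm : MeromorphicAt (schwarz R) z := (hR.meromorphic hz').meromorphicAt.schwarz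
    refine (tendsto_cobounded_iff_meromorphicOrderAt_neg hm).1 ?_
    have h1 := (tendsto_cobounded_of_meromorphicOrderAt_neg h).comp (tendsto_conj_nhdsNE z)
    rw [← tendsto_norm_atTop_iff_cobounded] at h1 ⊢
    refine h1.congr fun w => ?_
    simp [schwarz]

theorem IsBranch.analyticAt_schwarz (hR : IsBranch L a b e R) {z : ℂ} (hz : z ∉ cuts e)
    (hp : ¬ IsPole (schwarz R) z) : AnalyticAt ℂ (schwarz R) z :=
  (hR.analyticAt (fun h => hz (conj_mem_cuts.1 h))
    (fun h => hp ((hR.isPole_schwarz hz).2 h))).schwarz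

theorem IsBranch.quadratic (hR : IsBranch L a b e R) {z : ℂ} (hz : z ∉ cuts e)
    (hp : ¬ IsPole R z) :
    expL L z * schwarz b z * R z ^ 2 + (expL L z * schwarz a z - a z) * R z + b z = 0 :=
  hR.equation z hz hp

/-- Conjugating the quadratic at the reflected point inverts `e^{2izL}`; multiplying by it restores
polynomial form. -/
theorem IsBranch.quadratic_schwarz (hR : IsBranch L a b e R) {z : ℂ} (hz : z ∉ cuts e)
    (hp : ¬ IsPole (schwarz R) z) :
    b z * schwarz R z ^ 2 + (a z - expL L z * schwarz a z) * schwarz R z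
      + expL L z * schwarz b z = 0 := by
  have h1 := hR.quadratic (fun h => hz (conj_mem_cuts.1 h))
    (fun h => hp ((hR.isPole_schwarz hz).2 h))
  have h2 := congrArg (starRingEnd ℂ) h1
  have h3 : (starRingEnd ℂ) (expL L ((starRingEnd ℂ) z)) = (expL L z)⁻¹ := schwarz_expL L z
  simp only [map_add, map_mul, map_sub, map_pow, map_zero, h3] at h2
  have e1 : (starRingEnd ℂ) (schwarz b ((starRingEnd ℂ) z)) = b z := schwarz_schwarz b z
  have e2 : (starRingEnd ℂ) (schwarz a ((starRingEnd ℂ) z)) = a z := schwarz_schwarz a z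
  rw [e1, e2] at h2
  have h4 := expL_ne_zero L z
  simp only [schwarz] at *
  field_simp at h2
  linear_combination h2

theorem not_isPole_of_bounded {f : ℂ → ℂ} {z : ℂ} {C : ℝ} (h : ∀ᶠ w in 𝓝[≠] z, ‖f w‖ ≤ C) :
    ¬ IsPole f z := by
  intro hp
  have h1 := tendsto_norm_atTop_iff_cobounded.2 (tendsto_cobounded_of_meromorphicOrderAt_neg hp)
  obtain ⟨w, h2, h3⟩ := (h.and (h1.eventually_gt_atTop C)).exists
  exact absurd h2 (not_le.2 h3)

/-- A function that is small near infinity is bounded near every far point, so it has no far poles.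
-/
theorem IsBranch.eventually_analyticAt_cocompact (hR : IsBranch L a b e R) :
    ∀ᶠ z in cocompact ℂ, z ∉ cuts e ∧ AnalyticAt ℂ R z ∧ AnalyticAt ℂ (schwarz R) z := by
  have key : ∀ᶠ z in cocompact ℂ, AnalyticAt ℂ R z := by
    have h1 := hR.decay.norm.eventually (gt_mem_nhds (show ‖(0 : ℂ)‖ < 1 by simp))
    rw [← Metric.cobounded_eq_cocompact, ← comap_norm_atTop, eventually_comap] at h1
    obtain ⟨r, hr⟩ := eventually_atTop.1 h1
    filter_upwards [eventually_notMem_cuts e, (Metric.cobounded_eq_cocompact (α := ℂ)) ▸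
      (tendsto_norm_cobounded_atTop.eventually_gt_atTop r)] with z hz hzr
    refine hR.analyticAt hz (not_isPole_of_bounded (C := 1) ?_)
    filter_upwards [nhdsWithin_le_nhds
      ((isOpen_lt continuous_const continuous_norm).mem_nhds hzr)] with w hw
    exact (hr _ (le_of_lt hw) w rfl).le
  have hconj : Tendsto (starRingEnd ℂ) (cocompact ℂ) (cocompact ℂ) :=
    (Complex.conjCLE.toHomeomorph.isClosedEmbedding).tendsto_cocompact
  filter_upwards [eventually_notMem_cuts e, key, hconj.eventually key] with z h1 h2 h3
  exact ⟨h1, h2, h3.schwarz⟩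

theorem IsBranch.decay_schwarz (hR : IsBranch L a b e R) :
    Tendsto (schwarz R) (cocompact ℂ) (𝓝 0) := by
  have hconj : Tendsto (starRingEnd ℂ) (cocompact ℂ) (cocompact ℂ) :=
    (Complex.conjCLE.toHomeomorph.isClosedEmbedding).tendsto_cocompact
  have := (Complex.continuous_conj.tendsto 0).comp (hR.decay.comp hconj)
  rwa [map_zero] at this

theorem IsBranch.left_values_schwarz (hR : IsBranch L a b e R) {p : ℂ}
    (hp : p ∈ cuts e \ branchPts e) :
    ∃ c, Tendsto (schwarz R) (𝓝[{w | w.re < p.re}] p) (𝓝 c) := by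
  obtain ⟨c, hc⟩ := hR.left_values ((starRingEnd ℂ) p)
    ⟨conj_mem_cuts.2 hp.1, fun h => hp.2 (conj_mem_branchPts.1 h)⟩
  exact ⟨_, (Complex.continuous_conj.tendsto c).comp
    (hc.comp (tendsto_conj_nhdsWithin (fun z hz => by simpa using hz) p))⟩

theorem IsBranch.right_values_schwarz (hR : IsBranch L a b e R) {p : ℂ}
    (hp : p ∈ cuts e \ branchPts e) :
    ∃ c, Tendsto (schwarz R) (𝓝[{w | p.re < w.re}] p) (𝓝 c) := by
  obtain ⟨c, hc⟩ := hR.right_values ((starRingEnd ℂ) p)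
    ⟨conj_mem_cuts.2 hp.1, fun h => hp.2 (conj_mem_branchPts.1 h)⟩
  exact ⟨_, (Complex.continuous_conj.tendsto c).comp
    (hc.comp (tendsto_conj_nhdsWithin (fun z hz => by simpa using hz) p))⟩

theorem IsBranch.eventually_bounded_cut (hR : IsBranch L a b e R) {p : ℂ}
    (hp : p ∈ cuts e \ branchPts e) :
    ∃ C, ∀ᶠ z in 𝓝[{w | w.re ≠ p.re}] p, ‖R z‖ ≤ C := by
  obtain ⟨c, hc⟩ := hR.left_values p hp
  obtain ⟨d, hd⟩ := hR.right_values p hp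
  refine ⟨max (‖c‖ + 1) (‖d‖ + 1), ?_⟩
  rw [vertical_compl, nhdsWithin_union]
  refine eventually_sup.2 ⟨?_, ?_⟩
  · filter_upwards [hc.norm.eventually (gt_mem_nhds (lt_add_one _))] with z hz
    exact hz.le.trans (le_max_left _ _)
  · filter_upwards [hd.norm.eventually (gt_mem_nhds (lt_add_one _))] with z hz
    exact hz.le.trans (le_max_right _ _)

theorem isOpen_re_ne (c : ℝ) : IsOpen {w : ℂ | w.re ≠ c} :=
  isOpen_ne_fun Complex.continuous_re continuous_const

theorem IsBranch.eventually_analyticAt_cut (hR : IsBranch L a b e R) {p : ℂ}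
    (hp : p ∈ cuts e \ branchPts e) : ∀ᶠ z in 𝓝[(cuts e)ᶜ] p, AnalyticAt ℂ R z := by
  obtain ⟨C, hC⟩ := hR.eventually_bounded_cut hp
  have h1 := eventually_nhdsWithin_iff.1 hC
  rw [eventually_nhdsWithin_iff]
  filter_upwards [h1.eventually_nhds, eventually_mem_cuts hp.1 hp.2] with z hz hz' hzc
  refine hR.analyticAt hzc (not_isPole_of_bounded (C := C) ?_)
  have hne : z.re ≠ p.re := fun h => hzc (hz' h)
  filter_upwards [nhdsWithin_le_nhds hz, nhdsWithin_le_nhds ((isOpen_re_ne p.re).mem_nhds hne)]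
    with w h2 h3 using h2 h3

theorem IsBranch.eventually_analyticAt_ne (hR : IsBranch L a b e R) {p : ℂ} (hp : p ∉ cuts e) :
    ∀ᶠ z in 𝓝[≠] p, AnalyticAt ℂ R z :=
  (hR.meromorphic hp).meromorphicAt.eventually_analyticAt

/-- Poles of `R` are zeros of `b*`. -/
theorem IsBranch.schwarz_b_eq_zero (hS : SpectralData L a b) (hR : IsBranch L a b e R) {p : ℂ}
    (hp : p ∉ cuts e) (hpole : IsPole R p) : schwarz b p = 0 := by
  have h1 := tendsto_cobounded_of_meromorphicOrderAt_neg hpole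
  have h2 : Tendsto (fun z => (R z)⁻¹) (𝓝[≠] p) (𝓝 0) := tendsto_inv₀_cobounded.comp h1
  have h3 : ∀ᶠ z in 𝓝[≠] p, R z ≠ 0 := by
    have := tendsto_norm_atTop_iff_cobounded.2 h1
    filter_upwards [this.eventually_gt_atTop 0] with z hz using norm_pos_iff.1 hz
  have hcont : ∀ f : ℂ → ℂ, Differentiable ℂ f → Tendsto f (𝓝[≠] p) (𝓝 (f p)) := fun f hf =>
    (hf p).continuousAt.tendsto.mono_left nhdsWithin_le_nhds
  have h4 : Tendsto (fun z => -((expL L z * schwarz a z - a z) * (R z)⁻¹ + b z * (R z)⁻¹ ^ 2))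
      (𝓝[≠] p) (𝓝 (-((expL L p * schwarz a p - a p) * 0 + b p * 0 ^ 2))) :=
    ((((hcont _ (differentiable_expL L)).mul (hcont _ hS.diff_a.schwarz)).sub
      (hcont _ hS.diff_a)).mul h2 |>.add ((hcont _ hS.diff_b).mul (h2.pow 2))).neg
  have h5 : Tendsto (fun z => expL L z * schwarz b z) (𝓝[≠] p) (𝓝 (expL L p * schwarz b p)) :=
    (hcont _ (differentiable_expL L)).mul (hcont _ hS.diff_b.schwarz)
  have h6 : expL L p * schwarz b p = 0 := by
    refine (tendsto_nhds_unique (h5.congr' ?_) h4).trans (by simp)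
    filter_upwards [h3, hR.eventually_analyticAt_ne hp,
      nhdsWithin_le_nhds ((isClosed_cuts e).isOpen_compl.mem_nhds hp)] with z h7 h8 h9
    have := hR.quadratic h9 h8.not_isPole
    field_simp
    linear_combination this
  exact (mul_eq_zero.1 h6).resolve_left (expL_ne_zero L p)

/-! ### Behaviour of `R` at the branch points -/

theorem exp_half_sq (L : ℝ) (z : ℂ) :
    expL L z = Complex.exp (Complex.I * z * L) ^ 2 := by
  rw [expL, ← Complex.exp_nat_mul]; congr 1; push_cast; ring

/-- The right side is the discriminant of the quadratic for `R`, so simple zeros of `Δ² - 4` are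
simple zeros of that discriminant. -/
theorem expL_mul_discr (hS : SpectralData L a b) (z : ℂ) :
    expL L z * (discr L a z ^ 2 - 4) =
      (expL L z * schwarz a z - a z) ^ 2 - 4 * expL L z * (b z * schwarz b z) := by
  have h1 := hS.det z
  have h2 := Complex.exp_ne_zero (Complex.I * z * L)
  rw [discr, exp_half_sq, Complex.exp_neg]
  field_simp
  linear_combination (4 * Complex.exp (Complex.I * z * L) ^ 2) * h1

/-- At a branch point either `b*` does not vanish, or it has a simple zero there. -/
theorem deriv_schwarz_b_ne_zero (hS : SpectralData L a b) (he : IsMainSpectrum L a e)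
    {p : ℂ} (hp : p ∈ branchPts e) (hb : schwarz b p = 0) :
    expL L p * schwarz a p - a p = 0 ∧ deriv (schwarz b) p ≠ 0 := by
  have hda := hS.diff_a
  have hdb := hS.diff_b
  have hdas := hS.diff_a.schwarz
  have hdbs := hS.diff_b.schwarz
  have hdE := differentiable_expL L
  have hf : Differentiable ℂ (fun z => discr L a z ^ 2 - 4) := by
    unfold discr; fun_prop
  obtain ⟨h0, h1⟩ := deriv_ne_zero_of_analyticOrderAt_eq_one (hf.analyticAt p)
    ((he.simple_zeros p).2 hp)
  have hk : expL L p * schwarz a p - a p = 0 := by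
    have := expL_mul_discr hS p
    rw [h0, hb] at this
    have h2 : (expL L p * schwarz a p - a p) ^ 2 = 0 := by linear_combination -this
    exact pow_eq_zero_iff (two_ne_zero) |>.1 h2
  refine ⟨hk, fun hd => ?_⟩
  -- If `b*` had a double zero, the discriminant would vanish to second order at `p`, against the
  -- simplicity of the zero of `Δ² - 4`. The two sides of `expL_mul_discr` are differentiated at
  -- `p`.
  have e1 : HasDerivAt (fun z => expL L z * (discr L a z ^ 2 - 4))
      (expL L p * deriv (fun z => discr L a z ^ 2 - 4) p) p := by
    refine ((hdE p).hasDerivAt.mul (hf p).hasDerivAt).congr_deriv ?_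
    rw [h0]; ring
  have e2 : HasDerivAt (fun z => (expL L z * schwarz a z - a z) ^ 2
      - 4 * expL L z * (b z * schwarz b z)) 0 p := by
    have d1 := (((hdE.mul hdas).sub hda) p).hasDerivAt.pow 2
    have d2 := ((hdE p).hasDerivAt.const_mul 4).mul ((hdb p).hasDerivAt.mul (hdbs p).hasDerivAt)
    refine (d1.sub d2).congr_deriv ?_
    simp only [Pi.sub_apply, Pi.mul_apply, hk, hd, hb]
    ring
  have e3 := e1.unique (e2.congr_of_eventuallyEq
    (Eventually.of_forall fun z => expL_mul_discr hS z))
  exact (mul_ne_zero (expL_ne_zero L p) h1) e3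

/-- Poles of `R` are zeros of `b*`, and these do not accumulate at `p`. For the growth bound,
multiply the quadratic by a power of `z - p` to get an equation for `(z - p) R` whose leading
coefficient has a nonzero limit while the others tend to zero. If `b*` vanishes at `p`, one factor
`z - p` is hidden in `b*` and another in the middle coefficient. -/
theorem IsBranch.branch_point (hS : SpectralData L a b) (he : IsMainSpectrum L a e)
    (hR : IsBranch L a b e R) {p : ℂ} (hp : p ∈ branchPts e) :
    (∀ᶠ z in 𝓝[(cuts e)ᶜ] p, AnalyticAt ℂ R z) ∧
      Tendsto (fun z => (z - p) * R z) (𝓝[(cuts e)ᶜ] p) (𝓝 0) := by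
  have hda := hS.diff_a
  have hdb := hS.diff_b
  have hdas := hS.diff_a.schwarz
  have hdbs := hS.diff_b.schwarz
  have hdE := differentiable_expL L
  have hpc : p ∈ cuts e := branchPts_subset_cuts he.im_pos hp
  have hcont : ∀ f : ℂ → ℂ, ContinuousAt f p → Tendsto f (𝓝[(cuts e)ᶜ] p) (𝓝 (f p)) := fun f hf =>
    hf.tendsto.mono_left nhdsWithin_le_nhds
  have hsub : Tendsto (fun z => z - p) (𝓝[(cuts e)ᶜ] p) (𝓝 0) := by
    simpa using hcont (fun z => z - p) (by fun_prop)
  have hbne : ∀ᶠ z in 𝓝[(cuts e)ᶜ] p, schwarz b z ≠ 0 := by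
    by_cases hb : schwarz b p = 0
    · have h1 := (hdbs p).hasDerivAt.eventually_ne (c := 0)
        (deriv_schwarz_b_ne_zero hS he hp hb).2
      exact nhdsWithin_mono p (show (cuts e)ᶜ ⊆ {p}ᶜ from
        fun z (hz : z ∉ cuts e) (h : z = p) => hz (by rw [h]; exact hpc)) h1
    · exact nhdsWithin_le_nhds ((hdbs p).continuousAt.eventually_ne hb)
  have han : ∀ᶠ z in 𝓝[(cuts e)ᶜ] p, AnalyticAt ℂ R z := by
    filter_upwards [hbne, self_mem_nhdsWithin] with z h1 h2
    exact hR.analyticAt h2 fun h => h1 (hR.schwarz_b_eq_zero hS h2 h)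
  refine ⟨han, ?_⟩
  by_cases hb : schwarz b p = 0
  · obtain ⟨hk, hd⟩ := deriv_schwarz_b_ne_zero hS he hp hb
    have hkd : Differentiable ℂ (fun z => expL L z * schwarz a z - a z) :=
      (hdE.mul hdas).sub hda
    have c1 := (analyticAt_dslope (p := p) hdbs).continuousAt
    have c2 := (analyticAt_dslope (p := p) hkd).continuousAt
    refine tendsto_zero_of_quadratic (A₀ := expL L p * dslope (schwarz b) p p)
      (A := fun z => expL L z * dslope (schwarz b) p z)
      (B := fun z => (z - p) * dslope (fun z => expL L z * schwarz a z - a z) p z)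
      (C := fun z => (z - p) * b z) ?_ ?_ ?_ ?_ ?_
    · rw [dslope_same]; exact mul_ne_zero (expL_ne_zero L p) hd
    · exact (hcont _ (hdE p).continuousAt).mul (hcont _ c1)
    · simpa using hsub.mul (hcont _ c2)
    · simpa using hsub.mul (hcont _ (hdb p).continuousAt)
    · filter_upwards [han, self_mem_nhdsWithin] with z h1 h2
      have h3 := hR.quadratic h2 h1.not_isPole
      have h4 : (z - p) * dslope (schwarz b) p z = schwarz b z := by
        have := sub_smul_dslope (schwarz b) p z
        rwa [hb, sub_zero, smul_eq_mul] at this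
      have h5 : (z - p) * dslope (fun z => expL L z * schwarz a z - a z) p z =
          expL L z * schwarz a z - a z := by
        have := sub_smul_dslope (fun z => expL L z * schwarz a z - a z) p z
        rwa [hk, sub_zero, smul_eq_mul] at this
      linear_combination (z - p) * h3 + (expL L z * R z ^ 2 * (z - p)) * h4 +
        ((z - p) * R z) * h5
  · have hk : ContinuousAt (fun z => expL L z * schwarz a z - a z) p :=
      (((hdE.mul hdas).sub hda) p).continuousAt
    refine tendsto_zero_of_quadratic (A₀ := expL L p * schwarz b p)
      (A := fun z => expL L z * schwarz b z)
      (B := fun z => (z - p) * (expL L z * schwarz a z - a z))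
      (C := fun z => (z - p) * ((z - p) * b z)) (mul_ne_zero (expL_ne_zero L p) hb) ?_ ?_ ?_ ?_
    · exact (hcont _ (hdE p).continuousAt).mul (hcont _ (hdbs p).continuousAt)
    · simpa using hsub.mul (hcont _ hk)
    · simpa using hsub.mul (hsub.mul (hcont _ (hdb p).continuousAt))
    · filter_upwards [han, self_mem_nhdsWithin] with z h1 h2
      have h3 := hR.quadratic h2 h1.not_isPole
      linear_combination (z - p) ^ 2 * h3

/-- Poles do not accumulate anywhere, including at the cuts: they are isolated off the cuts,
excluded near cut interiors by the finite boundary values, and near branch points by `b* ≠ 0`. -/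
theorem IsBranch.eventually_analyticAt (hS : SpectralData L a b) (he : IsMainSpectrum L a e)
    (hR : IsBranch L a b e R) (p : ℂ) :
    ∀ᶠ z in 𝓝[(cuts e ∪ {p})ᶜ] p, AnalyticAt ℂ R z := by
  by_cases hp : p ∈ cuts e
  · have h1 : ∀ᶠ z in 𝓝[(cuts e)ᶜ] p, AnalyticAt ℂ R z := by
      by_cases hb : p ∈ branchPts e
      · exact (hR.branch_point hS he hb).1
      · exact hR.eventually_analyticAt_cut ⟨hp, hb⟩
    exact nhdsWithin_mono p (Set.compl_subset_compl.2 Set.subset_union_left) h1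
  · exact nhdsWithin_mono p (Set.compl_subset_compl.2 Set.subset_union_right)
      (hR.eventually_analyticAt_ne hp)

theorem IsBranch.eventually_analyticAt_schwarz (hS : SpectralData L a b)
    (he : IsMainSpectrum L a e) (hR : IsBranch L a b e R) (p : ℂ) :
    ∀ᶠ z in 𝓝[(cuts e ∪ {p})ᶜ] p, AnalyticAt ℂ (schwarz R) z := by
  have h1 : Tendsto (starRingEnd ℂ) (𝓝[(cuts e ∪ {p})ᶜ] p)
      (𝓝[(cuts e ∪ {(starRingEnd ℂ) p})ᶜ] ((starRingEnd ℂ) p)) := by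
    refine tendsto_conj_nhdsWithin (fun z hz => ?_) p
    rw [Set.mem_compl_iff] at hz ⊢
    refine fun h => hz ?_
    rcases h with h | h
    · exact Or.inl (conj_mem_cuts.1 h)
    · exact Or.inr (by simpa using congrArg (starRingEnd ℂ) h)
  filter_upwards [h1.eventually (hR.eventually_analyticAt hS he _)] with z hz using hz.schwarz

theorem IsBranch.tendsto_residue (hR : IsBranch L a b e R) {ξ : ℂ} (hξ : ξ ∈ (Q1 ∪ Q3) \ cuts e)
    (hp : IsPole R ξ) :
    Tendsto (fun z => (z - ξ) * R z) (𝓝[≠] ξ) (𝓝 (residue R ξ)) := by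
  refine tendsto_nhds_limUnder ?_
  have h1 := hR.poles_simple ξ hξ hp
  obtain ⟨g, hg, -, he⟩ := (meromorphicOrderAt_eq_int_iff (n := -1)
    (hR.meromorphic hξ.2).meromorphicAt).1 (by exact_mod_cast h1)
  refine ⟨g ξ, (hg.continuousAt.tendsto.mono_left nhdsWithin_le_nhds).congr' ?_⟩
  filter_upwards [he, self_mem_nhdsWithin] with z hz hne
  have : z - ξ ≠ 0 := sub_ne_zero.2 hne
  rw [hz, smul_eq_mul, zpow_neg_one]
  field_simp

theorem IsBranch.tendsto_residue_schwarz (hR : IsBranch L a b e R) {ξ : ℂ}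
    (hξ : ξ ∈ (Q2 ∪ Q4) \ cuts e) (hp : IsPole (schwarz R) ξ) :
    Tendsto (fun z => (z - ξ) * schwarz R z) (𝓝[≠] ξ) (𝓝 (residue (schwarz R) ξ)) := by
  refine tendsto_nhds_limUnder ?_
  have hmem : (starRingEnd ℂ) ξ ∈ (Q1 ∪ Q3) \ cuts e := by
    refine ⟨?_, fun h => hξ.2 (conj_mem_cuts.1 h)⟩
    rcases hξ.1 with h | h
    · right; simpa [Q2, Q3] using h
    · left; simpa [Q1, Q4] using h
  have h1 := (hR.tendsto_residue hmem ((hR.isPole_schwarz hξ.2).1 hp)).comp (tendsto_conj_nhdsNE ξ)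
  refine ⟨_, ((Complex.continuous_conj.tendsto _).comp h1).congr fun z => ?_⟩
  simp [schwarz]

/-! ### The Floquet multipliers -/

/-- Unimodularity of the Floquet multipliers on the real axis. -/
theorem IsBranch.multiplier_real (hS : SpectralData L a b)
    (hR : IsBranch L a b e R) {z : ℂ} (hz : z ∉ cuts e) (hr : z.im = 0) :
    (a z + b z * schwarz R z) * (schwarz a z + schwarz b z * R z) = 1 := by
  have hp : ¬ IsPole R z := fun h => (hR.poles_off_axes z hz h).2 hr
  have hK := hR.quadratic hz hp
  set w := Complex.exp (Complex.I * z * L) * (schwarz a z + schwarz b z * R z) with hw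
  have hconj : a z + b z * schwarz R z = (starRingEnd ℂ) (schwarz a z + schwarz b z * R z) := by
    rw [map_add, map_mul, schwarz_ofReal _ hr, schwarz_ofReal _ hr, schwarz_ofReal _ hr,
      Complex.conj_conj, Complex.conj_conj]
  have hexp : (starRingEnd ℂ) (Complex.exp (Complex.I * z * L)) *
      Complex.exp (Complex.I * z * L) = 1 := by
    rw [← Complex.exp_conj, ← Complex.exp_add]
    have : (starRingEnd ℂ) z = z := Complex.conj_eq_iff_im.2 hr
    simp [this]
  have hgoal : (starRingEnd ℂ) w * w =
      (a z + b z * schwarz R z) * (schwarz a z + schwarz b z * R z) := by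
    rw [hconj, hw, map_mul]
    linear_combination ((starRingEnd ℂ) (schwarz a z + schwarz b z * R z) *
      (schwarz a z + schwarz b z * R z)) * hexp
  -- `w` is an eigenvalue of the monodromy matrix, which has trace `Δ` and determinant one.
  have hquad : w ^ 2 - discr L a z * w + 1 = 0 := by
    have h2 : Complex.exp (Complex.I * z * L) ≠ 0 := Complex.exp_ne_zero _
    rw [exp_half_sq] at hK
    rw [hw, discr, Complex.exp_neg]
    field_simp
    linear_combination (schwarz b z) * hK - hS.det z
  obtain ⟨d, hd, hd2⟩ : ∃ d : ℝ, discr L a z = d ∧ d ^ 2 ≤ 4 := by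
    have h1 : Complex.exp (Complex.I * z * L) * schwarz a z =
        (starRingEnd ℂ) (Complex.exp (-(Complex.I * z * L)) * a z) := by
      rw [map_mul, schwarz_ofReal _ hr, ← Complex.exp_conj]
      have : (starRingEnd ℂ) z = z := Complex.conj_eq_iff_im.2 hr
      simp [this]
    refine ⟨2 * (Complex.exp (-(Complex.I * z * L)) * a z).re, ?_, ?_⟩
    · rw [discr, h1, Complex.add_conj]
    · have h3 : ‖Complex.exp (-(Complex.I * z * L)) * a z‖ ≤ 1 := by
        rw [norm_mul, Complex.norm_exp]
        have h4 : (-(Complex.I * z * L)).re = 0 := by simp [hr]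
        rw [h4, Real.exp_zero, one_mul]
        have := hS.bound_upper z hr.ge
        nlinarith [sq_nonneg ‖b z‖, norm_nonneg (a z)]
      have h5 := abs_le.1 ((Complex.abs_re_le_norm _).trans h3)
      nlinarith
  rw [← hgoal, mul_comm, Complex.mul_conj, Complex.normSq_apply]
  have him := congrArg Complex.im hquad
  have hre := congrArg Complex.re hquad
  rw [hd] at him hre
  simp only [Complex.add_im, Complex.sub_im, Complex.mul_im, Complex.add_re, Complex.sub_re,
    Complex.mul_re, pow_two, Complex.one_re, Complex.one_im, Complex.zero_re, Complex.zero_im,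
    Complex.ofReal_re, Complex.ofReal_im] at him hre
  -- On the real axis `Δ = d` is real with `|d| ≤ 2`, so the roots are conjugate on the unit circle.
  -- Either `2 Re w = d`, or `w` is real and then `(w - d/2)² = d²/4 - 1 ≤ 0` forces a double root
  -- `±1`.
  have hx : w.im * (2 * w.re - d) = 0 := by linear_combination him
  have : w.re * w.re + w.im * w.im = 1 := by
    rcases mul_eq_zero.1 hx with h | h
    · rw [h] at hre ⊢
      have h1 : w.re - d / 2 = 0 := by
        have : (w.re - d / 2) ^ 2 ≤ 0 := by nlinarith
        exact pow_eq_zero_iff (two_ne_zero) |>.1 (le_antisymm this (sq_nonneg _))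
      nlinarith
    · linear_combination -hre + w.re * h
  exact_mod_cast this

/-- The two Floquet multipliers are inverse to each other. -/
theorem IsBranch.multiplier (hS : SpectralData L a b)
    (hR : IsBranch L a b e R) {z : ℂ} (hz : z ∉ cuts e) (hp : ¬ IsPole R z)
    (hp' : ¬ IsPole (schwarz R) z) :
    (a z + b z * schwarz R z) * (schwarz a z + schwarz b z * R z) = 1 := by
  have hda := hS.diff_a
  have hdb := hS.diff_b
  have hdas := hS.diff_a.schwarz
  have hdbs := hS.diff_b.schwarz
  set f : ℂ → ℂ :=
    fun z => (a z + b z * schwarz R z) * (schwarz a z + schwarz b z * R z) - 1 with hf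
  have hfan : ∀ w, AnalyticAt ℂ R w → AnalyticAt ℂ (schwarz R) w → AnalyticAt ℂ f w :=
    fun w h1 h2 => (((hda.analyticAt w).add ((hdb.analyticAt w).mul h2)).mul
      ((hdas.analyticAt w).add ((hdbs.analyticAt w).mul h1))).sub analyticAt_const
  suffices ∀ z ∉ cuts e, ¬ IsPole R z → ¬ IsPole (schwarz R) z → f z = 0 from
    sub_eq_zero.1 (this z hz hp hp')
  -- A thin vertical strip around `z` avoids all cuts, is convex and meets the real axis, where the
  -- identity is known; the identity theorem for meromorphic functions carries it up to `z`.
  have hstrip : ∀ z : ℂ, (∀ j, z.re ≠ (e j).re) → ¬ IsPole R z → ¬ IsPole (schwarz R) z →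
      f z = 0 := by
    intro z hz hp hp'
    have hcut : ∀ w : ℂ, (∀ j, w.re ≠ (e j).re) → w ∉ cuts e := by
      rintro w hw ⟨j, hj, -⟩; exact hw j hj
    have ho : IsOpen {x : ℝ | ∀ j, x ≠ (e j).re} := by
      have : {x : ℝ | ∀ j, x ≠ (e j).re} = ⋂ j, {x : ℝ | x ≠ (e j).re} := by ext; simp
      rw [this]
      exact isOpen_iInter_of_finite fun j => isOpen_ne
    obtain ⟨δ, hδ, hball⟩ := Metric.isOpen_iff.1 ho z.re hz
    set U : Set ℂ := Complex.re ⁻¹' Metric.ball z.re δ with hU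
    have hUcut : ∀ w ∈ U, w ∉ cuts e := fun w hw => hcut w (hball hw)
    have hUpre : IsPreconnected U :=
      ((convex_ball z.re δ).linear_preimage Complex.reLm).isPreconnected
    have hUo : IsOpen U := Metric.isOpen_ball.preimage Complex.continuous_re
    have hfm : MeromorphicOn f U := by
      intro w hw
      have h1 : MeromorphicAt R w := (hR.meromorphic (hUcut w hw)).meromorphicAt
      have h2 : MeromorphicAt (schwarz R) w :=
        (hR.meromorphic (fun h => hUcut w hw (conj_mem_cuts.1 h))).meromorphicAt.schwarz
      exact ((((hda.analyticAt w).meromorphicAt).add ((hdb.analyticAt w).meromorphicAt.mul h2)).mul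
        ((hdas.analyticAt w).meromorphicAt.add ((hdbs.analyticAt w).meromorphicAt.mul h1))).sub
        analyticAt_const.meromorphicAt
    have hx0 : ((z.re : ℝ) : ℂ) ∈ U := by simp [hU, hδ]
    have hzU : z ∈ U := by simp [hU, hδ]
    have hreal : ∀ w ∈ U, w.im = 0 → AnalyticAt ℂ f w ∧ f w = 0 := by
      intro w hw him
      have h1 := hUcut w hw
      refine ⟨hfan w (hR.analyticAt h1 fun h => (hR.poles_off_axes w h1 h).2 him)
        (hR.analyticAt_schwarz h1 fun h => ?_), sub_eq_zero.2 (hR.multiplier_real hS h1 him)⟩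
      have := (hR.poles_off_axes _ (fun h => h1 (conj_mem_cuts.1 h))
        ((hR.isPole_schwarz h1).1 h)).2
      exact this (by simp [him])
    have htop : meromorphicOrderAt f ((z.re : ℝ) : ℂ) = ⊤ := by
      rw [meromorphicOrderAt_eq_top_iff]
      refine ((hreal _ hx0 (by simp)).1.frequently_zero_iff_eventually_zero.1 ?_).filter_mono
        nhdsWithin_le_nhds
      have ht : Tendsto (fun s : ℝ => (((z.re + s : ℝ)) : ℂ)) (𝓝[≠] 0)
          (𝓝[≠] ((z.re : ℝ) : ℂ)) := by
        refine tendsto_nhdsWithin_iff.2 ⟨?_, ?_⟩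
        · have : Continuous fun s : ℝ => (((z.re + s : ℝ)) : ℂ) := by fun_prop
          simpa using (this.tendsto 0).mono_left (nhdsWithin_le_nhds (s := {0}ᶜ))
        · filter_upwards [self_mem_nhdsWithin] with s hs
          simpa using hs
      refine ht.frequently (Eventually.frequently ?_)
      filter_upwards [ht.eventually (nhdsWithin_le_nhds (hUo.mem_nhds hx0))] with s hs
      exact (hreal _ hs (by simp)).2
    have htop' : meromorphicOrderAt f z = ⊤ := by
      by_contra h
      exact hfm.meromorphicOrderAt_ne_top_of_isPreconnected hUpre hzU hx0 h htop
    have hev := meromorphicOrderAt_eq_top_iff.1 htop'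
    have hc := (hfan z (hR.analyticAt (hUcut z hzU) hp)
      (hR.analyticAt_schwarz (hUcut z hzU) hp')).continuousAt
    refine tendsto_nhds_unique (hc.tendsto.mono_left (nhdsWithin_le_nhds (s := {z}ᶜ))) ?_
    exact tendsto_const_nhds.congr' (hev.mono fun w hw => hw.symm)
  intro z hz hp hp'
  have h1 := hR.analyticAt hz hp
  have h2 := hR.analyticAt_schwarz hz hp'
  -- A point above or below a cut is on no admissible strip; it is reached as a limit from the
  -- right.
  have ht : Tendsto (fun s : ℝ => z + s) (𝓝[>] 0) (𝓝 z) := by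
    have : Continuous fun s : ℝ => z + (s : ℂ) := by fun_prop
    simpa using (this.tendsto 0).mono_left (nhdsWithin_le_nhds (s := Set.Ioi 0))
  refine tendsto_nhds_unique ((hfan z h1 h2).continuousAt.tendsto.comp ht) ?_
  refine tendsto_const_nhds.congr' ?_
  have hne : ∀ᶠ s : ℝ in 𝓝[>] 0, ∀ j, z.re + s ≠ (e j).re := by
    refine eventually_all.2 fun j => ?_
    rcases eq_or_ne z.re (e j).re with h | h
    · filter_upwards [self_mem_nhdsWithin] with s hs
      have : 0 < s := hs
      intro h'; linarith
    · have : Tendsto (fun s : ℝ => z.re + s) (𝓝[>] 0) (𝓝 (z.re + 0)) :=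
        ((continuous_const.add continuous_id).tendsto 0).mono_left nhdsWithin_le_nhds
      rw [add_zero] at this
      exact this.eventually_ne h
  filter_upwards [hne, ht.eventually h1.eventually_analyticAt,
    ht.eventually h2.eventually_analyticAt] with s h3 h4 h5
  exact (hstrip _ (fun j => by simpa using h3 j) h4.not_isPole h5.not_isPole).symm

end Branch

end

end PeriodicNLS

namespace PeriodicNLS

noncomputable section

/-! ### The dressing of a solution of the Riemann–Hilbert problem -/

/-- Entrywise analyticity of a matrix function. -/
def MAnalyticAt (A : ℂ → Mat2) (p : ℂ) : Prop := ∀ i j, AnalyticAt ℂ (fun z => A z i j) p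

theorem MAnalyticAt.mul {A B : ℂ → Mat2} {p : ℂ} (hA : MAnalyticAt A p) (hB : MAnalyticAt B p) :
    MAnalyticAt (fun z => A z * B z) p := by
  intro i j
  simp only [Matrix.mul_apply, Fin.sum_univ_two]
  exact ((hA i 0).mul (hB 0 j)).add ((hA i 1).mul (hB 1 j))

theorem MAnalyticAt.add {A B : ℂ → Mat2} {p : ℂ} (hA : MAnalyticAt A p) (hB : MAnalyticAt B p) :
    MAnalyticAt (fun z => A z + B z) p := fun i j => (hA i j).add (hB i j)

theorem MAnalyticAt.smul {f : ℂ → ℂ} {A : ℂ → Mat2} {p : ℂ} (hf : AnalyticAt ℂ f p)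
    (hA : MAnalyticAt A p) : MAnalyticAt (fun z => f z • A z) p := fun i j => hf.mul (hA i j)

theorem mAnalyticAt_const (A : Mat2) (p : ℂ) : MAnalyticAt (fun _ => A) p :=
  fun _ _ => analyticAt_const

theorem mAnalyticAt_of {f g h k : ℂ → ℂ} {p : ℂ} (hf : AnalyticAt ℂ f p) (hg : AnalyticAt ℂ g p)
    (hh : AnalyticAt ℂ h p) (hk : AnalyticAt ℂ k p) :
    MAnalyticAt (fun z => !![f z, g z; h z, k z]) p := by
  intro i j
  fin_cases i <;> fin_cases j <;> assumption

theorem MAnalyticAt.continuousAt {A : ℂ → Mat2} {p : ℂ} (hA : MAnalyticAt A p) :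
    ContinuousAt A p :=
  continuousAt_pi.2 fun i => continuousAt_pi.2 fun j => (hA i j).continuousAt

theorem MAnalyticAt.congr {A B : ℂ → Mat2} {p : ℂ} (hA : MAnalyticAt A p)
    (h : ∀ᶠ z in 𝓝 p, A z = B z) : MAnalyticAt B p := fun i j =>
  (hA i j).congr (by filter_upwards [h] with z hz; rw [hz])

theorem tendsto_entry {l : Filter ℂ} {A : ℂ → Mat2} {A₀ : Mat2} (h : Tendsto A l (𝓝 A₀))
    (i j : Fin 2) : Tendsto (fun z => A z i j) l (𝓝 (A₀ i j)) :=
  ((continuous_apply_apply i j).tendsto A₀).comp h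

theorem tendsto_matrix {l : Filter ℂ} {A : ℂ → Mat2} {A₀ : Mat2}
    (h : ∀ i j, Tendsto (fun z => A z i j) l (𝓝 (A₀ i j))) : Tendsto A l (𝓝 A₀) :=
  tendsto_pi_nhds.2 fun i => tendsto_pi_nhds.2 fun j => h i j

/-- The phase `i z x + 2 i z² t`. -/
def phase (x t : ℝ) (z : ℂ) : ℂ := Complex.I * z * x + 2 * Complex.I * z ^ 2 * t

theorem differentiable_phase (x t : ℝ) : Differentiable ℂ (phase x t) := by
  unfold phase; fun_prop

theorem expσ₃_mul (u v : ℂ) : expσ₃ u * expσ₃ v = expσ₃ (u + v) := by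
  ext i j
  fin_cases i <;> fin_cases j <;> simp [expσ₃, Matrix.mul_apply, Fin.sum_univ_two, Complex.exp_add,
    mul_comm]

theorem expσ₃_zero : expσ₃ 0 = 1 := by
  ext i j
  fin_cases i <;> fin_cases j <;> simp [expσ₃]

theorem expσ₃_mul_neg (u : ℂ) : expσ₃ u * expσ₃ (-u) = 1 := by
  rw [expσ₃_mul, add_neg_cancel, expσ₃_zero]

theorem mAnalyticAt_expσ₃ {f : ℂ → ℂ} (hf : Differentiable ℂ f) (p : ℂ) :
    MAnalyticAt (fun z => expσ₃ (f z)) p :=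
  mAnalyticAt_of ((hf.cexp).analyticAt p) analyticAt_const analyticAt_const
    ((hf.neg.cexp).analyticAt p)

theorem evolve_eq (x t : ℝ) (z : ℂ) (J : Mat2) :
    evolve x t z J = expσ₃ (-phase x t z) * J * expσ₃ (phase x t z) := rfl

/-- A triangular factor followed by `s`, conjugated by the phase. -/
def dressWith (ρ : ℂ → ℂ) (n s : ℂ → Mat2) (x t : ℝ) (z : ℂ) : Mat2 :=
  expσ₃ (-phase x t z) * ((1 + ρ z • n z) * s z)

/-- The transition matrix `s = (a*, b; -b*, a)` and its inverse. -/
def matS (a b : ℂ → ℂ) (z : ℂ) : Mat2 := !![schwarz a z, b z; -schwarz b z, a z]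

def matSInv (a b : ℂ → ℂ) (z : ℂ) : Mat2 := !![a z, -b z; schwarz b z, schwarz a z]

def nUp (η : ℂ → ℂ) (z : ℂ) : Mat2 := !![0, η z; 0, 0]

def nLow (η : ℂ → ℂ) (z : ℂ) : Mat2 := !![0, 0; η z, 0]

open Classical in
/-- The piecewise dressing which removes all jumps and poles. -/
def dress (L : ℝ) (a b R : ℂ → ℂ) (x t : ℝ) (z : ℂ) : Mat2 :=
  if z ∈ Q1 then dressWith R (nUp fun _ => -1) (fun _ => 1) x t z
  else if z ∈ Q2 then
    dressWith (schwarz R) (nLow fun z => (expL L z)⁻¹) (matSInv a b) x t z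
  else if z ∈ Q3 then dressWith R (nUp fun z => -expL L z) (matSInv a b) x t z
  else dressWith (schwarz R) (nLow fun _ => 1) (fun _ => 1) x t z

theorem notMem_Q1_of_Q2 {z : ℂ} (h : z ∈ Q2) : z ∉ Q1 := fun h' => (h.1.trans h'.1).false
theorem notMem_Q1_of_Q3 {z : ℂ} (h : z ∈ Q3) : z ∉ Q1 := fun h' => (h.1.trans h'.1).false
theorem notMem_Q2_of_Q3 {z : ℂ} (h : z ∈ Q3) : z ∉ Q2 := fun h' => (h.2.trans h'.2).false
theorem notMem_Q1_of_Q4 {z : ℂ} (h : z ∈ Q4) : z ∉ Q1 := fun h' => (h.2.trans h'.2).false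
theorem notMem_Q2_of_Q4 {z : ℂ} (h : z ∈ Q4) : z ∉ Q2 := fun h' => (h.2.trans h'.2).false
theorem notMem_Q3_of_Q4 {z : ℂ} (h : z ∈ Q4) : z ∉ Q3 := fun h' => (h'.1.trans h.1).false

theorem isOpen_Q1 : IsOpen Q1 := (isOpen_lt continuous_const Complex.continuous_re).inter
  (isOpen_lt continuous_const Complex.continuous_im)
theorem isOpen_Q2 : IsOpen Q2 := (isOpen_lt Complex.continuous_re continuous_const).inter
  (isOpen_lt continuous_const Complex.continuous_im)
theorem isOpen_Q3 : IsOpen Q3 := (isOpen_lt Complex.continuous_re continuous_const).inter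
  (isOpen_lt Complex.continuous_im continuous_const)
theorem isOpen_Q4 : IsOpen Q4 := (isOpen_lt continuous_const Complex.continuous_re).inter
  (isOpen_lt Complex.continuous_im continuous_const)

theorem mem_quadrant {z : ℂ} (hre : z.re ≠ 0) (him : z.im ≠ 0) :
    z ∈ Q1 ∨ z ∈ Q2 ∨ z ∈ Q3 ∨ z ∈ Q4 := by
  rcases hre.lt_or_gt with h1 | h1 <;> rcases him.lt_or_gt with h2 | h2
  · exact Or.inr (Or.inr (Or.inl ⟨h1, h2⟩))
  · exact Or.inr (Or.inl ⟨h1, h2⟩)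
  · exact Or.inr (Or.inr (Or.inr ⟨h1, h2⟩))
  · exact Or.inl ⟨h1, h2⟩

/-- Passing from one dressing to another across a jump. -/
theorem evolve_mul_dressWith {x t : ℝ} {z : ℂ} {J D D' : Mat2} (h : J * D = D') :
    evolve x t z J * (expσ₃ (-phase x t z) * D) = expσ₃ (-phase x t z) * D' := by
  rw [evolve_eq, ← h]
  have := expσ₃_mul_neg (phase x t z)
  calc _ = expσ₃ (-phase x t z) * J * (expσ₃ (phase x t z) * expσ₃ (-phase x t z)) * D := by
        simp only [Matrix.mul_assoc]
    _ = _ := by rw [this, Matrix.mul_one, Matrix.mul_assoc]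

section JumpAlgebra

variable {N : ℕ} {L : ℝ} {a b R : ℂ → ℂ} {e : Fin (N + 1) → ℂ}

/-- This family of identities carries the dressing: the jump times the dressing on one side is the
dressing on the other. Here `J₀` is a product of two unipotent matrices whose `b/a` parts cancel
against those in `G₂`. -/
theorem jump_real_pos_algebra {p : ℂ} (hp : p.im = 0) :
    J₀RealPos a b R p * ((1 + R p • nUp (fun _ => -1) p) * 1) =
      (1 + schwarz R p • nLow (fun _ => 1) p) * 1 := by
  have h1 : ((‖b p / a p‖ ^ 2 : ℝ) : ℂ) = b p / a p * (starRingEnd ℂ) (b p / a p) := by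
    rw [Complex.mul_conj, Complex.normSq_eq_norm_sq]
  have h2 : schwarz (funG₂ a b R) p = (starRingEnd ℂ) (R p) - (starRingEnd ℂ) (b p / a p) := by
    rw [schwarz_ofReal _ hp, funG₂, map_sub]
  rw [J₀RealPos, h1, h2, schwarz_ofReal _ hp, schwarz_ofReal _ hp, funG₂]
  generalize b p / a p = ρ
  ext i j
  fin_cases i <;> fin_cases j <;>
    simp [nUp, nLow, Matrix.mul_apply, Fin.sum_univ_two] <;> ring

/-- The quadratic and the determinant relation linearise `G`: up to `b*/a` it is `-e^{-2izL} R*`,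
the entry occurring in the dressing of `Q2`. The multiplier relation only ensures that the
denominator does not vanish. -/
theorem funG_eq (hS : SpectralData L a b) {z : ℂ} (ha : a z ≠ 0)
    (hK : b z * schwarz R z ^ 2 + (a z - expL L z * schwarz a z) * schwarz R z
      + expL L z * schwarz b z = 0)
    (hν : (a z + b z * schwarz R z) * (schwarz a z + schwarz b z * R z) = 1) :
    funG a b R z = -((expL L z)⁻¹ * schwarz R z) - schwarz b z / a z := by
  have hν0 : a z + b z * schwarz R z ≠ 0 := left_ne_zero_of_mul_eq_one hν
  have hE := expL_ne_zero L z
  rw [funG, div_eq_iff (mul_ne_zero ha hν0)]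
  field_simp
  linear_combination (a z) * hK + expL L z * schwarz R z * hS.det z

theorem schwarz_funG_eq (hS : SpectralData L a b) {z : ℂ} (ha : schwarz a z ≠ 0)
    (hK : expL L z * schwarz b z * R z ^ 2 + (expL L z * schwarz a z - a z) * R z + b z = 0)
    (hν : (a z + b z * schwarz R z) * (schwarz a z + schwarz b z * R z) = 1) :
    schwarz (funG a b R) z = -(expL L z * R z) - b z / schwarz a z := by
  have hν0 : schwarz a z + schwarz b z * R z ≠ 0 := right_ne_zero_of_mul_eq_one hν
  have e1 : schwarz (funG a b R) z = -(R z) / (schwarz a z * (schwarz a z + schwarz b z * R z)) := by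
    simp [schwarz, funG]
  rw [e1, div_eq_iff (mul_ne_zero ha hν0)]
  field_simp
  linear_combination (schwarz a z) * hK + R z * hS.det z

/-- Both sides carry the same `s⁻¹`, which cancels. After `G` and `G*` are linearised, the remaining
identity holds for arbitrary values of the reflection coefficients. -/
theorem jump_real_neg_algebra (hS : SpectralData L a b) {p : ℂ} (hp : p.im = 0) (ha : a p ≠ 0)
    (hK : expL L p * schwarz b p * R p ^ 2 + (expL L p * schwarz a p - a p) * R p + b p = 0)
    (hK' : b p * schwarz R p ^ 2 + (a p - expL L p * schwarz a p) * schwarz R p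
      + expL L p * schwarz b p = 0)
    (hν : (a p + b p * schwarz R p) * (schwarz a p + schwarz b p * R p) = 1) :
    J₀RealNeg a b R p *
      ((1 + schwarz R p • nLow (fun z => (expL L z)⁻¹) p) * matSInv a b p) =
      (1 + R p • nUp (fun z => -expL L z) p) * matSInv a b p := by
  have ha' : schwarz a p ≠ 0 := by rw [schwarz_ofReal _ hp]; simpa using ha
  have h1 : ((‖schwarz b p / a p‖ ^ 2 : ℝ) : ℂ) = schwarz b p / a p * (b p / schwarz a p) := by
    rw [← Complex.normSq_eq_norm_sq, ← Complex.mul_conj, map_div₀, schwarz_ofReal _ hp,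
      schwarz_ofReal _ hp, Complex.conj_conj]
  have h2 : schwarz (fun w => schwarz b w / a w) p = b p / schwarz a p := by
    simp [schwarz]
  rw [← Matrix.mul_assoc]
  congr 1
  rw [J₀RealNeg, h1, h2, schwarz_funG_eq hS ha' hK hν, funG_eq hS ha hK' hν]
  generalize b p / schwarz a p = ρ
  generalize schwarz b p / a p = ρ'
  ext i j
  fin_cases i <;> fin_cases j <;>
    simp [nUp, nLow, Matrix.mul_apply, Fin.sum_univ_two] <;> ring

theorem jump_imag_pos_algebra (hS : SpectralData L a b) {p : ℂ} (ha : a p ≠ 0)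
    (hK' : b p * schwarz R p ^ 2 + (a p - expL L p * schwarz a p) * schwarz R p
      + expL L p * schwarz b p = 0)
    (hν : (a p + b p * schwarz R p) * (schwarz a p + schwarz b p * R p) = 1) :
    J₀ImagPos a b R p *
      ((1 + schwarz R p • nLow (fun z => (expL L z)⁻¹) p) * matSInv a b p) =
      (1 + R p • nUp (fun _ => -1) p) * 1 := by
  have hdet := hS.det p
  rw [J₀ImagPos, funG_eq hS ha hK' hν, funG₂]
  ext i j
  fin_cases i <;> fin_cases j <;>
    simp [nUp, nLow, matSInv, Matrix.mul_apply, Fin.sum_univ_two] <;> field_simp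
  · ring
  · linear_combination (b p - a p * R p) * hdet
  · ring
  · linear_combination hdet

theorem jump_imag_neg_algebra (hS : SpectralData L a b) {p : ℂ} (ha : schwarz a p ≠ 0)
    (hK : expL L p * schwarz b p * R p ^ 2 + (expL L p * schwarz a p - a p) * R p + b p = 0)
    (hν : (a p + b p * schwarz R p) * (schwarz a p + schwarz b p * R p) = 1) :
    J₀ImagNeg a b R p * ((1 + schwarz R p • nLow (fun _ => 1) p) * 1) =
      (1 + R p • nUp (fun z => -expL L z) p) * matSInv a b p := by
  have hdet := hS.det p
  have e1 : schwarz (funG₂ a b R) p = schwarz R p - schwarz b p / schwarz a p := by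
    simp [schwarz, funG₂]
  rw [J₀ImagNeg, schwarz_funG_eq hS ha hK hν, e1]
  ext i j
  fin_cases i <;> fin_cases j <;>
    simp [nUp, nLow, matSInv, Matrix.mul_apply, Fin.sum_univ_two] <;> field_simp
  · linear_combination -hdet
  all_goals ring

theorem nUp_sq (η : ℂ → ℂ) (z : ℂ) : nUp η z * nUp η z = 0 := by
  ext i j
  fin_cases i <;> fin_cases j <;> simp [nUp, Matrix.mul_apply, Fin.sum_univ_two]

theorem nLow_sq (η : ℂ → ℂ) (z : ℂ) : nLow η z * nLow η z = 0 := by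
  ext i j
  fin_cases i <;> fin_cases j <;> simp [nLow, Matrix.mul_apply, Fin.sum_univ_two]

/-- Nilpotency makes `u ↦ 1 + u n` additive, so a triangular cut jump just exchanges one boundary
value of `R` for the other. -/
theorem jump_cut_algebra {n s : Mat2} (hn : n * n = 0) (u v : ℂ) :
    (1 + (v - u) • n) * ((1 + u • n) * s) = (1 + v • n) * s := by
  rw [← Matrix.mul_assoc]
  congr 1
  simp only [add_mul, mul_add, one_mul, mul_one, sub_smul, sub_mul, smul_mul_assoc,
    mul_smul_comm, hn, smul_zero, sub_zero, add_zero]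
  abel

theorem matS_mul_matSInv (hS : SpectralData L a b) (z : ℂ) : matS a b z * matSInv a b z = 1 := by
  have hdet := hS.det z
  ext i j
  fin_cases i <;> fin_cases j <;>
    simp [matS, matSInv, Matrix.mul_apply, Fin.sum_univ_two]
  · linear_combination hdet
  · ring
  · ring
  · linear_combination hdet

theorem matSInv_mul_matS (hS : SpectralData L a b) (z : ℂ) : matSInv a b z * matS a b z = 1 :=
  mul_eq_one_comm.1 (matS_mul_matSInv hS z)

theorem mAnalyticAt_matSInv (hS : SpectralData L a b) (p : ℂ) : MAnalyticAt (matSInv a b) p :=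
  mAnalyticAt_of (hS.diff_a.analyticAt p) (hS.diff_b.neg.analyticAt p)
    (hS.diff_b.schwarz.analyticAt p) (hS.diff_a.schwarz.analyticAt p)

theorem mAnalyticAt_matS (hS : SpectralData L a b) (p : ℂ) : MAnalyticAt (matS a b) p :=
  mAnalyticAt_of (hS.diff_a.schwarz.analyticAt p) (hS.diff_b.analyticAt p)
    (hS.diff_b.schwarz.neg.analyticAt p) (hS.diff_a.analyticAt p)

end JumpAlgebra

end

end PeriodicNLS

namespace PeriodicNLS

noncomputable section

/-! ### The dressed solution is entire -/

/-- The set where the dressed solution is given by its defining formula. -/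
def regSet {N : ℕ} (e : Fin (N + 1) → ℂ) (R : ℂ → ℂ) : Set ℂ := (contour e ∪ rhPoles e R)ᶜ

/-- The data describing the dressing in the quadrant `Q`. -/
structure IsChart {N : ℕ} (L : ℝ) (a b R : ℂ → ℂ) (e : Fin (N + 1) → ℂ) (Q : Set ℂ)
    (ρ : ℂ → ℂ) (n s : ℂ → Mat2) : Prop where
  isOpen : IsOpen Q
  dress_eq : ∀ (x t : ℝ), ∀ z ∈ Q, dress L a b R x t z = dressWith ρ n s x t z
  off_axes : ∀ z ∈ Q, z.re ≠ 0 ∧ z.im ≠ 0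
  analytic : ∀ z ∈ Q, z ∉ cuts e → z ∉ rhPoles e R → AnalyticAt ℂ ρ z
  eventually_analytic : ∀ p, ∀ᶠ z in 𝓝[(cuts e ∪ {p})ᶜ] p, AnalyticAt ℂ ρ z
  n_analytic : ∀ p, MAnalyticAt n p
  s_analytic : ∀ p, MAnalyticAt s p
  triangular : (∃ η, Continuous η ∧ n = nUp η) ∨ (∃ η, Continuous η ∧ n = nLow η)
  s_inv : ∃ s' : ℂ → Mat2, (∀ p, MAnalyticAt s' p) ∧ ∀ z, s z * s' z = 1
  left_values : ∀ p ∈ cuts e \ branchPts e, ∃ c, Tendsto ρ (𝓝[{w | w.re < p.re}] p) (𝓝 c)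
  right_values : ∀ p ∈ cuts e \ branchPts e, ∃ c, Tendsto ρ (𝓝[{w | p.re < w.re}] p) (𝓝 c)
  mild : ∀ p, p = 0 ∨ p ∈ cuts e → Tendsto (fun z => (z - p) * ρ z) (𝓝[(cuts e)ᶜ] p) (𝓝 0)
  jump : ∀ p ∈ Q, J₀Cut L R p = 1 + (bvMinus ρ p - bvPlus ρ p) • n p

section

variable {N : ℕ} {L : ℝ} {a b R : ℂ → ℂ} {e : Fin (N + 1) → ℂ}

theorem IsBranch.analyticAt_axis (hR : IsBranch L a b e R) {p : ℂ} (hp : p ∉ cuts e)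
    (h : p.re = 0 ∨ p.im = 0) : AnalyticAt ℂ R p ∧ AnalyticAt ℂ (schwarz R) p := by
  have key : ∀ p : ℂ, p ∉ cuts e → p.re = 0 ∨ p.im = 0 → AnalyticAt ℂ R p := fun p hp h =>
    hR.analyticAt hp fun hpole => by
      have := hR.poles_off_axes p hp hpole
      tauto
  exact ⟨key p hp h, (key _ (fun h' => hp (conj_mem_cuts.1 h')) (by simpa using h)).schwarz⟩

theorem IsMainSpectrum.re_ne_zero (he : IsMainSpectrum L a e) {p : ℂ} (hp : p ∈ cuts e) :
    p.re ≠ 0 := by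
  obtain ⟨j, hj, -⟩ := hp
  rw [hj]; exact he.re_ne j

theorem tendsto_sub_mul_of_bounded {f : ℂ → ℂ} {p : ℂ} {l : Filter ℂ} (hl : l ≤ 𝓝 p) {C : ℝ}
    (h : ∀ᶠ z in l, ‖f z‖ ≤ C) : Tendsto (fun z => (z - p) * f z) l (𝓝 0) := by
  have h1 : Tendsto (fun z => z - p) l (𝓝 0) := by
    have : Continuous fun z : ℂ => z - p := by fun_prop
    simpa using (this.tendsto p).mono_left hl
  refine Tendsto.zero_mul_isBoundedUnder_le h1 ⟨C, ?_⟩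
  simpa using h

/-- Weaker than a pole at all exceptional points: `R` is bounded near the interior of a cut and near
`0`, and controlled by the quadratic at branch points. -/
theorem IsBranch.mild (hS : SpectralData L a b) (he : IsMainSpectrum L a e)
    (hR : IsBranch L a b e R) {p : ℂ} (hp : p = 0 ∨ p ∈ cuts e) :
    Tendsto (fun z => (z - p) * R z) (𝓝[(cuts e)ᶜ] p) (𝓝 0) := by
  by_cases hpc : p ∈ cuts e
  · by_cases hb : p ∈ branchPts e
    · exact (hR.branch_point hS he hb).2
    · obtain ⟨C, hC⟩ := hR.eventually_bounded_cut ⟨hpc, hb⟩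
      refine tendsto_sub_mul_of_bounded nhdsWithin_le_nhds (C := C) ?_
      rw [eventually_nhdsWithin_iff] at hC ⊢
      filter_upwards [hC, eventually_mem_cuts hpc hb] with z h1 h2 h3
      exact h1 fun h => h3 (h2 h)
  · have h0 : p = 0 := hp.resolve_right hpc
    have h1 := (hR.analyticAt_axis hpc (Or.inl (by simp [h0]))).1.continuousAt
    refine tendsto_sub_mul_of_bounded nhdsWithin_le_nhds (C := ‖R p‖ + 1) ?_
    filter_upwards [nhdsWithin_le_nhds (h1.norm.eventually (gt_mem_nhds (lt_add_one _)))]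
      with z hz using hz.le

theorem IsBranch.mild_schwarz (hS : SpectralData L a b) (he : IsMainSpectrum L a e)
    (hR : IsBranch L a b e R) {p : ℂ} (hp : p = 0 ∨ p ∈ cuts e) :
    Tendsto (fun z => (z - p) * schwarz R z) (𝓝[(cuts e)ᶜ] p) (𝓝 0) := by
  have h1 := hR.mild hS he (p := (starRingEnd ℂ) p) (hp.imp (fun h => by simp [h])
    conj_mem_cuts.2)
  have h2 : Tendsto (starRingEnd ℂ) (𝓝[(cuts e)ᶜ] p) (𝓝[(cuts e)ᶜ] ((starRingEnd ℂ) p)) :=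
    tendsto_conj_nhdsWithin (fun z hz => by
      rw [Set.mem_compl_iff] at hz ⊢
      exact fun h => hz (conj_mem_cuts.1 h)) p
  have h3 := (Complex.continuous_conj.tendsto 0).comp (h1.comp h2)
  rw [map_zero] at h3
  refine h3.congr fun z => ?_
  simp [schwarz]

theorem continuous_expL_inv (L : ℝ) : Continuous fun z => (expL L z)⁻¹ :=
  (differentiable_expL L).continuous.inv₀ (expL_ne_zero L)

theorem mAnalyticAt_nUp {η : ℂ → ℂ} {p : ℂ} (h : AnalyticAt ℂ η p) : MAnalyticAt (nUp η) p :=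
  mAnalyticAt_of analyticAt_const h analyticAt_const analyticAt_const

theorem mAnalyticAt_nLow {η : ℂ → ℂ} {p : ℂ} (h : AnalyticAt ℂ η p) : MAnalyticAt (nLow η) p :=
  mAnalyticAt_of analyticAt_const analyticAt_const h analyticAt_const

theorem isChart_Q1 (hS : SpectralData L a b) (he : IsMainSpectrum L a e)
    (hR : IsBranch L a b e R) : IsChart L a b R e Q1 R (nUp fun _ => -1) (fun _ => 1) where
  isOpen := isOpen_Q1
  dress_eq x t z hz := by rw [dress, if_pos hz]
  off_axes z hz := ⟨hz.1.ne', hz.2.ne'⟩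
  analytic z hz hzc hzp := hR.analyticAt hzc fun h => hzp ⟨hzc, Or.inl ⟨Or.inl hz, h⟩⟩
  eventually_analytic p := hR.eventually_analyticAt hS he p
  n_analytic p := mAnalyticAt_nUp analyticAt_const
  s_analytic p := mAnalyticAt_const 1 p
  triangular := Or.inl ⟨_, continuous_const, rfl⟩
  s_inv := ⟨fun _ => 1, mAnalyticAt_const 1, fun _ => one_mul 1⟩
  left_values := hR.left_values
  right_values := hR.right_values
  mild p hp := hR.mild hS he hp
  jump p hp := by
    rw [J₀Cut, if_pos hp]
    ext i j; fin_cases i <;> fin_cases j <;> simp [nUp]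

theorem isChart_Q2 (hS : SpectralData L a b) (he : IsMainSpectrum L a e)
    (hR : IsBranch L a b e R) :
    IsChart L a b R e Q2 (schwarz R) (nLow fun z => (expL L z)⁻¹) (matSInv a b) where
  isOpen := isOpen_Q2
  dress_eq x t z hz := by rw [dress, if_neg (notMem_Q1_of_Q2 hz), if_pos hz]
  off_axes z hz := ⟨hz.1.ne, hz.2.ne'⟩
  analytic z hz hzc hzp := hR.analyticAt_schwarz hzc fun h =>
    hzp ⟨hzc, Or.inr ⟨Or.inl hz, h⟩⟩
  eventually_analytic p := hR.eventually_analyticAt_schwarz hS he p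
  n_analytic p := mAnalyticAt_nLow (((differentiable_expL L).analyticAt p).inv (expL_ne_zero L p))
  s_analytic p := mAnalyticAt_matSInv hS p
  triangular := Or.inr ⟨_, continuous_expL_inv L, rfl⟩
  s_inv := ⟨matS a b, mAnalyticAt_matS hS, matSInv_mul_matS hS⟩
  left_values p hp := hR.left_values_schwarz hp
  right_values p hp := hR.right_values_schwarz hp
  mild p hp := hR.mild_schwarz hS he hp
  jump p hp := by
    rw [J₀Cut, if_neg (notMem_Q1_of_Q2 hp), if_pos hp]
    ext i j; fin_cases i <;> fin_cases j <;> simp [nLow, expL, Complex.exp_neg, mul_comm]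

theorem isChart_Q3 (hS : SpectralData L a b) (he : IsMainSpectrum L a e)
    (hR : IsBranch L a b e R) :
    IsChart L a b R e Q3 R (nUp fun z => -expL L z) (matSInv a b) where
  isOpen := isOpen_Q3
  dress_eq x t z hz := by
    rw [dress, if_neg (notMem_Q1_of_Q3 hz), if_neg (notMem_Q2_of_Q3 hz), if_pos hz]
  off_axes z hz := ⟨hz.1.ne, hz.2.ne⟩
  analytic z hz hzc hzp := hR.analyticAt hzc fun h => hzp ⟨hzc, Or.inl ⟨Or.inr hz, h⟩⟩
  eventually_analytic p := hR.eventually_analyticAt hS he p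
  n_analytic p := mAnalyticAt_nUp ((differentiable_expL L).neg.analyticAt p)
  s_analytic p := mAnalyticAt_matSInv hS p
  triangular := Or.inl ⟨_, (differentiable_expL L).neg.continuous, rfl⟩
  s_inv := ⟨matS a b, mAnalyticAt_matS hS, matSInv_mul_matS hS⟩
  left_values := hR.left_values
  right_values := hR.right_values
  mild p hp := hR.mild hS he hp
  jump p hp := by
    rw [J₀Cut, if_neg (notMem_Q1_of_Q3 hp), if_neg (notMem_Q2_of_Q3 hp), if_pos hp]
    ext i j; fin_cases i <;> fin_cases j <;> simp [nUp, expL] <;> ring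

theorem isChart_Q4 (hS : SpectralData L a b) (he : IsMainSpectrum L a e)
    (hR : IsBranch L a b e R) :
    IsChart L a b R e Q4 (schwarz R) (nLow fun _ => 1) (fun _ => 1) where
  isOpen := isOpen_Q4
  dress_eq x t z hz := by
    rw [dress, if_neg (notMem_Q1_of_Q4 hz), if_neg (notMem_Q2_of_Q4 hz),
      if_neg (notMem_Q3_of_Q4 hz)]
  off_axes z hz := ⟨hz.1.ne', hz.2.ne⟩
  analytic z hz hzc hzp := hR.analyticAt_schwarz hzc fun h =>
    hzp ⟨hzc, Or.inr ⟨Or.inr hz, h⟩⟩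
  eventually_analytic p := hR.eventually_analyticAt_schwarz hS he p
  n_analytic p := mAnalyticAt_nLow analyticAt_const
  s_analytic p := mAnalyticAt_const 1 p
  triangular := Or.inr ⟨_, continuous_const, rfl⟩
  s_inv := ⟨fun _ => 1, mAnalyticAt_const 1, fun _ => one_mul 1⟩
  left_values p hp := hR.left_values_schwarz hp
  right_values p hp := hR.right_values_schwarz hp
  mild p hp := hR.mild_schwarz hS he hp
  jump p hp := by
    rw [J₀Cut, if_neg (notMem_Q1_of_Q4 hp), if_neg (notMem_Q2_of_Q4 hp),
      if_neg (notMem_Q3_of_Q4 hp)]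
    ext i j; fin_cases i <;> fin_cases j <;> simp [nLow]

theorem exists_chart (hS : SpectralData L a b) (he : IsMainSpectrum L a e)
    (hR : IsBranch L a b e R) {z : ℂ} (hre : z.re ≠ 0) (him : z.im ≠ 0) :
    ∃ Q ρ n s, IsChart L a b R e Q ρ n s ∧ z ∈ Q := by
  rcases mem_quadrant hre him with h | h | h | h
  · exact ⟨_, _, _, _, isChart_Q1 hS he hR, h⟩
  · exact ⟨_, _, _, _, isChart_Q2 hS he hR, h⟩
  · exact ⟨_, _, _, _, isChart_Q3 hS he hR, h⟩
  · exact ⟨_, _, _, _, isChart_Q4 hS he hR, h⟩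

theorem eventually_notMem_rhPoles (hS : SpectralData L a b) (he : IsMainSpectrum L a e)
    (hR : IsBranch L a b e R) (p : ℂ) : ∀ᶠ z in 𝓝[≠] p, z ∉ rhPoles e R := by
  have h1 := hR.eventually_analyticAt hS he p
  have h2 := hR.eventually_analyticAt_schwarz hS he p
  rw [eventually_nhdsWithin_iff] at h1 h2 ⊢
  filter_upwards [h1, h2] with z h3 h4 hz hzp
  have hmem : z ∈ (cuts e ∪ {p})ᶜ := by
    rw [Set.mem_compl_iff]
    rintro (h | h)
    · exact hzp.1 h
    · exact hz h
  rcases hzp.2 with h | h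
  · exact (h3 hmem).not_isPole h.2
  · exact (h4 hmem).not_isPole h.2

/-- The diagonal direction leaves the contour, and the poles are discrete, so the regular set
accumulates at every point. -/
theorem regSet_neBot (hS : SpectralData L a b) (he : IsMainSpectrum L a e)
    (hR : IsBranch L a b e R) (p : ℂ) : (𝓝[regSet e R] p).NeBot := by
  have := dense_compl_contour_diff e p
  refine this.mono (le_inf nhdsWithin_le_nhds (le_principal_iff.2 ?_))
  have h1 := nhdsWithin_mono p (Set.compl_subset_compl.2
    (Set.subset_union_right (s := contour e) (t := {p}))) (eventually_notMem_rhPoles hS he hR p)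
  filter_upwards [h1, self_mem_nhdsWithin] with z h2 h3
  rw [regSet, Set.mem_compl_iff]
  rintro (h | h)
  · exact h3 (Or.inl h)
  · exact h2 h

theorem dense_regSet (hS : SpectralData L a b) (he : IsMainSpectrum L a e)
    (hR : IsBranch L a b e R) : Dense (regSet e R) := fun p =>
  mem_closure_iff_nhdsWithin_neBot.2 (regSet_neBot hS he hR p)

theorem notMem_contour {z : ℂ} (hre : z.re ≠ 0) (him : z.im ≠ 0) (hc : z ∉ cuts e) :
    z ∉ contour e := by
  rintro ((h | h) | h)
  · exact him h
  · exact hre h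
  · exact hc h

theorem mem_regSet {z : ℂ} (hre : z.re ≠ 0) (him : z.im ≠ 0) (hc : z ∉ cuts e)
    (hp : z ∉ rhPoles e R) : z ∈ regSet e R := by
  rw [regSet, Set.mem_compl_iff]
  rintro (h | h)
  · exact notMem_contour hre him hc h
  · exact hp h

theorem off_axes_of_mem_regSet {z : ℂ} (hz : z ∈ regSet e R) :
    z.re ≠ 0 ∧ z.im ≠ 0 ∧ z ∉ cuts e ∧ z ∉ rhPoles e R ∧ z ∉ contour e := by
  rw [regSet, Set.mem_compl_iff] at hz
  refine ⟨fun h => hz (Or.inl (Or.inl (Or.inr h))), fun h => hz (Or.inl (Or.inl (Or.inl h))),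
    fun h => hz (Or.inl (Or.inr h)), fun h => hz (Or.inr h), fun h => hz (Or.inl h)⟩

/-! ### One-sided limits of the dressed solution on the contour -/

theorem mAnalyticAt_dressWith {ρ : ℂ → ℂ} {n s : ℂ → Mat2} {p : ℂ} (x t : ℝ)
    (hρ : AnalyticAt ℂ ρ p) (hn : MAnalyticAt n p) (hs : MAnalyticAt s p) :
    MAnalyticAt (dressWith ρ n s x t) p :=
  (mAnalyticAt_expσ₃ (differentiable_phase x t).neg p).mul
    (((mAnalyticAt_const 1 p).add (hn.smul hρ)).mul hs)

/-- The dressed solution. -/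
def dressed (L : ℝ) (a b R : ℂ → ℂ) (x t : ℝ) (m : ℂ → Mat2) (z : ℂ) : Mat2 :=
  m z * dress L a b R x t z

variable {x t : ℝ} {m : ℂ → Mat2}

theorem mAnalyticAt_dressed (hS : SpectralData L a b) (he : IsMainSpectrum L a e)
    (hR : IsBranch L a b e R) (hm : IsRHSolution L a b e R x t m) {z : ℂ} (hz : z ∈ regSet e R) :
    MAnalyticAt (dressed L a b R x t m) z := by
  obtain ⟨h1, h2, h3, h4, h5⟩ := off_axes_of_mem_regSet hz
  obtain ⟨Q, ρ, n, s, hQ, hzQ⟩ := exists_chart hS he hR h1 h2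
  have h6 : MAnalyticAt m z := fun i j => hm.analytic z h5 h4 i j
  refine (h6.mul (mAnalyticAt_dressWith x t (hQ.analytic z hzQ h3 h4) (hQ.n_analytic z)
    (hQ.s_analytic z))).congr ?_
  filter_upwards [hQ.isOpen.mem_nhds hzQ] with w hw
  rw [dressed, hQ.dress_eq x t w hw]

theorem tendsto_dressWith {ρ : ℂ → ℂ} {n s : ℂ → Mat2} {p c : ℂ} {l : Filter ℂ} (hl : l ≤ 𝓝 p)
    (x t : ℝ) (hρ : Tendsto ρ l (𝓝 c)) (hn : MAnalyticAt n p) (hs : MAnalyticAt s p) :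
    Tendsto (dressWith ρ n s x t) l
      (𝓝 (expσ₃ (-phase x t p) * ((1 + c • n p) * s p))) :=
  ((mAnalyticAt_expσ₃ (differentiable_phase x t).neg p).continuousAt.tendsto.mono_left hl).mul
    ((tendsto_const_nhds.add (hρ.smul (hn.continuousAt.tendsto.mono_left hl))).mul
      (hs.continuousAt.tendsto.mono_left hl))

theorem IsChart.tendsto_dressed {Q : Set ℂ} {ρ : ℂ → ℂ} {n s : ℂ → Mat2}
    (hQ : IsChart L a b R e Q ρ n s) {p c : ℂ} {U : Set ℂ} {A : Mat2}
    (hU : ∀ᶠ z in 𝓝[U] p, z ∈ Q) (hρ : Tendsto ρ (𝓝[U] p) (𝓝 c))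
    (hm : Tendsto m (𝓝[U] p) (𝓝 A)) :
    Tendsto (dressed L a b R x t m) (𝓝[U] p)
      (𝓝 (A * (expσ₃ (-phase x t p) * ((1 + c • n p) * s p)))) := by
  refine (hm.mul (tendsto_dressWith nhdsWithin_le_nhds x t hρ (hQ.n_analytic p)
    (hQ.s_analytic p))).congr' ?_
  filter_upwards [hU] with z hz
  rw [dressed, hQ.dress_eq x t z hz]

theorem crossing {J D D' A B : Mat2} {p : ℂ} (h : J * D = D') (hAB : A = B * evolve x t p J) :
    A * (expσ₃ (-phase x t p) * D) = B * (expσ₃ (-phase x t p) * D') := by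
  rw [hAB, Matrix.mul_assoc, evolve_mul_dressWith h]

theorem tendsto_nhdsWithin_of_continuousAt {f : ℂ → ℂ} {p : ℂ} (U : Set ℂ)
    (h : AnalyticAt ℂ f p) : Tendsto f (𝓝[U] p) (𝓝 (f p)) :=
  h.continuousAt.tendsto.mono_left nhdsWithin_le_nhds

/-- Existence of both limits is kept apart from their equality, which needs `a p ≠ 0`. At zeros of
`a` existence alone makes the singularity removable. -/
theorem real_limits (hS : SpectralData L a b) (he : IsMainSpectrum L a e)
    (hR : IsBranch L a b e R) (hm : IsRHSolution L a b e R x t m) {p : ℂ} (hp : p.im = 0)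
    (hc : p ∉ crossPts e) : ∃ A B,
      Tendsto (dressed L a b R x t m) (𝓝[{z | 0 < z.im}] p) (𝓝 A) ∧
      Tendsto (dressed L a b R x t m) (𝓝[{z | z.im < 0}] p) (𝓝 B) ∧ (a p ≠ 0 → A = B) := by
  have hpc : p ∉ cuts e := by
    rintro ⟨j, hj, -⟩
    exact hc (Or.inr ⟨j, Complex.ext (by simpa using hj) (by simpa using hp)⟩)
  have hp0 : p.re ≠ 0 := fun h => hc (Or.inl (Complex.ext h hp))
  obtain ⟨hRp, hRp'⟩ := hR.analyticAt_axis hpc (Or.inr hp)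
  have hK := hR.quadratic hpc hRp.not_isPole
  have hK' := hR.quadratic_schwarz hpc hRp'.not_isPole
  have hν := hR.multiplier hS hpc hRp.not_isPole hRp'.not_isPole
  rcases hp0.lt_or_gt with h | h
  · obtain ⟨A, B, hA, hB, hAB⟩ := hm.jump_real_neg p hp h hc
    have hn : ∀ᶠ z : ℂ in 𝓝 p, z.re < 0 :=
      (isOpen_lt Complex.continuous_re continuous_const).mem_nhds h
    refine ⟨_, _, (isChart_Q2 hS he hR).tendsto_dressed ?_
      (tendsto_nhdsWithin_of_continuousAt _ hRp') hA,
      (isChart_Q3 hS he hR).tendsto_dressed ?_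
      (tendsto_nhdsWithin_of_continuousAt _ hRp) hB, fun ha => ?_⟩
    · filter_upwards [nhdsWithin_le_nhds hn, self_mem_nhdsWithin] with z h1 h2 using ⟨h1, h2⟩
    · filter_upwards [nhdsWithin_le_nhds hn, self_mem_nhdsWithin] with z h1 h2 using ⟨h1, h2⟩
    · exact crossing (jump_real_neg_algebra hS hp ha hK hK' hν) (hAB ha)
  · obtain ⟨A, B, hA, hB, hAB⟩ := hm.jump_real_pos p hp h hc
    have hn : ∀ᶠ z : ℂ in 𝓝 p, 0 < z.re :=
      (isOpen_lt continuous_const Complex.continuous_re).mem_nhds h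
    refine ⟨_, _, (isChart_Q1 hS he hR).tendsto_dressed ?_
      (tendsto_nhdsWithin_of_continuousAt _ hRp) hA,
      (isChart_Q4 hS he hR).tendsto_dressed ?_
      (tendsto_nhdsWithin_of_continuousAt _ hRp') hB, fun ha => ?_⟩
    · filter_upwards [nhdsWithin_le_nhds hn, self_mem_nhdsWithin] with z h1 h2 using ⟨h1, h2⟩
    · filter_upwards [nhdsWithin_le_nhds hn, self_mem_nhdsWithin] with z h1 h2 using ⟨h1, h2⟩
    · exact crossing (jump_real_pos_algebra hp) (hAB ha)

theorem imag_limits (hS : SpectralData L a b) (he : IsMainSpectrum L a e)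
    (hR : IsBranch L a b e R) (hm : IsRHSolution L a b e R x t m) {p : ℂ} (hp : p.re = 0)
    (hp0 : p.im ≠ 0) : ∃ A B,
      Tendsto (dressed L a b R x t m) (𝓝[{z | z.re < 0}] p) (𝓝 A) ∧
      Tendsto (dressed L a b R x t m) (𝓝[{z | 0 < z.re}] p) (𝓝 B) ∧
      (a p ≠ 0 → schwarz a p ≠ 0 → A = B) := by
  have hpc : p ∉ cuts e := fun h => he.re_ne_zero h hp
  obtain ⟨hRp, hRp'⟩ := hR.analyticAt_axis hpc (Or.inl hp)
  have hK := hR.quadratic hpc hRp.not_isPole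
  have hK' := hR.quadratic_schwarz hpc hRp'.not_isPole
  have hν := hR.multiplier hS hpc hRp.not_isPole hRp'.not_isPole
  rcases hp0.lt_or_gt with h | h
  -- The negative half-axis is oriented downwards, so the `+` side is the right one and the two
  -- limits change roles.
  · obtain ⟨A, B, hA, hB, hAB⟩ := hm.jump_imag_neg p hp h
    have hn : ∀ᶠ z : ℂ in 𝓝 p, z.im < 0 :=
      (isOpen_lt Complex.continuous_im continuous_const).mem_nhds h
    refine ⟨_, _, (isChart_Q3 hS he hR).tendsto_dressed ?_
      (tendsto_nhdsWithin_of_continuousAt _ hRp) hB,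
      (isChart_Q4 hS he hR).tendsto_dressed ?_
      (tendsto_nhdsWithin_of_continuousAt _ hRp') hA, fun _ ha => ?_⟩
    · filter_upwards [nhdsWithin_le_nhds hn, self_mem_nhdsWithin] with z h1 h2 using ⟨h2, h1⟩
    · filter_upwards [nhdsWithin_le_nhds hn, self_mem_nhdsWithin] with z h1 h2 using ⟨h2, h1⟩
    · exact (crossing (jump_imag_neg_algebra hS ha hK hν) (hAB ha)).symm
  · obtain ⟨A, B, hA, hB, hAB⟩ := hm.jump_imag_pos p hp h
    have hn : ∀ᶠ z : ℂ in 𝓝 p, 0 < z.im :=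
      (isOpen_lt continuous_const Complex.continuous_im).mem_nhds h
    refine ⟨_, _, (isChart_Q2 hS he hR).tendsto_dressed ?_
      (tendsto_nhdsWithin_of_continuousAt _ hRp') hA,
      (isChart_Q1 hS he hR).tendsto_dressed ?_
      (tendsto_nhdsWithin_of_continuousAt _ hRp) hB, fun ha _ => ?_⟩
    · filter_upwards [nhdsWithin_le_nhds hn, self_mem_nhdsWithin] with z h1 h2 using ⟨h2, h1⟩
    · filter_upwards [nhdsWithin_le_nhds hn, self_mem_nhdsWithin] with z h1 h2 using ⟨h2, h1⟩
    · exact crossing (jump_imag_pos_algebra hS ha hK' hν) (hAB ha)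

theorem cut_limits (hS : SpectralData L a b) (he : IsMainSpectrum L a e)
    (hR : IsBranch L a b e R) (hm : IsRHSolution L a b e R x t m) {p : ℂ} (hp : p ∈ cuts e)
    (hb : p ∉ branchPts e) (hc : p ∉ crossPts e) : ∃ A,
      Tendsto (dressed L a b R x t m) (𝓝[{z | z.re < p.re}] p) (𝓝 A) ∧
      Tendsto (dressed L a b R x t m) (𝓝[{z | p.re < z.re}] p) (𝓝 A) := by
  have him : p.im ≠ 0 := by
    intro h
    obtain ⟨j, hj, -⟩ := hp
    exact hc (Or.inr ⟨j, Complex.ext (by simpa using hj) (by simpa using h)⟩)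
  obtain ⟨Q, ρ, n, s, hQ, hpQ⟩ := exists_chart hS he hR (he.re_ne_zero hp) him
  obtain ⟨A, B, hA, hB, hAB⟩ := hm.jump_cut p hp hb hc
  have hl : Tendsto ρ (𝓝[{z | z.re < p.re}] p) (𝓝 (bvPlus ρ p)) :=
    tendsto_nhds_limUnder (hQ.left_values p ⟨hp, hb⟩)
  -- The boundary values of `R` exist by hypothesis, so `limUnder` is a genuine limit on either
  -- side.
  have hr : Tendsto ρ (𝓝[{z | p.re < z.re}] p) (𝓝 (bvMinus ρ p)) :=
    tendsto_nhds_limUnder (hQ.right_values p ⟨hp, hb⟩)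
  have hn := hQ.isOpen.mem_nhds hpQ
  have hsq : n p * n p = 0 := by
    rcases hQ.triangular with ⟨η, -, h⟩ | ⟨η, -, h⟩
    · rw [h]; exact nUp_sq η p
    · rw [h]; exact nLow_sq η p
  refine ⟨_, hQ.tendsto_dressed (nhdsWithin_le_nhds hn) hl hA, ?_⟩
  have h1 := hQ.tendsto_dressed (x := x) (t := t) (nhdsWithin_le_nhds hn) hr hB
  rw [hQ.jump p hpQ] at hAB
  rwa [crossing (jump_cut_algebra hsq _ _) (hAB trivial)]

end

end

end PeriodicNLS

namespace PeriodicNLS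

noncomputable section

section

variable {N : ℕ} {L : ℝ} {a b R : ℂ → ℂ} {e : Fin (N + 1) → ℂ} {x t : ℝ} {m : ℂ → Mat2}

/-! ### Continuation across the smooth parts of the contour -/

theorem notMem_rhPoles {z : ℂ} (h : AnalyticAt ℂ R z) (h' : AnalyticAt ℂ (schwarz R) z) :
    z ∉ rhPoles e R := by
  rintro ⟨-, h1 | h1⟩
  · exact h.not_isPole h1.2
  · exact h'.not_isPole h1.2

theorem eventually_notMem_crossPts {p : ℂ} (hp : p ∉ crossPts e) : ∀ᶠ z in 𝓝 p, z ∉ crossPts e :=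
  (finite_crossPts e).isClosed.isOpen_compl.mem_nhds hp

theorem eventually_notMem_branchPts {p : ℂ} (hp : p ∉ branchPts e) :
    ∀ᶠ z in 𝓝 p, z ∉ branchPts e :=
  (finite_branchPts e).isClosed.isOpen_compl.mem_nhds hp

theorem extendsAt_real (hS : SpectralData L a b) (he : IsMainSpectrum L a e)
    (hR : IsBranch L a b e R) (hm : IsRHSolution L a b e R x t m) {p : ℂ} (hp : p.im = 0)
    (hc : p ∉ crossPts e) (ha : a p ≠ 0) (i j : Fin 2) :
    ExtendsAt (fun z => dressed L a b R x t m z i j) (regSet e R) p := by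
  have hpc : p ∉ cuts e := by
    rintro ⟨k, hk, -⟩
    exact hc (Or.inr ⟨k, Complex.ext (by simpa using hk) (by simpa using hp)⟩)
  have hp0 : p.re ≠ 0 := fun h => hc (Or.inl (Complex.ext h hp))
  obtain ⟨hRp, hRp'⟩ := hR.analyticAt_axis hpc (Or.inr hp)
  have ev : ∀ᶠ z in 𝓝 p, (z ∉ crossPts e ∧ a z ≠ 0 ∧ z ∉ cuts e) ∧
      AnalyticAt ℂ R z ∧ AnalyticAt ℂ (schwarz R) z ∧ z.re ≠ 0 := by
    filter_upwards [eventually_notMem_crossPts hc, hS.diff_a.continuous.continuousAt.eventually_ne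
      ha, (isClosed_cuts e).isOpen_compl.mem_nhds hpc, hRp.eventually_analyticAt,
      hRp'.eventually_analyticAt, Complex.continuous_re.continuousAt.eventually_ne hp0]
      with z h1 h2 h3 h4 h5 h6 using ⟨⟨h1, h2, h3⟩, h4, h5, h6⟩
  obtain ⟨r, hr, hball⟩ := Metric.eventually_nhds_iff_ball.1 ev
  refine (extendsAt_horizontal hr ?_ ?_).mono ?_
  · intro z hz hzp
    obtain ⟨⟨h1, h2, h3⟩, h4, h5, h6⟩ := hball z hz
    exact (mAnalyticAt_dressed hS he hR hm (mem_regSet h6 (hp ▸ hzp) h3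
      (notMem_rhPoles h4 h5)) i j).differentiableAt
  · intro z hz hzp
    obtain ⟨⟨h1, h2, h3⟩, h4, h5, h6⟩ := hball z hz
    obtain ⟨A, B, hA, hB, hAB⟩ := real_limits hS he hR hm (hzp.trans hp) h1
    simp only [hp]
    refine ⟨A i j, ?_, tendsto_entry hA i j⟩
    rw [hAB h2]
    exact tendsto_entry hB i j
  · exact Eventually.of_forall fun z hz => hp ▸ (off_axes_of_mem_regSet hz).2.1

theorem extendsAt_imag (hS : SpectralData L a b) (he : IsMainSpectrum L a e)
    (hR : IsBranch L a b e R) (hm : IsRHSolution L a b e R x t m) {p : ℂ} (hp : p.re = 0)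
    (hp0 : p.im ≠ 0) (ha : a p ≠ 0) (ha' : schwarz a p ≠ 0) (i j : Fin 2) :
    ExtendsAt (fun z => dressed L a b R x t m z i j) (regSet e R) p := by
  have hpc : p ∉ cuts e := fun h => he.re_ne_zero h hp
  obtain ⟨hRp, hRp'⟩ := hR.analyticAt_axis hpc (Or.inl hp)
  have ev : ∀ᶠ z in 𝓝 p, (schwarz a z ≠ 0 ∧ a z ≠ 0 ∧ z ∉ cuts e) ∧
      AnalyticAt ℂ R z ∧ AnalyticAt ℂ (schwarz R) z ∧ z.im ≠ 0 := by
    filter_upwards [hS.diff_a.schwarz.continuous.continuousAt.eventually_ne ha',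
      hS.diff_a.continuous.continuousAt.eventually_ne
      ha, (isClosed_cuts e).isOpen_compl.mem_nhds hpc, hRp.eventually_analyticAt,
      hRp'.eventually_analyticAt, Complex.continuous_im.continuousAt.eventually_ne hp0]
      with z h1 h2 h3 h4 h5 h6 using ⟨⟨h1, h2, h3⟩, h4, h5, h6⟩
  obtain ⟨r, hr, hball⟩ := Metric.eventually_nhds_iff_ball.1 ev
  refine (extendsAt_vertical hr ?_ ?_).mono ?_
  · intro z hz hzp
    obtain ⟨⟨h1, h2, h3⟩, h4, h5, h6⟩ := hball z hz
    exact (mAnalyticAt_dressed hS he hR hm (mem_regSet (hp ▸ hzp) h6 h3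
      (notMem_rhPoles h4 h5)) i j).differentiableAt
  · intro z hz hzp
    obtain ⟨⟨h1, h2, h3⟩, h4, h5, h6⟩ := hball z hz
    obtain ⟨A, B, hA, hB, hAB⟩ := imag_limits hS he hR hm (hzp.trans hp) h6
    simp only [hp]
    refine ⟨A i j, tendsto_entry hA i j, ?_⟩
    rw [hAB h2 h1]
    exact tendsto_entry hB i j
  · exact Eventually.of_forall fun z hz => hp ▸ (off_axes_of_mem_regSet hz).1

theorem extendsAt_cut (hS : SpectralData L a b) (he : IsMainSpectrum L a e)
    (hR : IsBranch L a b e R) (hm : IsRHSolution L a b e R x t m) {p : ℂ} (hp : p ∈ cuts e)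
    (hb : p ∉ branchPts e) (hc : p ∉ crossPts e) (i j : Fin 2) :
    ExtendsAt (fun z => dressed L a b R x t m z i j) (regSet e R) p := by
  have hp0 := he.re_ne_zero hp
  have him : p.im ≠ 0 := by
    intro h
    obtain ⟨k, hk, -⟩ := hp
    exact hc (Or.inr ⟨k, Complex.ext (by simpa using hk) (by simpa using h)⟩)
  -- Only finitely many abscissae carry cuts; near `p` all cut points lie on the vertical line
  -- through `p`.
  have ev1 : ∀ᶠ z : ℂ in 𝓝 p, z.re ≠ p.re → z ∉ cuts e := by
    have hfin : (Set.range (fun k => (e k).re) \ {p.re}).Finite := (Set.finite_range _).sdiff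
    have : ∀ᶠ z : ℂ in 𝓝 p, z.re ∉ Set.range (fun k => (e k).re) \ {p.re} :=
      Complex.continuous_re.continuousAt.eventually
        (hfin.isClosed.isOpen_compl.mem_nhds fun h => h.2 rfl)
    filter_upwards [this] with z hz hzp
    rintro ⟨k, hk, -⟩
    exact hz ⟨⟨k, hk.symm⟩, hzp⟩
  have ev : ∀ᶠ z in 𝓝 p, (z ∉ crossPts e ∧ z ∉ branchPts e ∧ (z.re = p.re → z ∈ cuts e)) ∧
      (z.re ≠ p.re → z ∉ cuts e ∧ z ∉ rhPoles e R) ∧ z.re ≠ 0 ∧ z.im ≠ 0 := by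
    have h := eventually_notMem_rhPoles hS he hR p
    rw [eventually_nhdsWithin_iff] at h
    filter_upwards [eventually_notMem_crossPts hc, eventually_notMem_branchPts hb,
      eventually_mem_cuts hp hb, ev1, h, Complex.continuous_re.continuousAt.eventually_ne hp0,
      Complex.continuous_im.continuousAt.eventually_ne him]
      with z h1 h2 h3 h4 h5 h6 h7
    exact ⟨⟨h1, h2, h3⟩, fun h => ⟨h4 h, h5 fun h' => h (by rw [h'])⟩, h6, h7⟩
  obtain ⟨r, hr, hball⟩ := Metric.eventually_nhds_iff_ball.1 ev
  refine (extendsAt_vertical hr ?_ ?_).mono ?_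
  · intro z hz hzp
    obtain ⟨⟨h1, h2, h3⟩, h4, h5, h6⟩ := hball z hz
    exact (mAnalyticAt_dressed hS he hR hm (mem_regSet h5 h6 (h4 hzp).1 (h4 hzp).2)
      i j).differentiableAt
  · intro z hz hzp
    obtain ⟨⟨h1, h2, h3⟩, h4, h5, h6⟩ := hball z hz
    obtain ⟨A, hA, hB⟩ := cut_limits hS he hR hm (h3 hzp) h2 h1
    rw [hzp] at hA hB
    exact ⟨A i j, tendsto_entry hA i j, tendsto_entry hB i j⟩
  · filter_upwards [ev] with z hz hzr hzp
    exact (off_axes_of_mem_regSet hzr).2.2.1 (hz.1.2.2 hzp)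

/-- `a` is entire and tends to `1` high in the upper half-plane, so it is not identically zero and
its zeros are isolated. -/
theorem SpectralData.eventually_ne (hS : SpectralData L a b) (p : ℂ) :
    ∀ᶠ z in 𝓝[≠] p, a z ≠ 0 ∧ schwarz a z ≠ 0 := by
  have key : ∀ p, ∀ᶠ z in 𝓝[≠] p, a z ≠ 0 := by
    intro p
    have han : AnalyticOnNhd ℂ a Set.univ := fun z _ => hS.diff_a.analyticAt z
    rcases (hS.diff_a.analyticAt p).eventually_eq_zero_or_eventually_ne_zero with h | h
    · exfalso
      have h1 := han.eqOn_zero_of_preconnected_of_eventuallyEq_zero isPreconnected_univ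
        (Set.mem_univ p) h
      obtain ⟨K, hK⟩ := hS.tendsto_one 1 one_pos
      have h2 := hK (((K + 1 : ℝ) : ℂ) * Complex.I) (by simp)
      rw [h1 (Set.mem_univ _)] at h2
      simp at h2
    · exact h
  filter_upwards [key p, (tendsto_conj_nhdsNE p).eventually (key _)] with z h1 h2
  exact ⟨h1, by simpa [schwarz] using h2⟩

theorem extendsAt_of_generic (hS : SpectralData L a b) (he : IsMainSpectrum L a e)
    (hR : IsBranch L a b e R) (hm : IsRHSolution L a b e R x t m) {p : ℂ} (hb : p ∉ branchPts e)
    (hc : p ∉ crossPts e) (hp : p ∉ rhPoles e R) (ha : a p ≠ 0) (ha' : schwarz a p ≠ 0)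
    (i j : Fin 2) : ExtendsAt (fun z => dressed L a b R x t m z i j) (regSet e R) p := by
  by_cases h1 : p.im = 0
  · exact extendsAt_real hS he hR hm h1 hc ha i j
  by_cases h2 : p.re = 0
  · exact extendsAt_imag hS he hR hm h2 h1 ha ha' i j
  by_cases h3 : p ∈ cuts e
  · exact extendsAt_cut hS he hR hm h3 hb hc i j
  · exact ⟨_, mAnalyticAt_dressed hS he hR hm (mem_regSet h2 h1 h3 hp) i j,
      Eventually.of_forall fun _ _ => rfl⟩

theorem eventually_notMem_of_finite {s : Set ℂ} (hs : s.Finite) (p : ℂ) :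
    ∀ᶠ z in 𝓝[≠] p, z ∉ s := by
  have h : ∀ᶠ z in 𝓝 p, z ∉ s \ {p} :=
    (hs.sdiff (t := {p})).isClosed.isOpen_compl.mem_nhds fun h => h.2 rfl
  rw [eventually_nhdsWithin_iff]
  filter_upwards [h] with z hz hzp hzs using hz ⟨hzs, hzp⟩

/-- The points not covered by the jump conditions (branch points, crossings, poles, zeros of `a` and
`a*`) are isolated, which is what `extendsAt_of_removable` requires. -/
theorem eventually_extendsAt (hS : SpectralData L a b) (he : IsMainSpectrum L a e)
    (hR : IsBranch L a b e R) (hm : IsRHSolution L a b e R x t m) (p : ℂ) (i j : Fin 2) :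
    ∀ᶠ z in 𝓝[≠] p, ExtendsAt (fun z => dressed L a b R x t m z i j) (regSet e R) z := by
  have h1 : ∀ᶠ z in 𝓝[≠] p, z ∉ branchPts e :=
    eventually_notMem_of_finite (finite_branchPts e) p
  have h2 : ∀ᶠ z in 𝓝[≠] p, z ∉ crossPts e :=
    eventually_notMem_of_finite (finite_crossPts e) p
  filter_upwards [h1, h2, eventually_notMem_rhPoles hS he hR p, hS.eventually_ne p]
    with z h1 h2 h3 h4 using extendsAt_of_generic hS he hR hm h1 h2 h3 h4.1 h4.2 i j

/-! ### Removing the isolated singularities -/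

/-- `(z - p) f → 0` entrywise. -/
def Mild (f : ℂ → Mat2) (l : Filter ℂ) (p : ℂ) : Prop :=
  Tendsto (fun z => (z - p) • f z) l (𝓝 0)

theorem Mild.mul_right {f g : ℂ → Mat2} {l : Filter ℂ} {p : ℂ} (h : Mild f l p)
    (hl : l ≤ 𝓝 p) (hg : MAnalyticAt g p) : Mild (fun z => f z * g z) l p := by
  have := Filter.Tendsto.mul h (hg.continuousAt.tendsto.mono_left hl)
  rw [zero_mul] at this
  exact this.congr fun z => by rw [smul_mul_assoc]

theorem tendsto_sub_nhdsWithin (p : ℂ) {l : Filter ℂ} (hl : l ≤ 𝓝 p) :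
    Tendsto (fun z => z - p) l (𝓝 0) := by
  have : Continuous fun z : ℂ => z - p := by fun_prop
  simpa using (this.tendsto p).mono_left hl

theorem mild_of_tendsto {f : ℂ → Mat2} {l : Filter ℂ} {p : ℂ} {A : Mat2} (hl : l ≤ 𝓝 p)
    (h : Tendsto f l (𝓝 A)) : Mild f l p := by
  have := (tendsto_sub_nhdsWithin p hl).smul h
  rwa [zero_smul] at this

theorem mild_mul_of_bounded {f g : ℂ → Mat2} {l : Filter ℂ} {p : ℂ}
    (h : ∀ i j, (fun z => f z i j) =O[l] fun _ => (1 : ℝ)) (hg : Mild g l p) :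
    Mild (fun z => f z * g z) l p := by
  refine tendsto_matrix fun i j => ?_
  have h1 : ∀ k, Tendsto (fun z => f z i k * ((z - p) * g z k j)) l (𝓝 0) := by
    intro k
    have h2 : Tendsto (fun z => (z - p) * g z k j) l (𝓝 0) := tendsto_entry hg k j
    have h3 := (h i k).mul ((isLittleO_one_iff ℝ).2 h2).isBigO
    refine Tendsto.zero_mul_isBoundedUnder_le h2 ?_ |>.congr fun z => mul_comm _ _
    obtain ⟨C, hC⟩ := (h i k).bound
    exact ⟨C, by simpa using hC⟩
  have h2 := (h1 0).add (h1 1)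
  rw [add_zero] at h2
  refine h2.congr fun z => ?_
  simp [Matrix.mul_apply, Fin.sum_univ_two]; ring

theorem IsChart.mild_dressWith {Q : Set ℂ} {ρ : ℂ → ℂ} {n s : ℂ → Mat2}
    (hQ : IsChart L a b R e Q ρ n s) {p : ℂ} (hp : p = 0 ∨ p ∈ cuts e) :
    Mild (dressWith ρ n s x t) (𝓝[(cuts e)ᶜ] p) p := by
  have h1 : Mild (fun z => 1 + ρ z • n z) (𝓝[(cuts e)ᶜ] p) p := by
    have h2 := ((tendsto_sub_nhdsWithin p nhdsWithin_le_nhds).smul_const (1 : Mat2)).add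
      ((hQ.mild p hp).smul ((hQ.n_analytic p).continuousAt.tendsto.mono_left
        (nhdsWithin_le_nhds (s := (cuts e)ᶜ))))
    rw [zero_smul, zero_smul, add_zero] at h2
    exact h2.congr fun z => by rw [smul_add, smul_smul]
  have h2 := h1.mul_right nhdsWithin_le_nhds (hQ.s_analytic p)
  have h3 := ((mAnalyticAt_expσ₃ (differentiable_phase x t).neg p).continuousAt.tendsto.mono_left
    (nhdsWithin_le_nhds (s := (cuts e)ᶜ))).mul h2
  rw [mul_zero] at h3
  exact h3.congr fun z => by rw [mul_smul_comm]; rfl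

theorem nhdsWithin_regSet_inter_le {p : ℂ} (Q : Set ℂ) :
    𝓝[regSet e R ∩ Q] p ≤ 𝓝[(cuts e)ᶜ] p ∧ 𝓝[regSet e R ∩ Q] p ≤ 𝓝[(contour e)ᶜ] p :=
  ⟨nhdsWithin_mono p fun _ hz => (off_axes_of_mem_regSet hz.1).2.2.1,
    nhdsWithin_mono p fun _ hz => (off_axes_of_mem_regSet hz.1).2.2.2.2⟩

theorem regSet_eq_union : regSet e R = regSet e R ∩ Q1 ∪ regSet e R ∩ Q2 ∪
    (regSet e R ∩ Q3 ∪ regSet e R ∩ Q4) := by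
  ext z
  constructor
  · intro hz
    obtain ⟨h1, h2, -⟩ := off_axes_of_mem_regSet hz
    rcases mem_quadrant h1 h2 with h | h | h | h
    · exact Or.inl (Or.inl ⟨hz, h⟩)
    · exact Or.inl (Or.inr ⟨hz, h⟩)
    · exact Or.inr (Or.inl ⟨hz, h⟩)
    · exact Or.inr (Or.inr ⟨hz, h⟩)
  · rintro ((h | h) | (h | h)) <;> exact h.1

/-- At a crossing `m` is bounded, so the growth of the product is that of the dressing, which is
weaker than a pole in each quadrant. -/
theorem mild_cross (hS : SpectralData L a b) (he : IsMainSpectrum L a e)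
    (hR : IsBranch L a b e R) (hm : IsRHSolution L a b e R x t m) {p : ℂ}
    (hp : p ∈ crossPts e) : Mild (dressed L a b R x t m) (𝓝[regSet e R] p) p := by
  have hp' : p = 0 ∨ p ∈ cuts e := by
    rcases hp with h | ⟨k, h⟩
    · exact Or.inl h
    · exact Or.inr ⟨k, by simp [h], by simp [h, (he.im_pos k).le]⟩
  have key : ∀ {Q : Set ℂ} {ρ : ℂ → ℂ} {n s : ℂ → Mat2}, IsChart L a b R e Q ρ n s →
      Mild (dressed L a b R x t m) (𝓝[regSet e R ∩ Q] p) p := by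
    intro Q ρ n s hQ
    obtain ⟨hl1, hl2⟩ := nhdsWithin_regSet_inter_le (e := e) (R := R) (p := p) Q
    have h1 := mild_mul_of_bounded (fun i j => (hm.bounded_cross p hp i j).mono hl2)
      (Tendsto.mono_left (hQ.mild_dressWith (x := x) (t := t) hp') hl1)
    refine Tendsto.congr' ?_ h1
    filter_upwards [self_mem_nhdsWithin] with z hz
    rw [dressed, hQ.dress_eq x t z hz.2]
  rw [Mild, regSet_eq_union, nhdsWithin_union, nhdsWithin_union, nhdsWithin_union]
  exact ((key (isChart_Q1 hS he hR)).sup (key (isChart_Q2 hS he hR))).sup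
    ((key (isChart_Q3 hS he hR)).sup (key (isChart_Q4 hS he hR)))

/-- Needed where `a` or `a*` vanishes on an axis: no jump relation is available there, but the
one-sided limits bound the dressed solution. -/
theorem mild_axes (hS : SpectralData L a b) (he : IsMainSpectrum L a e)
    (hR : IsBranch L a b e R) (hm : IsRHSolution L a b e R x t m) {p : ℂ}
    (hp : p.im = 0 ∨ p.re = 0) (hc : p ∉ crossPts e) :
    Mild (dressed L a b R x t m) (𝓝[regSet e R] p) p := by
  by_cases hp0 : p.im = 0
  · obtain ⟨A, B, hA, hB, -⟩ := real_limits hS he hR hm hp0 hc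
    refine Tendsto.mono_left ((mild_of_tendsto nhdsWithin_le_nhds hA).sup
      (mild_of_tendsto nhdsWithin_le_nhds hB)) ?_
    rw [← nhdsWithin_union]
    exact nhdsWithin_mono p fun z hz => (off_axes_of_mem_regSet hz).2.1.lt_or_gt.symm
  · obtain ⟨A, B, hA, hB, -⟩ := imag_limits hS he hR hm (hp.resolve_left hp0) hp0
    refine Tendsto.mono_left ((mild_of_tendsto nhdsWithin_le_nhds hA).sup
      (mild_of_tendsto nhdsWithin_le_nhds hB)) ?_
    rw [← nhdsWithin_union]
    exact nhdsWithin_mono p fun z hz => (off_axes_of_mem_regSet hz).1.lt_or_gt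

theorem mul_dress_nUp (A : Mat2) (w ρ : ℂ) (η : ℂ → ℂ) (z : ℂ) :
    A * (expσ₃ (-w) * (1 + ρ • nUp η z)) =
      !![A 0 0 * Complex.exp (-w), A 0 1 * Complex.exp w + A 0 0 * Complex.exp (-w) * (ρ * η z);
        A 1 0 * Complex.exp (-w), A 1 1 * Complex.exp w + A 1 0 * Complex.exp (-w) * (ρ * η z)] := by
  have h : 1 + ρ • nUp η z = !![1, ρ * η z; 0, 1] := by
    ext i j; fin_cases i <;> fin_cases j <;> simp [nUp]
  rw [h]
  ext i j
  fin_cases i <;> fin_cases j <;>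
    simp [Matrix.mul_apply, Fin.sum_univ_two, expσ₃] <;> ring

theorem mul_dress_nLow (A : Mat2) (w ρ : ℂ) (η : ℂ → ℂ) (z : ℂ) :
    A * (expσ₃ (-w) * (1 + ρ • nLow η z)) =
      !![A 0 0 * Complex.exp (-w) + A 0 1 * Complex.exp w * (ρ * η z), A 0 1 * Complex.exp w;
        A 1 0 * Complex.exp (-w) + A 1 1 * Complex.exp w * (ρ * η z), A 1 1 * Complex.exp w] := by
  have h : 1 + ρ • nLow η z = !![1, 0; ρ * η z, 1] := by
    ext i j; fin_cases i <;> fin_cases j <;> simp [nLow]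
  rw [h]
  ext i j
  fin_cases i <;> fin_cases j <;>
    simp [Matrix.mul_apply, Fin.sum_univ_two, expσ₃] <;> ring

/-- The residue condition is designed so that the pole of the second column of `m` cancels that of
`ρ` times the first column. The cancellation is the hypothesis `hc` on the residue constant. -/
theorem mild_residue_up {ξ c r : ℂ} {ρ η : ℂ → ℂ} (hm : HasResidue m ξ 1 0 c)
    (hρ : Tendsto (fun z => (z - ξ) * ρ z) (𝓝[≠] ξ) (𝓝 r)) (hη : Continuous η)
    (hc : c = -(r * η ξ * Complex.exp (-(2 * phase x t ξ)))) :
    Mild (fun z => m z * (expσ₃ (-phase x t z) * (1 + ρ z • nUp η z))) (𝓝[≠] ξ) ξ := by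
  have hph := (differentiable_phase x t).continuous
  have hexp : Tendsto (fun z => Complex.exp (phase x t z)) (𝓝[≠] ξ)
      (𝓝 (Complex.exp (phase x t ξ))) :=
    ((Complex.continuous_exp.comp hph).tendsto ξ).mono_left nhdsWithin_le_nhds
  have hexp' : Tendsto (fun z => Complex.exp (-phase x t z)) (𝓝[≠] ξ)
      (𝓝 (Complex.exp (-phase x t ξ))) :=
    ((Complex.continuous_exp.comp hph.neg).tendsto ξ).mono_left nhdsWithin_le_nhds
  have h0 := tendsto_sub_nhdsWithin ξ (nhdsWithin_le_nhds (s := {ξ}ᶜ))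
  have hη' := (hη.tendsto ξ).mono_left (nhdsWithin_le_nhds (s := {ξ}ᶜ))
  have hexp2 : Complex.exp (-(2 * phase x t ξ)) * Complex.exp (phase x t ξ) =
      Complex.exp (-phase x t ξ) := by rw [← Complex.exp_add]; ring_nf
  have hcol : ∀ i, Tendsto (fun z => m z i 0) (𝓝[≠] ξ) (𝓝 (m ξ i 0)) := fun i =>
    (hm i).1.continuousAt.tendsto.mono_left nhdsWithin_le_nhds
  have h1 : ∀ i, Tendsto (fun z => (z - ξ) * (m z i 0 * Complex.exp (-phase x t z))) (𝓝[≠] ξ)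
      (𝓝 0) := fun i => by simpa using h0.mul ((hcol i).mul hexp')
  have h2 : ∀ i, Tendsto (fun z => (z - ξ) * (m z i 1 * Complex.exp (phase x t z) +
      m z i 0 * Complex.exp (-phase x t z) * (ρ z * η z))) (𝓝[≠] ξ) (𝓝 0) := by
    intro i
    have h3 := ((hm i).2.mul hexp).add (((hcol i).mul hexp').mul (hρ.mul hη'))
    have h4 : c * m ξ i 0 * Complex.exp (phase x t ξ) +
        m ξ i 0 * Complex.exp (-phase x t ξ) * (r * η ξ) = 0 := by
      rw [hc]; linear_combination (-(m ξ i 0 * r * η ξ)) * hexp2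
    rw [h4] at h3
    exact h3.congr fun z => by ring
  refine tendsto_matrix fun i j => ?_
  fin_cases j
  · refine (h1 i).congr fun z => ?_
    change _ = (z - ξ) * (m z * (expσ₃ (-phase x t z) * (1 + ρ z • nUp η z))) i 0
    rw [mul_dress_nUp]; fin_cases i <;> simp
  · refine (h2 i).congr fun z => ?_
    change _ = (z - ξ) * (m z * (expσ₃ (-phase x t z) * (1 + ρ z • nUp η z))) i 1
    rw [mul_dress_nUp]; fin_cases i <;> simp

theorem mild_residue_low {ξ c r : ℂ} {ρ η : ℂ → ℂ} (hm : HasResidue m ξ 0 1 c)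
    (hρ : Tendsto (fun z => (z - ξ) * ρ z) (𝓝[≠] ξ) (𝓝 r)) (hη : Continuous η)
    (hc : c = -(r * η ξ * Complex.exp (2 * phase x t ξ))) :
    Mild (fun z => m z * (expσ₃ (-phase x t z) * (1 + ρ z • nLow η z))) (𝓝[≠] ξ) ξ := by
  have hph := (differentiable_phase x t).continuous
  have hexp : Tendsto (fun z => Complex.exp (phase x t z)) (𝓝[≠] ξ)
      (𝓝 (Complex.exp (phase x t ξ))) :=
    ((Complex.continuous_exp.comp hph).tendsto ξ).mono_left nhdsWithin_le_nhds
  have hexp' : Tendsto (fun z => Complex.exp (-phase x t z)) (𝓝[≠] ξ)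
      (𝓝 (Complex.exp (-phase x t ξ))) :=
    ((Complex.continuous_exp.comp hph.neg).tendsto ξ).mono_left nhdsWithin_le_nhds
  have h0 := tendsto_sub_nhdsWithin ξ (nhdsWithin_le_nhds (s := {ξ}ᶜ))
  have hη' := (hη.tendsto ξ).mono_left (nhdsWithin_le_nhds (s := {ξ}ᶜ))
  have hexp2 : Complex.exp (2 * phase x t ξ) * Complex.exp (-phase x t ξ) =
      Complex.exp (phase x t ξ) := by rw [← Complex.exp_add]; ring_nf
  have hcol : ∀ i, Tendsto (fun z => m z i 1) (𝓝[≠] ξ) (𝓝 (m ξ i 1)) := fun i =>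
    (hm i).1.continuousAt.tendsto.mono_left nhdsWithin_le_nhds
  have h1 : ∀ i, Tendsto (fun z => (z - ξ) * (m z i 1 * Complex.exp (phase x t z))) (𝓝[≠] ξ)
      (𝓝 0) := fun i => by simpa using h0.mul ((hcol i).mul hexp)
  have h2 : ∀ i, Tendsto (fun z => (z - ξ) * (m z i 0 * Complex.exp (-phase x t z) +
      m z i 1 * Complex.exp (phase x t z) * (ρ z * η z))) (𝓝[≠] ξ) (𝓝 0) := by
    intro i
    have h3 := ((hm i).2.mul hexp').add (((hcol i).mul hexp).mul (hρ.mul hη'))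
    have h4 : c * m ξ i 1 * Complex.exp (-phase x t ξ) +
        m ξ i 1 * Complex.exp (phase x t ξ) * (r * η ξ) = 0 := by
      rw [hc]; linear_combination (-(m ξ i 1 * r * η ξ)) * hexp2
    rw [h4] at h3
    exact h3.congr fun z => by ring
  refine tendsto_matrix fun i j => ?_
  fin_cases j
  · refine (h2 i).congr fun z => ?_
    change _ = (z - ξ) * (m z * (expσ₃ (-phase x t z) * (1 + ρ z • nLow η z))) i 0
    rw [mul_dress_nLow]; fin_cases i <;> simp
  · refine (h1 i).congr fun z => ?_
    change _ = (z - ξ) * (m z * (expσ₃ (-phase x t z) * (1 + ρ z • nLow η z))) i 1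
    rw [mul_dress_nLow]; fin_cases i <;> simp

theorem IsChart.mild_dressed {Q : Set ℂ} {ρ : ℂ → ℂ} {n s : ℂ → Mat2}
    (hQ : IsChart L a b R e Q ρ n s) {p : ℂ} {l : Filter ℂ} (hl : l ≤ 𝓝 p) (hlQ : ∀ᶠ z in l, z ∈ Q)
    (h : Mild (fun z => m z * (expσ₃ (-phase x t z) * (1 + ρ z • n z))) l p) :
    Mild (dressed L a b R x t m) l p := by
  refine Tendsto.congr' ?_ (h.mul_right hl (hQ.s_analytic p))
  filter_upwards [hlQ] with z hz
  rw [dressed, hQ.dress_eq x t z hz, dressWith]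
  simp only [Matrix.mul_assoc]

theorem mild_pole (hS : SpectralData L a b) (he : IsMainSpectrum L a e)
    (hR : IsBranch L a b e R) (hm : IsRHSolution L a b e R x t m) {p : ℂ}
    (hp : p ∈ rhPoles e R) : Mild (dressed L a b R x t m) (𝓝[≠] p) p := by
  obtain ⟨hpc, ⟨hp1 | hp1, hpole⟩ | ⟨hp1 | hp1, hpole⟩⟩ := hp
  · refine (isChart_Q1 hS he hR).mild_dressed nhdsWithin_le_nhds
      (nhdsWithin_le_nhds (isOpen_Q1.mem_nhds hp1))
      (mild_residue_up (hm.res_I p ⟨hp1, hpc⟩ hpole) (hR.tendsto_residue ⟨Or.inl hp1, hpc⟩ hpole)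
        continuous_const ?_)
    rw [phase]; ring_nf
  · refine (isChart_Q3 hS he hR).mild_dressed nhdsWithin_le_nhds
      (nhdsWithin_le_nhds (isOpen_Q3.mem_nhds hp1))
      (mild_residue_up (hm.res_III p ⟨hp1, hpc⟩ hpole) (hR.tendsto_residue ⟨Or.inr hp1, hpc⟩ hpole)
        (differentiable_expL L).neg.continuous ?_)
    rw [phase, expL, mul_neg, neg_mul, neg_neg, mul_assoc (residue _ _), ← Complex.exp_add]
    ring_nf
  · refine (isChart_Q2 hS he hR).mild_dressed nhdsWithin_le_nhds
      (nhdsWithin_le_nhds (isOpen_Q2.mem_nhds hp1))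
      (mild_residue_low (hm.res_II p ⟨hp1, hpc⟩ hpole)
        (hR.tendsto_residue_schwarz ⟨Or.inl hp1, hpc⟩ hpole) (continuous_expL_inv L) ?_)
    rw [phase, expL, ← Complex.exp_neg, mul_assoc (residue _ _), ← Complex.exp_add]; ring_nf
  · refine (isChart_Q4 hS he hR).mild_dressed nhdsWithin_le_nhds
      (nhdsWithin_le_nhds (isOpen_Q4.mem_nhds hp1))
      (mild_residue_low (hm.res_IV p ⟨hp1, hpc⟩ hpole)
        (hR.tendsto_residue_schwarz ⟨Or.inr hp1, hpc⟩ hpole) continuous_const ?_)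
    rw [phase]; ring_nf

end

end

end PeriodicNLS

namespace PeriodicNLS

noncomputable section

section

variable {N : ℕ} {L : ℝ} {a b R : ℂ → ℂ} {e : Fin (N + 1) → ℂ} {x t : ℝ} {m : ℂ → Mat2}

/-! ### Branch points and the global extension -/

theorem ExtendsAt.mul_analytic {f g : ℂ → ℂ} {S : Set ℂ} {p : ℂ} (hf : ExtendsAt f S p)
    (hg : AnalyticAt ℂ g p) : ExtendsAt (fun z => f z * g z) S p := by
  obtain ⟨h, hh, he⟩ := hf
  refine ⟨fun z => h z * g z, hh.mul hg, ?_⟩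
  filter_upwards [he] with z hz hzS
  rw [hz hzS]

theorem ExtendsAt.add {f g : ℂ → ℂ} {S : Set ℂ} {p : ℂ} (hf : ExtendsAt f S p)
    (hg : ExtendsAt g S p) : ExtendsAt (fun z => f z + g z) S p := by
  obtain ⟨h, hh, he⟩ := hf
  obtain ⟨k, hk, he'⟩ := hg
  refine ⟨fun z => h z + k z, hh.add hk, ?_⟩
  filter_upwards [he, he'] with z hz hz' hzS
  rw [hz hzS, hz' hzS]

theorem tendsto_branch_sing (hm : IsRHSolution L a b e R x t m) {p : ℂ} (hp : p ∈ branchPts e)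
    (i j : Fin 2) : Tendsto (fun z => (z - p) * m z i j) (𝓝[(contour e)ᶜ] p) (𝓝 0) := by
  have h1 : (fun z => (z - p) * m z i j) =O[𝓝[(contour e)ᶜ] p]
      fun z => ‖z - p‖ * ‖z - p‖ ^ (-(1 / 2) : ℝ) :=
    (isBigO_refl (fun z => z - p) _).norm_right.mul (hm.branch_sing p hp i j)
  refine h1.trans_tendsto ?_
  have h2 : Tendsto (fun z => ‖z - p‖ ^ (1 / 2 : ℝ)) (𝓝[(contour e)ᶜ] p) (𝓝 0) := by
    have h3 : Continuous fun z : ℂ => ‖z - p‖ ^ (1 / 2 : ℝ) :=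
      (by fun_prop : Continuous fun z : ℂ => ‖z - p‖).rpow_const fun _ => Or.inr (by norm_num)
    have h4 := (h3.tendsto p).mono_left (nhdsWithin_le_nhds (s := (contour e)ᶜ))
    simpa using h4
  refine h2.congr fun z => ?_
  rcases eq_or_ne ‖z - p‖ 0 with h | h
  · rw [h]; norm_num
  · have hpos : 0 < ‖z - p‖ := lt_of_le_of_ne (norm_nonneg _) h.symm
    nth_rewrite 2 [← Real.rpow_one ‖z - p‖]
    rw [← Real.rpow_add hpos]; norm_num

theorem analyticAt_exp_phase (x t : ℝ) (p : ℂ) :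
    AnalyticAt ℂ (fun z => Complex.exp (phase x t z)) p :=
  (differentiable_phase x t).cexp.analyticAt p

theorem analyticAt_exp_neg_phase (x t : ℝ) (p : ℂ) :
    AnalyticAt ℂ (fun z => Complex.exp (-phase x t z)) p :=
  (differentiable_phase x t).neg.cexp.analyticAt p

/-- In a chart the undressed column of `m` inherits the analytic continuation of the dressed
solution. -/
theorem IsChart.extendsAt_column {Q : Set ℂ} {ρ : ℂ → ℂ} {n s s' : ℂ → Mat2}
    (hQ : IsChart L a b R e Q ρ n s) (hs' : ∀ p, MAnalyticAt s' p) (hss : ∀ z, s z * s' z = 1)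
    {z : ℂ} (hz : z ∈ Q)
    (h : ∀ i j, ExtendsAt (fun z => dressed L a b R x t m z i j) (regSet e R) z) (i k : Fin 2) :
    ExtendsAt (fun z => (m z * (expσ₃ (-phase x t z) * (1 + ρ z • n z))) i k) (regSet e R) z := by
  refine (((h i 0).mul_analytic (hs' z 0 k)).add ((h i 1).mul_analytic (hs' z 1 k))).congr ?_
  filter_upwards [hQ.isOpen.mem_nhds hz] with w hw _
  have : dressed L a b R x t m w * s' w = m w * (expσ₃ (-phase x t w) * (1 + ρ w • n w)) := by
    rw [dressed, hQ.dress_eq x t w hw, dressWith]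
    simp only [Matrix.mul_assoc, hss, Matrix.mul_one]
  rw [← this, Matrix.mul_apply, Fin.sum_univ_two]

/-- The direct product bound fails: `m` may grow like `|z - p|^{-1/2}`, while about `ρ` only `(z -
p) ρ → 0` is known. The nilpotent factor leaves one column of `m` untouched by `ρ`. That column
continues analytically across the cut near `p` and grows too slowly for a pole, so it has a limit at
`p`; only this column is then multiplied by `ρ` to form the other one. -/
theorem mild_branch (hS : SpectralData L a b) (he : IsMainSpectrum L a e)
    (hR : IsBranch L a b e R) (hm : IsRHSolution L a b e R x t m) {p : ℂ}
    (hp : p ∈ branchPts e) : Mild (dressed L a b R x t m) (𝓝[regSet e R] p) p := by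
  have hpc := branchPts_subset_cuts he.im_pos hp
  have him : p.im ≠ 0 := by
    obtain ⟨k, rfl | rfl⟩ := hp
    · exact (he.im_pos k).ne'
    · simpa using (he.im_pos k).ne'
  have hpS : p ∉ regSet e R := fun h => (off_axes_of_mem_regSet h).2.2.1 hpc
  obtain ⟨Q, ρ, n, s, hQ, hpQ⟩ := exists_chart hS he hR (he.re_ne_zero hpc) him
  obtain ⟨s', hs', hss⟩ := hQ.s_inv
  -- Removing the analytic invertible factor `s` from the dressed solution preserves its
  -- continuation off `p` and isolates the triangular structure.
  have hext : ∀ i k, ∀ᶠ z in 𝓝[≠] p, ExtendsAt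
      (fun z => (m z * (expσ₃ (-phase x t z) * (1 + ρ z • n z))) i k) (regSet e R) z := by
    intro i k
    have h1 : ∀ᶠ z in 𝓝[≠] p, ∀ i j,
        ExtendsAt (fun z => dressed L a b R x t m z i j) (regSet e R) z := by
      simp only [eventually_all]
      exact fun i j => eventually_extendsAt hS he hR hm p i j
    filter_upwards [h1, nhdsWithin_le_nhds (hQ.isOpen.mem_nhds hpQ)] with z h2 h3
    exact hQ.extendsAt_column hs' hss h3 h2 i k
  have hle : 𝓝[regSet e R] p ≤ 𝓝[(contour e)ᶜ] p :=
    nhdsWithin_mono p fun _ hz => (off_axes_of_mem_regSet hz).2.2.2.2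
  have hle' : 𝓝[regSet e R] p ≤ 𝓝[(cuts e)ᶜ] p :=
    nhdsWithin_mono p fun _ hz => (off_axes_of_mem_regSet hz).2.2.1
  have hmm : ∀ i j, Tendsto (fun z => (z - p) * m z i j) (𝓝[regSet e R] p) (𝓝 0) := fun i j =>
    (tendsto_branch_sing hm hp i j).mono_left hle
  have hρ : Tendsto (fun z => (z - p) * ρ z) (𝓝[regSet e R] p) (𝓝 0) :=
    (hQ.mild p (Or.inr hpc)).mono_left hle'
  have hexp := (analyticAt_exp_phase x t p).continuousAt.tendsto.mono_left
    (nhdsWithin_le_nhds (s := regSet e R))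
  have hexp' := (analyticAt_exp_neg_phase x t p).continuousAt.tendsto.mono_left
    (nhdsWithin_le_nhds (s := regSet e R))
  refine hQ.mild_dressed nhdsWithin_le_nhds (nhdsWithin_le_nhds (hQ.isOpen.mem_nhds hpQ)) ?_
  rcases hQ.triangular with ⟨η, hη, rfl⟩ | ⟨η, hη, rfl⟩
  · have hη' := (hη.tendsto p).mono_left (nhdsWithin_le_nhds (s := regSet e R))
    have h0 : ∀ i, Tendsto (fun z => (z - p) * (m z i 0 * Complex.exp (-phase x t z)))
        (𝓝[regSet e R] p) (𝓝 0) := fun i => by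
      have := (hmm i 0).mul hexp'
      rw [zero_mul] at this
      exact this.congr fun z => by ring
    -- The bootstrap: the column free of `ρ` has a removable singularity, hence a limit.
    have h1 : ∀ i, ∃ c, Tendsto (fun z => m z i 0 * Complex.exp (-phase x t z))
        (𝓝[regSet e R] p) (𝓝 c) := fun i => by
      have h2 := hext i 0
      simp only [mul_dress_nUp] at h2
      refine (extendsAt_of_removable (dense_regSet hS he hR) hpS ?_ (h0 i)).tendsto
      filter_upwards [h2] with z hz
      refine hz.congr (Eventually.of_forall fun w _ => ?_)
      fin_cases i <;> simp
    refine tendsto_matrix fun i j => ?_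
    fin_cases j
    · refine (h0 i).congr fun z => ?_
      change _ = (z - p) * (m z * (expσ₃ (-phase x t z) * (1 + ρ z • nUp η z))) i 0
      rw [mul_dress_nUp]; fin_cases i <;> simp
    · obtain ⟨c, hc⟩ := h1 i
      have h3 := ((hmm i 1).mul hexp).add (hc.mul (hρ.mul hη'))
      simp only [zero_mul, mul_zero, add_zero, Matrix.zero_apply] at h3 ⊢
      refine h3.congr fun z => ?_
      change _ = (z - p) * (m z * (expσ₃ (-phase x t z) * (1 + ρ z • nUp η z))) i 1
      rw [mul_dress_nUp]; fin_cases i <;> simp <;> ring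
  · have hη' := (hη.tendsto p).mono_left (nhdsWithin_le_nhds (s := regSet e R))
    have h0 : ∀ i, Tendsto (fun z => (z - p) * (m z i 1 * Complex.exp (phase x t z)))
        (𝓝[regSet e R] p) (𝓝 0) := fun i => by
      have := (hmm i 1).mul hexp
      rw [zero_mul] at this
      exact this.congr fun z => by ring
    have h1 : ∀ i, ∃ c, Tendsto (fun z => m z i 1 * Complex.exp (phase x t z))
        (𝓝[regSet e R] p) (𝓝 c) := fun i => by
      have h2 := hext i 1
      simp only [mul_dress_nLow] at h2
      refine (extendsAt_of_removable (dense_regSet hS he hR) hpS ?_ (h0 i)).tendsto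
      filter_upwards [h2] with z hz
      refine hz.congr (Eventually.of_forall fun w _ => ?_)
      fin_cases i <;> simp
    refine tendsto_matrix fun i j => ?_
    fin_cases j
    · obtain ⟨c, hc⟩ := h1 i
      have h3 := ((hmm i 0).mul hexp').add (hc.mul (hρ.mul hη'))
      simp only [zero_mul, mul_zero, add_zero, Matrix.zero_apply] at h3 ⊢
      refine h3.congr fun z => ?_
      change _ = (z - p) * (m z * (expσ₃ (-phase x t z) * (1 + ρ z • nLow η z))) i 0
      rw [mul_dress_nLow]; fin_cases i <;> simp <;> ring
    · refine (h0 i).congr fun z => ?_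
      change _ = (z - p) * (m z * (expσ₃ (-phase x t z) * (1 + ρ z • nLow η z))) i 1
      rw [mul_dress_nLow]; fin_cases i <;> simp

/-- Every point falls into one of two classes: an interior cut point or regular point, where
continuation is direct, or an exceptional or axis point, where the growth bound and the isolation of
bad points give a removable singularity. -/
theorem extendsAt_dressed (hS : SpectralData L a b) (he : IsMainSpectrum L a e)
    (hR : IsBranch L a b e R) (hm : IsRHSolution L a b e R x t m) (p : ℂ) (i j : Fin 2) :
    ExtendsAt (fun z => dressed L a b R x t m z i j) (regSet e R) p := by
  have key : p ∉ regSet e R → Mild (dressed L a b R x t m) (𝓝[regSet e R] p) p →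
      ExtendsAt (fun z => dressed L a b R x t m z i j) (regSet e R) p := fun hp h =>
    extendsAt_of_removable (dense_regSet hS he hR) hp (eventually_extendsAt hS he hR hm p i j)
      (tendsto_entry h i j)
  by_cases hb : p ∈ branchPts e
  · exact key (fun h => (off_axes_of_mem_regSet h).2.2.1 (branchPts_subset_cuts he.im_pos hb))
      (mild_branch hS he hR hm hb)
  by_cases hc : p ∈ crossPts e
  · refine key (fun h => (off_axes_of_mem_regSet h).2.1 ?_) (mild_cross hS he hR hm hc)
    rcases hc with rfl | ⟨k, rfl⟩ <;> simp
  by_cases hp : p ∈ rhPoles e R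
  · have hpS : p ∉ regSet e R := fun h => (off_axes_of_mem_regSet h).2.2.2.1 hp
    refine key hpS ((mild_pole hS he hR hm hp).mono_left (nhdsWithin_mono p ?_))
    rintro z hz rfl
    exact hpS hz
  by_cases h1 : p.im = 0 ∨ p.re = 0
  · refine key (fun h => ?_) (mild_axes hS he hR hm h1 hc)
    exact h1.elim (off_axes_of_mem_regSet h).2.1 (off_axes_of_mem_regSet h).1
  rw [not_or] at h1
  by_cases h3 : p ∈ cuts e
  · exact extendsAt_cut hS he hR hm h3 hb hc i j
  · exact ⟨_, mAnalyticAt_dressed hS he hR hm (mem_regSet h1.2 h1.1 h3 hp) i j,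
      Eventually.of_forall fun _ _ => rfl⟩

/-! ### Behaviour at infinity -/

theorem tendsto_diagonal :
    Tendsto (fun s : ℝ => (s : ℂ) * (1 + Complex.I)) atTop (cocompact ℂ) := by
  rw [← Metric.cobounded_eq_cocompact, ← tendsto_norm_atTop_iff_cobounded]
  simp only [norm_mul, Complex.norm_real]
  exact tendsto_norm_atTop_atTop.atTop_mul_const (norm_pos_iff.2 fun h => by
    simpa using congrArg Complex.im h)

theorem IsBranch.eventually_regSet (hR : IsBranch L a b e R) :
    ∀ᶠ z in cocompact ℂ ⊓ 𝓟 (contour e)ᶜ, z ∈ regSet e R := by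
  filter_upwards [mem_inf_of_left hR.eventually_analyticAt_cocompact,
    mem_inf_of_right (mem_principal_self _)] with z h1 h2
  rw [regSet, Set.mem_compl_iff]
  rintro (h | h)
  · exact h2 h
  · exact notMem_rhPoles h1.2.1 h1.2.2 h

theorem eventually_diagonal (e : Fin (N + 1) → ℂ) :
    Tendsto (fun s : ℝ => (s : ℂ) * (1 + Complex.I)) atTop
      (cocompact ℂ ⊓ 𝓟 ((contour e)ᶜ ∩ Q1)) := by
  refine tendsto_inf.2 ⟨tendsto_diagonal, tendsto_principal.2 ?_⟩
  filter_upwards [tendsto_diagonal.eventually (eventually_notMem_cuts e), eventually_gt_atTop 0]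
    with s h1 h2
  exact ⟨notMem_contour (by simpa using h2.ne') (by simpa using h2.ne') h1,
    ⟨by simpa using h2, by simpa using h2⟩⟩

instance neBot_contour (e : Fin (N + 1) → ℂ) : (cocompact ℂ ⊓ 𝓟 (contour e)ᶜ).NeBot :=
  (((eventually_diagonal e).mono_right
    (inf_le_inf_left _ (principal_mono.2 Set.inter_subset_left))).neBot)

theorem det_dressWith {ρ : ℂ → ℂ} {n s : ℂ → Mat2} {z : ℂ}
    (h : (1 + ρ z • n z).det = 1) (hs : (s z).det = 1) : (dressWith ρ n s x t z).det = 1 := by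
  rw [dressWith, Matrix.det_mul, Matrix.det_mul, h, hs, expσ₃, Matrix.det_fin_two_of]
  simp [← Complex.exp_add]

theorem det_dress (hS : SpectralData L a b) (x t : ℝ) (z : ℂ) :
    (dress L a b R x t z).det = 1 := by
  have hu : ∀ (η : ℂ → ℂ) (ρ : ℂ), (1 + ρ • nUp η z).det = 1 := fun η ρ => by
    simp [Matrix.det_fin_two, nUp]
  have hl : ∀ (η : ℂ → ℂ) (ρ : ℂ), (1 + ρ • nLow η z).det = 1 := fun η ρ => by
    simp [Matrix.det_fin_two, nLow]
  have hs : (matSInv a b z).det = 1 := by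
    rw [matSInv, Matrix.det_fin_two_of]; linear_combination hS.det z
  rw [dress]
  split_ifs
  · exact det_dressWith (hu _ _) Matrix.det_one
  · exact det_dressWith (hl _ _) hs
  · exact det_dressWith (hu _ _) hs
  · exact det_dressWith (hl _ _) Matrix.det_one

/-- The dressed solution extends to an entire function of determinant one. -/
theorem exists_entire (hS : SpectralData L a b) (he : IsMainSpectrum L a e)
    (hR : IsBranch L a b e R) (hm : IsRHSolution L a b e R x t m) :
    ∃ F : ℂ → Mat2, (∀ i j, Differentiable ℂ fun z => F z i j) ∧
      (∀ z ∈ regSet e R, F z = m z * dress L a b R x t z) ∧ ∀ z, (F z).det = 1 := by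
  have hd := dense_regSet hS he hR
  have key := fun i j => differentiable_extendFrom hd fun p => extendsAt_dressed hS he hR hm p i j
  set F : ℂ → Mat2 := fun z => Matrix.of fun i j =>
    extendFrom (regSet e R) (fun z => dressed L a b R x t m z i j) z with hF
  have hF1 : ∀ i j, Differentiable ℂ fun z => F z i j := fun i j => (key i j).1
  have hF2 : ∀ z ∈ regSet e R, F z = m z * dress L a b R x t z := fun z hz => by
    ext i j; exact (key i j).2 z hz
  refine ⟨F, hF1, hF2, fun z => ?_⟩
  have hdet : Differentiable ℂ fun z => (F z).det := by
    simp only [Matrix.det_fin_two]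
    exact ((hF1 0 0).mul (hF1 1 1)).sub ((hF1 0 1).mul (hF1 1 0))
  -- The determinant is entire and equals `det m` off the contour near infinity, where it tends to
  -- one.
  have hdc : Dense (contour e)ᶜ := hd.mono fun z hz => (off_axes_of_mem_regSet hz).2.2.2.2
  refine eq_const_of_tendsto hdet hdc ?_ z
  have h1 : Tendsto (fun z => (m z).det) (cocompact ℂ ⊓ 𝓟 (contour e)ᶜ) (𝓝 (1 : Mat2).det) :=
    ((continuous_id.matrix_det).tendsto (1 : Mat2)).comp hm.normalized
  rw [Matrix.det_one] at h1
  refine h1.congr' ?_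
  filter_upwards [hR.eventually_regSet] with z hz
  rw [hF2 z hz, Matrix.det_mul, det_dress hS, mul_one]

end

end

end PeriodicNLS

namespace PeriodicNLS

noncomputable section

section

variable {N : ℕ} {L : ℝ} {a b R : ℂ → ℂ} {e : Fin (N + 1) → ℂ} {x t : ℝ} {m : ℂ → Mat2}

/-! ### Identities for `R` and the dressing in each quadrant -/

theorem mat_ext {a b c d a' b' c' d' : ℂ} (h₁ : a = a') (h₂ : b = b') (h₃ : c = c')
    (h₄ : d = d') : (!![a, b; c, d] : Mat2) = !![a', b'; c', d'] := by
  rw [h₁, h₂, h₃, h₄]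

/-- The algebraic identities between the spectral functions and `R`. -/
structure BranchIdentities (L : ℝ) (a b R : ℂ → ℂ) (z : ℂ) : Prop where
  quadratic : expL L z * schwarz b z * R z ^ 2 + (expL L z * schwarz a z - a z) * R z + b z = 0
  quadratic_schwarz : b z * schwarz R z ^ 2 + (a z - expL L z * schwarz a z) * schwarz R z
      + expL L z * schwarz b z = 0
  multiplier : (a z + b z * schwarz R z) * (schwarz a z + schwarz b z * R z) = 1
  det : a z * schwarz a z + b z * schwarz b z = 1

theorem IsBranch.identities (hS : SpectralData L a b) (hR : IsBranch L a b e R) {z : ℂ}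
    (hz : z ∉ cuts e) (hp : ¬ IsPole R z) (hp' : ¬ IsPole (schwarz R) z) :
    BranchIdentities L a b R z :=
  ⟨hR.quadratic hz hp, hR.quadratic_schwarz hz hp', hR.multiplier hS hz hp hp', hS.det z⟩

/-- The trace relation: the eigenvalues `e^{izL}(a* + b*R)` and `e^{-izL}(a + bR*)` multiply to one,
so they are the two roots of the characteristic equation and add up to `Δ`. -/
theorem BranchIdentities.cross {z : ℂ} (h : BranchIdentities L a b R z) :
    expL L z * schwarz b z * R z + b z * schwarz R z = 0 := by
  obtain ⟨h1, -, h3, h4⟩ := h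
  linear_combination (schwarz b z * (a z + b z * schwarz R z)) * h1
    + (a z - expL L z * schwarz b z * R z) * h3 - (a z + b z * schwarz R z) * h4

theorem IsBranch.eventually_identities (hS : SpectralData L a b) (hR : IsBranch L a b e R) :
    ∀ᶠ z in cocompact ℂ, BranchIdentities L a b R z := by
  filter_upwards [hR.eventually_analyticAt_cocompact] with z hz
  exact hR.identities hS hz.1 hz.2.1.not_isPole hz.2.2.not_isPole

theorem expσ₃_neg_eq (w : ℂ) : expσ₃ (-w) = !![Complex.exp (-w), 0; 0, Complex.exp w] := by
  rw [expσ₃, neg_neg]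

theorem dress_Q1 {z : ℂ} (hz : z ∈ Q1) : dress L a b R x t z =
    !![Complex.exp (-phase x t z), -(Complex.exp (-phase x t z) * R z);
      0, Complex.exp (phase x t z)] := by
  have h : (1 : Mat2) + R z • nUp (fun _ => -1) z = !![1, -R z; 0, 1] := by
    ext i j; fin_cases i <;> fin_cases j <;> simp [nUp]
  rw [dress, if_pos hz, dressWith, h, expσ₃_neg_eq, Matrix.mul_one, Matrix.mul_fin_two]
  apply mat_ext <;> ring

theorem dress_Q2 {z : ℂ} (hz : z ∈ Q2) : dress L a b R x t z =
    !![Complex.exp (-phase x t z) * a z, -(Complex.exp (-phase x t z) * b z);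
      Complex.exp (phase x t z) * ((expL L z)⁻¹ * schwarz R z * a z + schwarz b z),
      Complex.exp (phase x t z) * (schwarz a z - (expL L z)⁻¹ * schwarz R z * b z)] := by
  have h : (1 : Mat2) + schwarz R z • nLow (fun z => (expL L z)⁻¹) z =
      !![1, 0; schwarz R z * (expL L z)⁻¹, 1] := by
    ext i j; fin_cases i <;> fin_cases j <;> simp [nLow]
  rw [dress, if_neg (notMem_Q1_of_Q2 hz), if_pos hz, dressWith, h, expσ₃_neg_eq, matSInv,
    Matrix.mul_fin_two, Matrix.mul_fin_two]
  apply mat_ext <;> ring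

theorem dress_Q3 {z : ℂ} (hz : z ∈ Q3) : dress L a b R x t z =
    !![Complex.exp (-phase x t z) * (a z - expL L z * R z * schwarz b z),
      -(Complex.exp (-phase x t z) * (b z + expL L z * R z * schwarz a z));
      Complex.exp (phase x t z) * schwarz b z, Complex.exp (phase x t z) * schwarz a z] := by
  have h : (1 : Mat2) + R z • nUp (fun z => -expL L z) z =
      !![1, -(R z * expL L z); 0, 1] := by
    ext i j; fin_cases i <;> fin_cases j <;> simp [nUp]
  rw [dress, if_neg (notMem_Q1_of_Q3 hz), if_neg (notMem_Q2_of_Q3 hz), if_pos hz, dressWith, h,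
    expσ₃_neg_eq, matSInv, Matrix.mul_fin_two, Matrix.mul_fin_two]
  apply mat_ext <;> ring

theorem dress_Q4 {z : ℂ} (hz : z ∈ Q4) : dress L a b R x t z =
    !![Complex.exp (-phase x t z), 0;
      Complex.exp (phase x t z) * schwarz R z, Complex.exp (phase x t z)] := by
  have h : (1 : Mat2) + schwarz R z • nLow (fun _ => 1) z = !![1, 0; schwarz R z, 1] := by
    ext i j; fin_cases i <;> fin_cases j <;> simp [nLow]
  rw [dress, if_neg (notMem_Q1_of_Q4 hz), if_neg (notMem_Q2_of_Q4 hz), if_neg (notMem_Q3_of_Q4 hz),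
    dressWith, h, expσ₃_neg_eq, Matrix.mul_one, Matrix.mul_fin_two]
  apply mat_ext <;> ring

/-! ### Asymptotics of the entire solution -/

/-- The matrix of Bloch eigenvectors of the monodromy matrix. -/
def blochMat (R : ℂ → ℂ) (z : ℂ) : Mat2 := !![1, R z; -schwarz R z, 1]

open Classical in
/-- The normalisation of the Bloch solutions: trivial in the right half-plane, the Floquet
multipliers in the left half-plane. -/
def blochNorm (a b R : ℂ → ℂ) (z : ℂ) : Mat2 :=
  if 0 < z.re then 1
  else !![a z + b z * schwarz R z, 0; 0, schwarz a z + schwarz b z * R z]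

open Classical in
/-- The matrix relating the solution of the Riemann–Hilbert problem to the normalised Bloch
solutions. -/
def corr (L : ℝ) (R : ℂ → ℂ) (x t : ℝ) (z : ℂ) : Mat2 :=
  if z ∈ Q1 then
    !![1 + R z * schwarz R z, 0; -(schwarz R z * Complex.exp (2 * phase x t z)), 1]
  else if z ∈ Q2 then
    !![1, R z * Complex.exp (-(2 * phase x t z) + 2 * Complex.I * z * L);
      0, 1 + R z * schwarz R z]
  else if z ∈ Q3 then
    !![1 + R z * schwarz R z, 0;
      -(schwarz R z * Complex.exp (2 * phase x t z - 2 * Complex.I * z * L)), 1]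
  else !![1, R z * Complex.exp (-(2 * phase x t z)); 0, 1 + R z * schwarz R z]

/-- In each quadrant the Bloch vectors diagonalise the scattering part of the dressing; the
multipliers appear in the left half-plane, where `s⁻¹` acts. The factor `corr` keeps all
exponentials that have to be bounded. -/
theorem dress_mul_blochMat {z : ℂ} (hre : z.re ≠ 0) (him : z.im ≠ 0)
    (h : BranchIdentities L a b R z) :
    dress L a b R x t z * blochMat R z =
      corr L R x t z * expσ₃ (-phase x t z) * blochNorm a b R z := by
  have hK1 := h.quadratic
  have hK2 := h.quadratic_schwarz
  have hE : expL L z * (expL L z)⁻¹ = 1 := mul_inv_cancel₀ (expL_ne_zero L z)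
  rw [expσ₃_neg_eq]
  have h1 : Complex.exp (2 * phase x t z) * Complex.exp (-phase x t z) =
      Complex.exp (phase x t z) := by rw [← Complex.exp_add]; ring_nf
  have h2 : Complex.exp (-(2 * phase x t z)) * Complex.exp (phase x t z) =
      Complex.exp (-phase x t z) := by rw [← Complex.exp_add]; ring_nf
  rcases mem_quadrant hre him with hq | hq | hq | hq
  · rw [dress_Q1 hq, corr, if_pos hq, blochNorm, if_pos hq.1, blochMat, Matrix.mul_one,
      Matrix.mul_fin_two, Matrix.mul_fin_two]
    apply mat_ext
    · ring
    · ring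
    · linear_combination schwarz R z * h1
    · ring
  · rw [dress_Q2 hq, corr, if_neg (notMem_Q1_of_Q2 hq), if_pos hq, blochNorm, if_neg hq.1.not_gt,
      blochMat, Matrix.mul_fin_two, Matrix.mul_fin_two, Matrix.mul_fin_two]
    have h3 : Complex.exp (-(2 * phase x t z) + 2 * Complex.I * z * L) =
      Complex.exp (-(2 * phase x t z)) * expL L z := by rw [Complex.exp_add, expL]
    rw [h3]
    apply mat_ext
    · ring
    · linear_combination (-Complex.exp (-phase x t z)) * hK1 -
        (expL L z * R z * (schwarz a z + schwarz b z * R z)) * h2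
    · linear_combination (Complex.exp (phase x t z) * (expL L z)⁻¹) * hK2
        + (-(Complex.exp (phase x t z) * schwarz b z) +
          Complex.exp (phase x t z) * schwarz a z * schwarz R z) * hE
    · linear_combination (Complex.exp (phase x t z) * (expL L z)⁻¹ * schwarz R z) * (-hK1)
        + Complex.exp (phase x t z) * (schwarz R z * R z * (schwarz a z + schwarz b z * R z)) * hE
  · rw [dress_Q3 hq, corr, if_neg (notMem_Q1_of_Q3 hq), if_neg (notMem_Q2_of_Q3 hq), if_pos hq,
      blochNorm, if_neg hq.1.not_gt, blochMat, Matrix.mul_fin_two, Matrix.mul_fin_two,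
      Matrix.mul_fin_two]
    have h3 : Complex.exp (2 * phase x t z - 2 * Complex.I * z * L) =
      Complex.exp (2 * phase x t z) * (expL L z)⁻¹ := by
        rw [sub_eq_add_neg, Complex.exp_add, expL, ← Complex.exp_neg]
    rw [h3]
    apply mat_ext
    · linear_combination (-(Complex.exp (-phase x t z) * R z)) * hK2
    · linear_combination (-Complex.exp (-phase x t z)) * hK1
    · linear_combination (Complex.exp (phase x t z) * (expL L z)⁻¹) * hK2
        + (-(Complex.exp (phase x t z) * schwarz b z) +
          Complex.exp (phase x t z) * schwarz a z * schwarz R z) * hE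
        + (schwarz R z * (expL L z)⁻¹ * (a z + b z * schwarz R z)) * h1
    · ring
  · rw [dress_Q4 hq, corr, if_neg (notMem_Q1_of_Q4 hq), if_neg (notMem_Q2_of_Q4 hq),
      if_neg (notMem_Q3_of_Q4 hq), blochNorm, if_pos hq.1, blochMat, Matrix.mul_one,
      Matrix.mul_fin_two, Matrix.mul_fin_two]
    apply mat_ext
    · ring
    · linear_combination (-R z) * h2
    · ring
    · ring

theorem norm_exp_le_one {w : ℂ} (h : w.re ≤ 0) : ‖Complex.exp w‖ ≤ 1 := by
  rw [Complex.norm_exp]; exact Real.exp_le_one_iff.2 h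

theorem phase_re (x t : ℝ) (z : ℂ) : (phase x t z).re = -(z.im * x) - 4 * (z.re * z.im) * t := by
  simp [phase, pow_two]; ring

/-- The sign of `Re z · Im z` in each quadrant together with `t ≥ 0` and `0 ≤ x ≤ L` makes every
exponent have nonpositive real part. The right quadrants use `0 ≤ x`, the left ones `x ≤ L`. -/
theorem norm_corr_sub_one_le (hx : x ∈ Set.Icc 0 L) (ht : 0 ≤ t) {z : ℂ} (hre : z.re ≠ 0)
    (him : z.im ≠ 0) (i j : Fin 2) :
    ‖(corr L R x t z - 1) i j‖ ≤ ‖R z‖ + ‖schwarz R z‖ + ‖R z‖ * ‖schwarz R z‖ := by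
  have hR := norm_nonneg (R z)
  have hR' := norm_nonneg (schwarz R z)
  have hRR := mul_nonneg hR hR'
  have key1 : ∀ w : ℂ, w.re ≤ 0 → ‖R z * Complex.exp w‖ ≤
      ‖R z‖ + ‖schwarz R z‖ + ‖R z‖ * ‖schwarz R z‖ := fun w hw => by
    rw [norm_mul]
    have := mul_le_mul_of_nonneg_left (norm_exp_le_one hw) hR
    linarith
  have key2 : ∀ w : ℂ, w.re ≤ 0 → ‖-(schwarz R z * Complex.exp w)‖ ≤
      ‖R z‖ + ‖schwarz R z‖ + ‖R z‖ * ‖schwarz R z‖ := fun w hw => by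
    rw [norm_neg, norm_mul]
    have := mul_le_mul_of_nonneg_left (norm_exp_le_one hw) hR'
    linarith
  have key3 : ‖1 + R z * schwarz R z - 1‖ ≤
      ‖R z‖ + ‖schwarz R z‖ + ‖R z‖ * ‖schwarz R z‖ := by
    rw [add_sub_cancel_left, norm_mul]; linarith
  have hlin : (2 * Complex.I * z * L).re = -(2 * z.im * L) := by simp
  have h2 : (2 * phase x t z).re = 2 * (phase x t z).re := by simp
  have h0 : (0 : ℝ) ≤ ‖R z‖ + ‖schwarz R z‖ + ‖R z‖ * ‖schwarz R z‖ := by positivity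
  obtain ⟨hx0, hxL⟩ := hx
  rcases mem_quadrant hre him with hq | hq | hq | hq
  · have hw : (2 * phase x t z).re ≤ 0 := by
      rw [h2, phase_re]
      have h3 := mul_nonneg hq.2.le hx0
      have h4 := mul_nonneg (mul_pos hq.1 hq.2).le ht
      linarith
    rw [corr, if_pos hq]
    fin_cases i <;> fin_cases j <;> simp only [Matrix.sub_apply, Matrix.of_apply, Fin.zero_eta,
      Fin.mk_one, Matrix.cons_val_zero, Matrix.cons_val_one, Matrix.one_apply_eq, Ne,
      zero_ne_one, one_ne_zero, not_false_eq_true, Matrix.one_apply_ne, sub_zero, sub_self,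
      norm_zero, h0, key2 _ hw, key3]
  · have hw : (-(2 * phase x t z) + 2 * Complex.I * z * L).re ≤ 0 := by
      rw [Complex.add_re, Complex.neg_re, h2, phase_re, hlin]
      have h3 := mul_nonneg hq.2.le (sub_nonneg.2 hxL)
      have h4 := mul_nonneg (mul_pos_of_neg_of_neg hq.1 (neg_neg_of_pos hq.2)).le ht
      linarith
    rw [corr, if_neg (notMem_Q1_of_Q2 hq), if_pos hq]
    fin_cases i <;> fin_cases j <;> simp only [Matrix.sub_apply, Matrix.of_apply, Fin.zero_eta,
      Fin.mk_one, Matrix.cons_val_zero, Matrix.cons_val_one, Matrix.one_apply_eq, Ne,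
      zero_ne_one, one_ne_zero, not_false_eq_true, Matrix.one_apply_ne, sub_zero, sub_self,
      norm_zero, h0, key1 _ hw, key3]
  · have hw : (2 * phase x t z - 2 * Complex.I * z * L).re ≤ 0 := by
      rw [Complex.sub_re, h2, phase_re, hlin]
      have h3 := mul_nonneg (neg_nonneg.2 hq.2.le) (sub_nonneg.2 hxL)
      have h4 := mul_nonneg (mul_pos_of_neg_of_neg hq.1 hq.2).le ht
      linarith
    rw [corr, if_neg (notMem_Q1_of_Q3 hq), if_neg (notMem_Q2_of_Q3 hq), if_pos hq]
    fin_cases i <;> fin_cases j <;> simp only [Matrix.sub_apply, Matrix.of_apply, Fin.zero_eta,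
      Fin.mk_one, Matrix.cons_val_zero, Matrix.cons_val_one, Matrix.one_apply_eq, Ne,
      zero_ne_one, one_ne_zero, not_false_eq_true, Matrix.one_apply_ne, sub_zero, sub_self,
      norm_zero, h0, key2 _ hw, key3]
  · have hw : (-(2 * phase x t z)).re ≤ 0 := by
      rw [Complex.neg_re, h2, phase_re]
      have h3 := mul_nonneg (neg_nonneg.2 hq.2.le) hx0
      have h4 := mul_nonneg (mul_pos hq.1 (neg_pos.2 hq.2)).le ht
      linarith
    rw [corr, if_neg (notMem_Q1_of_Q4 hq), if_neg (notMem_Q2_of_Q4 hq),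
      if_neg (notMem_Q3_of_Q4 hq)]
    fin_cases i <;> fin_cases j <;> simp only [Matrix.sub_apply, Matrix.of_apply, Fin.zero_eta,
      Fin.mk_one, Matrix.cons_val_zero, Matrix.cons_val_one, Matrix.one_apply_eq, Ne,
      zero_ne_one, one_ne_zero, not_false_eq_true, Matrix.one_apply_ne, sub_zero, sub_self,
      norm_zero, h0, key1 _ hw, key3]

theorem tendsto_corr (hR : IsBranch L a b e R) (hx : x ∈ Set.Icc 0 L) (ht : 0 ≤ t) :
    Tendsto (corr L R x t) (cocompact ℂ ⊓ 𝓟 (contour e)ᶜ) (𝓝 1) := by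
  have h1 : Tendsto (fun z => ‖R z‖ + ‖schwarz R z‖ + ‖R z‖ * ‖schwarz R z‖)
      (cocompact ℂ ⊓ 𝓟 (contour e)ᶜ) (𝓝 0) := by
    have := (hR.decay.norm.add hR.decay_schwarz.norm).add
      (hR.decay.norm.mul hR.decay_schwarz.norm)
    simp only [norm_zero, mul_zero, add_zero] at this
    exact this.mono_left inf_le_left
  refine tendsto_matrix fun i j => ?_
  rw [tendsto_iff_norm_sub_tendsto_zero]
  refine squeeze_zero' (Eventually.of_forall fun _ => norm_nonneg _) ?_ h1
  filter_upwards [mem_inf_of_right (mem_principal_self _)] with z hz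
  exact norm_corr_sub_one_le hx ht (fun h => hz (Or.inl (Or.inr h)))
    (fun h => hz (Or.inl (Or.inl h))) i j

/-- The entire solution associated with the Riemann–Hilbert problem, together with its
asymptotics at infinity. -/
theorem exists_entire_asymptotics (hS : SpectralData L a b) (he : IsMainSpectrum L a e)
    (hR : IsBranch L a b e R) (hm : IsRHSolution L a b e R x t m) (hx : x ∈ Set.Icc 0 L)
    (ht : 0 ≤ t) :
    ∃ F A : ℂ → Mat2, (∀ i j, Differentiable ℂ fun z => F z i j) ∧
      (∀ z ∈ regSet e R, F z = m z * dress L a b R x t z) ∧ (∀ z, (F z).det = 1) ∧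
      Tendsto A (cocompact ℂ ⊓ 𝓟 (contour e)ᶜ) (𝓝 1) ∧
      (∀ᶠ z in cocompact ℂ ⊓ 𝓟 (contour e)ᶜ,
        F z * blochMat R z = A z * expσ₃ (-phase x t z) * blochNorm a b R z) ∧
      ∀ z ∈ Q1, A z 0 1 = m z 0 1 := by
  obtain ⟨F, hF1, hF2, hF3⟩ := exists_entire hS he hR hm
  refine ⟨F, fun z => m z * corr L R x t z, hF1, hF2, hF3, ?_, ?_, ?_⟩
  · have := hm.normalized.mul (tendsto_corr hR hx ht)
    rwa [one_mul] at this
  · filter_upwards [hR.eventually_regSet, mem_inf_of_left (hR.eventually_identities hS)]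
      with z h1 h2
    obtain ⟨h3, h4, -⟩ := off_axes_of_mem_regSet h1
    rw [hF2 z h1, Matrix.mul_assoc, dress_mul_blochMat h3 h4 h2]
    simp only [Matrix.mul_assoc]
  · intro z hz
    change (m z * corr L R x t z) 0 1 = _
    rw [corr, if_pos hz]
    simp [Matrix.mul_apply, Fin.sum_univ_two]

/-! ### The Floquet multipliers at infinity -/

theorem SpectralData.norm_le_one (hS : SpectralData L a b) {z : ℂ} (hz : 0 ≤ z.im) :
    ‖a z‖ ≤ 1 ∧ ‖b z‖ ≤ 1 := by
  have h := hS.bound_upper z hz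
  constructor <;> nlinarith [norm_nonneg (a z), norm_nonneg (b z)]

/-- `a + bR*` is bounded by the half-plane bounds on `a`, `b` and the decay of `R*`. High up, `a` is
near `1` and `a* + b*R` is the inverse of a quantity bounded below; in the remaining strip the
exponential bound on `a*`, `b*` is a constant. -/
theorem exists_bound_multiplier_upper (hL : 0 ≤ L) (hS : SpectralData L a b)
    (hR : IsBranch L a b e R) : ∃ C, ∀ᶠ z in cocompact ℂ, 0 ≤ z.im →
      ‖a z + b z * schwarz R z‖ ≤ C ∧ ‖schwarz a z + schwarz b z * R z‖ ≤ C := by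
  obtain ⟨K, hK⟩ := hS.tendsto_one (1 / 2) (by norm_num)
  refine ⟨max 4 (2 * Real.exp (2 * |K| * L)), ?_⟩
  have e1 := hR.decay.norm.eventually (gt_mem_nhds (by simp : ‖(0 : ℂ)‖ < 1 / 4))
  have e2 := hR.decay_schwarz.norm.eventually (gt_mem_nhds (by simp : ‖(0 : ℂ)‖ < 1 / 4))
  filter_upwards [e1, e2, hR.eventually_identities hS] with z h1 h2 h3 hz
  obtain ⟨ha, hb⟩ := hS.norm_le_one hz
  have hbR : ‖b z * schwarz R z‖ ≤ 1 / 4 := by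
    rw [norm_mul]
    nlinarith [norm_nonneg (b z), norm_nonneg (schwarz R z)]
  refine ⟨le_max_of_le_left ((norm_add_le _ _).trans (by linarith)), ?_⟩
  rcases lt_or_ge K z.im with hKz | hKz
  · refine le_max_of_le_left ?_
    have h4 := hK z hKz
    have h5 : (1 : ℝ) / 4 ≤ ‖a z + b z * schwarz R z‖ := by
      have h6 : (1 : ℂ) = (a z + b z * schwarz R z) - (a z - 1) - b z * schwarz R z := by ring
      have h7 := norm_sub_le ((a z + b z * schwarz R z) - (a z - 1)) (b z * schwarz R z)
      have h8 := norm_sub_le (a z + b z * schwarz R z) (a z - 1)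
      rw [← h6, norm_one] at h7
      linarith
    have h6 := congrArg norm h3.multiplier
    rw [norm_mul, norm_one] at h6
    nlinarith [norm_nonneg (schwarz a z + schwarz b z * R z)]
  · refine le_max_of_le_right ?_
    have h4 := hS.bound_lower ((starRingEnd ℂ) z) (by simpa using hz)
    have h5 : Real.exp (-(4 * ((starRingEnd ℂ) z).im * L)) ≤ Real.exp (2 * |K| * L) ^ 2 := by
      rw [← Real.exp_nat_mul]
      apply Real.exp_le_exp.2
      have : z.im * L ≤ |K| * L := mul_le_mul_of_nonneg_right (hKz.trans (le_abs_self K)) hL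
      simp only [Complex.conj_im]; push_cast; linarith
    have hpos := Real.exp_pos (2 * |K| * L)
    have ha' : ‖schwarz a z‖ ≤ Real.exp (2 * |K| * L) := by
      simp only [schwarz, RCLike.norm_conj]
      refine abs_le_of_sq_le_sq' (a := ‖a ((starRingEnd ℂ) z)‖) ?_ hpos.le |>.2
      nlinarith [sq_nonneg ‖b ((starRingEnd ℂ) z)‖]
    have hb' : ‖schwarz b z‖ ≤ Real.exp (2 * |K| * L) := by
      simp only [schwarz, RCLike.norm_conj]
      refine abs_le_of_sq_le_sq' (a := ‖b ((starRingEnd ℂ) z)‖) ?_ hpos.le |>.2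
      nlinarith [sq_nonneg ‖a ((starRingEnd ℂ) z)‖]
    have h6 : ‖schwarz b z * R z‖ ≤ Real.exp (2 * |K| * L) := by
      rw [norm_mul]
      nlinarith [norm_nonneg (schwarz b z), norm_nonneg (R z)]
    exact (norm_add_le _ _).trans (by linarith)

theorem schwarz_multiplier (a b R : ℂ → ℂ) (z : ℂ) :
    (starRingEnd ℂ) (a ((starRingEnd ℂ) z) + b ((starRingEnd ℂ) z) *
      schwarz R ((starRingEnd ℂ) z)) = schwarz a z + schwarz b z * R z := by
  simp [schwarz]

theorem exists_bound_multiplier (hL : 0 ≤ L) (hS : SpectralData L a b)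
    (hR : IsBranch L a b e R) : ∃ C, ∀ᶠ z in cocompact ℂ,
      ‖a z + b z * schwarz R z‖ ≤ C ∧ ‖schwarz a z + schwarz b z * R z‖ ≤ C := by
  obtain ⟨C, hC⟩ := exists_bound_multiplier_upper hL hS hR
  have hconj : Tendsto (starRingEnd ℂ) (cocompact ℂ) (cocompact ℂ) :=
    (Complex.conjCLE.toHomeomorph.isClosedEmbedding).tendsto_cocompact
  refine ⟨C, ?_⟩
  filter_upwards [hC, hconj.eventually hC] with z h1 h2
  rcases le_total 0 z.im with h | h
  · exact h1 h
  · obtain ⟨h3, h4⟩ := h2 (by simpa using h)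
    rw [← schwarz_multiplier, RCLike.norm_conj]
    refine ⟨?_, h3⟩
    rw [← schwarz_multiplier, RCLike.norm_conj, Complex.conj_conj] at h4
    exact h4

/-- Only along directions with `Im z → ∞` is `a → 1` available. The second limit comes from the
inverse relation, since `a*` itself is not bounded up there by the estimates at hand. -/
theorem tendsto_multiplier (hS : SpectralData L a b) (hR : IsBranch L a b e R) {l : Filter ℂ}
    (hl : l ≤ cocompact ℂ) (him : Tendsto Complex.im l atTop) :
    Tendsto (fun z => a z + b z * schwarz R z) l (𝓝 1) ∧
      Tendsto (fun z => schwarz a z + schwarz b z * R z) l (𝓝 1) := by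
  have h1 : Tendsto a l (𝓝 1) := by
    rw [Metric.tendsto_nhds]
    intro δ hδ
    obtain ⟨K, hK⟩ := hS.tendsto_one δ hδ
    filter_upwards [him.eventually_gt_atTop K] with z hz
    rw [dist_eq_norm]; exact hK z hz
  have h2 : Tendsto (fun z => b z * schwarz R z) l (𝓝 0) := by
    refine squeeze_zero_norm' (a := fun z => ‖schwarz R z‖) ?_
      (by simpa using (hR.decay_schwarz.mono_left hl).norm)
    filter_upwards [him.eventually_ge_atTop 0] with z hz
    rw [norm_mul]
    nlinarith [(hS.norm_le_one hz).2, norm_nonneg (schwarz R z)]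
  have h3 := h1.add h2
  rw [add_zero] at h3
  refine ⟨h3, ?_⟩
  have h4 := h3.inv₀ one_ne_zero
  rw [inv_one] at h4
  refine h4.congr' ?_
  filter_upwards [hl (hR.eventually_identities hS)] with z hz
  exact inv_eq_of_mul_eq_one_right hz.multiplier

end

end

end PeriodicNLS

namespace PeriodicNLS

noncomputable section

section

variable {N : ℕ} {L : ℝ} {a b R : ℂ → ℂ} {e : Fin (N + 1) → ℂ} {x t : ℝ} {m : ℂ → Mat2}

/-! ### Equality of the transformed solutions at the end points -/

/-- The transition matrix over the period. -/
def monodromy (L : ℝ) (a b : ℂ → ℂ) (z : ℂ) : Mat2 :=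
  matS a b z * expσ₃ (Complex.I * z * L)

theorem monodromy_eq (L : ℝ) (a b : ℂ → ℂ) (z : ℂ) : monodromy L a b z =
    !![schwarz a z * Complex.exp (Complex.I * z * L), b z * Complex.exp (-(Complex.I * z * L));
      -schwarz b z * Complex.exp (Complex.I * z * L),
      a z * Complex.exp (-(Complex.I * z * L))] := by
  rw [monodromy, matS, expσ₃, Matrix.mul_fin_two]
  apply mat_ext <;> ring

theorem exp_mul_exp_neg (w : ℂ) : Complex.exp w * Complex.exp (-w) = 1 := by
  rw [← Complex.exp_add, add_neg_cancel, Complex.exp_zero]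

/-- The columns of `blochMat` are eigenvectors by the quadratics for `R` and `R*`; the trace
relation `cross` matches the eigenvalues. -/
theorem monodromy_mul_blochMat {z : ℂ} (h : BranchIdentities L a b R z) :
    monodromy L a b z * blochMat R z = blochMat R z *
      !![Complex.exp (Complex.I * z * L) * (schwarz a z + schwarz b z * R z), 0;
        0, Complex.exp (-(Complex.I * z * L)) * (a z + b z * schwarz R z)] := by
  have h1 := h.quadratic
  have h2 := h.quadratic_schwarz
  have h3 := h.cross
  have h4 := exp_mul_exp_neg (Complex.I * z * L)
  rw [exp_half_sq] at h1 h2 h3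
  rw [monodromy_eq, blochMat, Matrix.mul_fin_two, Matrix.mul_fin_two]
  set u := Complex.exp (Complex.I * z * L)
  set v := Complex.exp (-(Complex.I * z * L))
  apply mat_ext
  · linear_combination (-v) * h3 + (u * schwarz b z * R z) * h4
  · linear_combination v * h1 - (u * schwarz b z * R z ^ 2 + u * schwarz a z * R z) * h4
      - v * R z * h3 + (u * schwarz b z * R z ^ 2) * h4
  · linear_combination (-v) * h2 - (u * schwarz a z * schwarz R z - u * schwarz b z) * h4
      + (v * schwarz R z) * h3 - (u * schwarz b z * R z * schwarz R z) * h4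
  · linear_combination (-v) * h3 + (u * schwarz b z * R z) * h4

theorem phase_zero (t : ℝ) (z : ℂ) : phase 0 t z = 2 * Complex.I * z ^ 2 * t := by
  simp [phase]

theorem phase_end (L t : ℝ) (z : ℂ) :
    phase L t z = phase 0 t z + Complex.I * z * L := by
  simp [phase]; ring

theorem blochMat_det (R : ℂ → ℂ) (z : ℂ) : (blochMat R z).det = 1 + R z * schwarz R z := by
  rw [blochMat, Matrix.det_fin_two_of]; ring

theorem blochNorm_det {z : ℂ} (h : BranchIdentities L a b R z) : (blochNorm a b R z).det = 1 := by
  rw [blochNorm]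
  split_ifs
  · exact Matrix.det_one
  · rw [Matrix.det_fin_two_of]; linear_combination h.multiplier

theorem expσ₃_det (w : ℂ) : (expσ₃ w).det = 1 := by
  rw [expσ₃, Matrix.det_fin_two_of]; linear_combination exp_mul_exp_neg w

/-- The entries of `f` are bounded along `l`. -/
def MBounded (f : ℂ → Mat2) (l : Filter ℂ) : Prop :=
  ∀ i j, (fun z => f z i j) =O[l] fun _ => (1 : ℝ)

theorem MBounded.mul {f g : ℂ → Mat2} {l : Filter ℂ} (hf : MBounded f l) (hg : MBounded g l) :
    MBounded (fun z => f z * g z) l := fun i j => by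
  simp only [Matrix.mul_apply, Fin.sum_univ_two]
  simpa using ((hf i 0).mul (hg 0 j)).add ((hf i 1).mul (hg 1 j))

theorem mBounded_of_tendsto {f : ℂ → Mat2} {l : Filter ℂ} {A : Mat2} (h : Tendsto f l (𝓝 A)) :
    MBounded f l := fun i j => (tendsto_entry h i j).isBigO_one ℝ

theorem tendsto_inv_matrix {f : ℂ → Mat2} {l : Filter ℂ} (h : Tendsto f l (𝓝 1)) :
    Tendsto (fun z => (f z)⁻¹) l (𝓝 1) ∧ ∀ᶠ z in l, f z * (f z)⁻¹ = 1 := by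
  have h1 : Tendsto (fun z => (f z).det) l (𝓝 1) := by
    have := ((continuous_id.matrix_det).tendsto (1 : Mat2)).comp h
    rwa [id, Matrix.det_one] at this
  have h2 : Tendsto (fun z => (f z).adjugate) l (𝓝 1) := by
    have := ((continuous_id.matrix_adjugate).tendsto (1 : Mat2)).comp h
    rwa [id, Matrix.adjugate_one] at this
  constructor
  · have h3 := (h1.inv₀ one_ne_zero).smul h2
    rw [inv_one, one_smul] at h3
    exact h3.congr fun z => by rw [Matrix.inv_def, Ring.inverse_eq_inv']
  · filter_upwards [h1.eventually_ne one_ne_zero] with z hz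
    exact Matrix.mul_nonsing_inv _ (isUnit_iff_ne_zero.2 hz)

theorem differentiable_mul_entry {f g : ℂ → Mat2} (hf : ∀ i j, Differentiable ℂ fun z => f z i j)
    (hg : ∀ i j, Differentiable ℂ fun z => g z i j) (i j : Fin 2) :
    Differentiable ℂ fun z => (f z * g z) i j := by
  simp only [Matrix.mul_apply, Fin.sum_univ_two]
  exact ((hf i 0).mul (hg 0 j)).add ((hf i 1).mul (hg 1 j))

theorem differentiable_adjugate_entry {f : ℂ → Mat2}
    (hf : ∀ i j, Differentiable ℂ fun z => f z i j) (i j : Fin 2) :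
    Differentiable ℂ fun z => (f z).adjugate i j := by
  simp only [Matrix.adjugate_fin_two]
  fin_cases i <;> fin_cases j
  · simpa using hf 1 1
  · simpa using (hf 0 1).neg
  · simpa using (hf 1 0).neg
  · simpa using hf 0 0

theorem SpectralData.differentiable_monodromy (hS : SpectralData L a b) (i j : Fin 2) :
    Differentiable ℂ fun z => monodromy L a b z i j := by
  have ha := hS.diff_a
  have hb := hS.diff_b
  have ha' := ha.schwarz
  have hb' := hb.schwarz
  simp only [monodromy_eq]
  fin_cases i <;> fin_cases j <;> simp <;> fun_prop

/-- A matrix Liouville theorem. -/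
theorem eq_one_of_bounded {Y : ℂ → Mat2} {S : Set ℂ} (hS : Dense S)
    (hY : ∀ i j, Differentiable ℂ fun z => Y z i j) (hb : MBounded Y (cocompact ℂ ⊓ 𝓟 S))
    {l : Filter ℂ} [l.NeBot] (h : Tendsto Y l (𝓝 1)) (z : ℂ) : Y z = 1 := by
  have hc : ∀ w, Y w = Y z := fun w => by
    ext i j
    obtain ⟨C, hC⟩ := (hb i j).bound
    exact eq_const_of_eventually_bounded (hY i j) hS (C := C) (by simpa using hC) w z
  exact tendsto_nhds_unique (tendsto_const_nhds.congr fun w => (hc w).symm) h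

/-- Uniqueness for the dressed problem over one period. Both sides have the same Bloch exponential
at infinity, because advancing by `L` is compensated by the eigenvalues of the monodromy matrix.
Boundedness in all directions and the limit along one ray identify the constant quotient. -/
theorem entire_eq_mul_monodromy (hL : 0 ≤ L) (hS : SpectralData L a b) (he : IsMainSpectrum L a e)
    (hR : IsBranch L a b e R) {F₀ F₁ A₀ A₁ : ℂ → Mat2}
    (hF₀ : ∀ i j, Differentiable ℂ fun z => F₀ z i j)
    (hF₁ : ∀ i j, Differentiable ℂ fun z => F₁ z i j) (hdet : ∀ z, (F₀ z).det = 1)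
    (hA₀ : Tendsto A₀ (cocompact ℂ ⊓ 𝓟 (contour e)ᶜ) (𝓝 1))
    (hA₁ : Tendsto A₁ (cocompact ℂ ⊓ 𝓟 (contour e)ᶜ) (𝓝 1))
    (h₀ : ∀ᶠ z in cocompact ℂ ⊓ 𝓟 (contour e)ᶜ,
      F₀ z * blochMat R z = A₀ z * expσ₃ (-phase 0 t z) * blochNorm a b R z)
    (h₁ : ∀ᶠ z in cocompact ℂ ⊓ 𝓟 (contour e)ᶜ,
      F₁ z * blochMat R z = A₁ z * expσ₃ (-phase L t z) * blochNorm a b R z) (z : ℂ) :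
    F₀ z = F₁ z * monodromy L a b z := by
  set l := cocompact ℂ ⊓ 𝓟 (contour e)ᶜ with hl
  set Y : ℂ → Mat2 := fun z => F₁ z * monodromy L a b z * (F₀ z).adjugate with hY
  set D : ℂ → Mat2 := fun z =>
    !![schwarz a z + schwarz b z * R z, 0; 0, a z + b z * schwarz R z] with hD
  have hYF : ∀ z, Y z * F₀ z = F₁ z * monodromy L a b z := fun z => by
    simp only [hY]
    rw [Matrix.mul_assoc, Matrix.adjugate_mul, hdet, one_smul, Matrix.mul_one]
  obtain ⟨hB, hB'⟩ := tendsto_inv_matrix hA₀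
  -- The exponentials of the monodromy eigenvalues turn the phase at `L` into the phase at `0`; only
  -- the multipliers remain, in the diagonal matrix `D`.
  have hYeq : ∀ᶠ z in l, Y z = A₁ z * D z * (A₀ z)⁻¹ := by
    filter_upwards [h₀, h₁, hB', mem_inf_of_left (hR.eventually_identities hS)]
      with z h0 h1 h2 h3
    have h4 : Y z * A₀ z * (expσ₃ (-phase 0 t z) * blochNorm a b R z) =
        A₁ z * D z * (expσ₃ (-phase 0 t z) * blochNorm a b R z) := by
      calc _ = Y z * (F₀ z * blochMat R z) := by rw [h0]; simp only [Matrix.mul_assoc]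
        _ = F₁ z * (monodromy L a b z * blochMat R z) := by
          rw [← Matrix.mul_assoc, hYF, Matrix.mul_assoc]
        _ = F₁ z * blochMat R z *
          !![Complex.exp (Complex.I * z * L) * (schwarz a z + schwarz b z * R z), 0;
            0, Complex.exp (-(Complex.I * z * L)) * (a z + b z * schwarz R z)] := by
          rw [monodromy_mul_blochMat h3, Matrix.mul_assoc]
        _ = A₁ z * (D z * (expσ₃ (-phase 0 t z) * blochNorm a b R z)) := by
          rw [h1, Matrix.mul_assoc, Matrix.mul_assoc]
          congr 1
          rw [phase_end L, neg_add, ← expσ₃_mul, expσ₃_neg_eq, expσ₃_neg_eq]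
          have h5 := exp_mul_exp_neg (Complex.I * z * L)
          simp only [hD, blochNorm]
          split_ifs
          · simp only [Matrix.one_mul, Matrix.mul_one, Matrix.mul_fin_two]
            apply mat_ext
            · linear_combination (Complex.exp (-phase 0 t z) *
                (schwarz a z + schwarz b z * R z)) * h5
            · ring
            · ring
            · linear_combination (Complex.exp (phase 0 t z) *
                (a z + b z * schwarz R z)) * h5
          · simp only [Matrix.mul_fin_two]
            apply mat_ext
            · linear_combination (Complex.exp (-phase 0 t z) * (a z + b z * schwarz R z) *
                (schwarz a z + schwarz b z * R z)) * h5
            · ring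
            · ring
            · linear_combination (Complex.exp (phase 0 t z) *
                (schwarz a z + schwarz b z * R z) * (a z + b z * schwarz R z)) * h5
        _ = _ := by simp only [Matrix.mul_assoc]
    have h5 : IsUnit (expσ₃ (-phase 0 t z) * blochNorm a b R z).det := by
      rw [Matrix.det_mul, expσ₃_det, blochNorm_det h3, one_mul]; exact isUnit_one
    have h6 : Y z * A₀ z = A₁ z * D z := by
      rw [← Matrix.mul_nonsing_inv_cancel_right _ (Y z * A₀ z) h5, h4,
        Matrix.mul_nonsing_inv_cancel_right _ _ h5]
    rw [← h6, Matrix.mul_assoc, h2, Matrix.mul_one]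
  have hdc : Dense (contour e)ᶜ := (dense_regSet hS he hR).mono
    fun z hz => (off_axes_of_mem_regSet hz).2.2.2.2
  have hYd : ∀ i j, Differentiable ℂ fun z => Y z i j :=
    differentiable_mul_entry (differentiable_mul_entry hF₁ hS.differentiable_monodromy)
      (differentiable_adjugate_entry hF₀)
  have hDb : MBounded D l := by
    obtain ⟨C, hC⟩ := exists_bound_multiplier hL hS hR
    have h1 : (fun z => schwarz a z + schwarz b z * R z) =O[l] fun _ => (1 : ℝ) :=
      IsBigO.of_bound C (by
        filter_upwards [mem_inf_of_left hC] with z hz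
        simpa using hz.2)
    have h2 : (fun z => a z + b z * schwarz R z) =O[l] fun _ => (1 : ℝ) :=
      IsBigO.of_bound C (by
        filter_upwards [mem_inf_of_left hC] with z hz
        simpa using hz.1)
    intro i j
    fin_cases i <;> fin_cases j
    · exact h1
    · exact isBigO_zero _ _
    · exact isBigO_zero _ _
    · exact h2
  have hYb : MBounded Y l := fun i j =>
    (((mBounded_of_tendsto hA₁).mul hDb).mul (mBounded_of_tendsto hB) i j).congr'
      (by filter_upwards [hYeq] with z hz; rw [hz]) EventuallyEq.rfl
  -- `D` is known to tend to `1` only as `Im z → ∞`, so the value of the constant is read off along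
  -- the diagonal ray.
  set l' : Filter ℂ := Filter.map (fun s : ℝ => (s : ℂ) * (1 + Complex.I)) atTop with hl'
  have hl'l : l' ≤ l := (eventually_diagonal e).mono_right
    (inf_le_inf_left _ (principal_mono.2 Set.inter_subset_left))
  have him : Tendsto Complex.im l' atTop := by
    rw [hl', tendsto_map'_iff]
    exact tendsto_id.congr fun s => by simp
  obtain ⟨h2, h3⟩ := tendsto_multiplier hS hR (hl'l.trans inf_le_left) him
  have hD1 : Tendsto D l' (𝓝 1) := by
    refine tendsto_matrix fun i j => ?_
    fin_cases i <;> fin_cases j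
    · simpa [hD] using h3
    · simp [hD]
    · simp [hD]
    · simpa [hD] using h2
  have hY1 : Tendsto Y l' (𝓝 1) := by
    have h4 := ((hA₁.mono_left hl'l).mul hD1).mul (hB.mono_left hl'l)
    rw [one_mul, one_mul] at h4
    refine h4.congr' ?_
    filter_upwards [hl'l hYeq] with z hz using hz.symm
  rw [← hYF, eq_one_of_bounded hdc hYd hYb hY1 z, Matrix.one_mul]

/-! ### The quadrant algebra -/

theorem exp_two_mul (w : ℂ) : Complex.exp (2 * w) = Complex.exp w ^ 2 := by
  rw [← Complex.exp_nat_mul]; norm_num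

/-- In the right half-plane the dressing contains no `s⁻¹`, so the monodromy matrix must be absorbed
by `matPhat`; the quadratics and the trace relation do this. -/
theorem matPhat_mul_dress {z : ℂ} (hz : 0 < z.re) (him : z.im ≠ 0)
    (h : BranchIdentities L a b R z) :
    matPhat L a b R t z * dress L a b R 0 t z =
      dress L a b R L t z * monodromy L a b z := by
  have h1 := h.quadratic
  have h2 := h.quadratic_schwarz
  have h3 := h.cross
  have h4 := exp_mul_exp_neg (Complex.I * z * L)
  have h5 := exp_mul_exp_neg (phase 0 t z)
  have hE' : Complex.exp (2 * Complex.I * z * L) = Complex.exp (Complex.I * z * L) ^ 2 := by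
    rw [← exp_two_mul]; ring_nf
  have hEi : Complex.exp (-(2 * Complex.I * z * L)) = Complex.exp (-(Complex.I * z * L)) ^ 2 := by
    rw [← exp_two_mul]; ring_nf
  have hP : Complex.exp (4 * Complex.I * z ^ 2 * t) = Complex.exp (phase 0 t z) ^ 2 := by
    rw [← exp_two_mul, phase_zero]; ring_nf
  have hPi : Complex.exp (-(4 * Complex.I * z ^ 2 * t)) = Complex.exp (-phase 0 t z) ^ 2 := by
    rw [← exp_two_mul, phase_zero]; ring_nf
  rw [exp_half_sq] at h1 h2 h3
  rcases him.lt_or_gt with hi | hi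
  · have hq : z ∈ Q4 := ⟨hz, hi⟩
    rw [matPhat, if_neg (notMem_Q1_of_Q4 hq), if_pos hq, dress_Q4 hq, dress_Q4 hq, monodromy_eq,
      phase_end L, neg_add, Complex.exp_add, Complex.exp_add, hEi, hPi, Matrix.mul_fin_two,
      Matrix.mul_fin_two]
    set u := Complex.exp (Complex.I * z * L)
    set v := Complex.exp (-(Complex.I * z * L))
    set p := Complex.exp (phase 0 t z)
    set p' := Complex.exp (-phase 0 t z)
    apply mat_ext
    · linear_combination (b z * v ^ 2 * p' * schwarz R z) * h5 - p' * schwarz a z * h4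
        + p' * v ^ 2 * h3 - p' * schwarz b z * R z * (u * v + 1) * h4
    · linear_combination (b z * v ^ 2 * p') * h5
    · linear_combination p * h2
    · linear_combination (-(a z + b z * schwarz R z) * p) * h4
  · have hq : z ∈ Q1 := ⟨hz, hi⟩
    rw [matPhat, if_pos hq, dress_Q1 hq, dress_Q1 hq, monodromy_eq,
      phase_end L, neg_add, Complex.exp_add, Complex.exp_add, hE', hP, Matrix.mul_fin_two,
      Matrix.mul_fin_two]
    set u := Complex.exp (Complex.I * z * L)
    set v := Complex.exp (-(Complex.I * z * L))
    set p := Complex.exp (phase 0 t z)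
    set p' := Complex.exp (-phase 0 t z)
    apply mat_ext
    · linear_combination (-(schwarz a z + schwarz b z * R z) * p') * h4
    · linear_combination -p' * v ^ 2 * h1 +
        p' * R z * (schwarz a z + schwarz b z * R z) * (u * v + 1) * h4
    · linear_combination (-schwarz b z * u ^ 2 * p) * h5
    · linear_combination (schwarz b z * u ^ 2 * p * R z) * h5 - p * a z * h4 + p * h3

theorem dress_mul_monodromy {z : ℂ} (hz : z.re < 0) (him : z.im ≠ 0)
    (h : BranchIdentities L a b R z) :
    dress L a b R 0 t z =
      matP a b R t z * (dress L a b R L t z * monodromy L a b z) := by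
  have h1 := h.quadratic
  have h2 := h.quadratic_schwarz
  have h3 := h.cross
  have hd := h.det
  have h4 := exp_mul_exp_neg (Complex.I * z * L)
  have h5 := exp_mul_exp_neg (phase 0 t z)
  have hEi : (expL L z)⁻¹ = Complex.exp (-(Complex.I * z * L)) ^ 2 := by
    rw [exp_half_sq, Complex.exp_neg, inv_pow]
  have hP : Complex.exp (4 * Complex.I * z ^ 2 * t) = Complex.exp (phase 0 t z) ^ 2 := by
    rw [← exp_two_mul, phase_zero]; ring_nf
  have hPi : Complex.exp (-(4 * Complex.I * z ^ 2 * t)) = Complex.exp (-phase 0 t z) ^ 2 := by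
    rw [← exp_two_mul, phase_zero]; ring_nf
  rw [exp_half_sq] at h1 h2 h3
  rcases him.lt_or_gt with hi | hi
  · have hq : z ∈ Q3 := ⟨hz, hi⟩
    -- The `s⁻¹` of the left dressing cancels the `s` of the monodromy matrix, leaving the
    -- expression used in the opposite quadrant `Q1` at `x = 0`.
    have hm : dress L a b R L t z * monodromy L a b z =
        !![Complex.exp (-phase 0 t z), -(Complex.exp (-phase 0 t z) * R z);
          0, Complex.exp (phase 0 t z)] := by
      rw [dress_Q3 hq, monodromy_eq, phase_end L, neg_add, Complex.exp_add, Complex.exp_add,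
        exp_half_sq, Matrix.mul_fin_two]
      set u := Complex.exp (Complex.I * z * L)
      set v := Complex.exp (-(Complex.I * z * L))
      set p := Complex.exp (phase 0 t z)
      set p' := Complex.exp (-phase 0 t z)
      apply mat_ext
      · linear_combination p' * u * v * hd + p' * h4
      · linear_combination (-p' * v ^ 2 * u ^ 2 * R z) * hd - p' * R z * (u * v + 1) * h4
      · ring
      · linear_combination p * u * v * hd + p * h4
    rw [hm, dress_Q3 hq, matP, if_neg (notMem_Q2_of_Q3 hq), if_pos hq, hP, exp_half_sq,
      Matrix.mul_fin_two]
    set u := Complex.exp (Complex.I * z * L)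
    set p := Complex.exp (phase 0 t z)
    set p' := Complex.exp (-phase 0 t z)
    apply mat_ext
    · linear_combination -p' * h3
    · linear_combination -p' * h1 + p' * R z * h3
    · linear_combination (-schwarz b z * p) * h5
    · linear_combination (schwarz b z * p * R z) * h5
  · have hq : z ∈ Q2 := ⟨hz, hi⟩
    have hm : dress L a b R L t z * monodromy L a b z =
        !![Complex.exp (-phase 0 t z), 0;
          Complex.exp (phase 0 t z) * schwarz R z, Complex.exp (phase 0 t z)] := by
      rw [dress_Q2 hq, monodromy_eq, phase_end L, neg_add, Complex.exp_add, Complex.exp_add,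
        hEi, Matrix.mul_fin_two]
      set u := Complex.exp (Complex.I * z * L)
      set v := Complex.exp (-(Complex.I * z * L))
      set p := Complex.exp (phase 0 t z)
      set p' := Complex.exp (-phase 0 t z)
      apply mat_ext
      · linear_combination p' * u * v * hd + p' * h4
      · ring
      · linear_combination (p * u ^ 2 * v ^ 2 * schwarz R z) * hd
          + p * schwarz R z * (u * v + 1) * h4
      · linear_combination p * u * v * hd + p * h4
    rw [hm, dress_Q2 hq, matP, if_pos hq, hPi, hEi, Matrix.mul_fin_two]
    set u := Complex.exp (Complex.I * z * L)
    set v := Complex.exp (-(Complex.I * z * L))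
    set p := Complex.exp (phase 0 t z)
    set p' := Complex.exp (-phase 0 t z)
    apply mat_ext
    · linear_combination (b z * p' * schwarz R z) * h5
    · linear_combination (b z * p') * h5
    · linear_combination p * v ^ 2 * h2
        + p * (schwarz a z * schwarz R z - schwarz b z) * (u * v + 1) * h4
        - p * schwarz R z * v ^ 2 * h3 + p * schwarz R z * schwarz b z * R z * (u * v + 1) * h4
    · linear_combination -p * v ^ 2 * h3 + p * schwarz b z * R z * (u * v + 1) * h4

theorem monodromy_det (hS : SpectralData L a b) (z : ℂ) : (monodromy L a b z).det = 1 := by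
  rw [monodromy, Matrix.det_mul, expσ₃_det, matS, Matrix.det_fin_two_of]
  linear_combination hS.det z

theorem matrix_cancel_right {A B C : Mat2} (hC : C.det = 1) (h : A * C = B * C) : A = B := by
  have hC' : IsUnit C.det := by rw [hC]; exact isUnit_one
  rw [← Matrix.mul_nonsing_inv_cancel_right _ A hC', h, Matrix.mul_nonsing_inv_cancel_right _ _ hC']

/-- The transformed solutions at the two end points coincide. -/
theorem transformed_eq (hL : 0 ≤ L) (hS : SpectralData L a b) (he : IsMainSpectrum L a e)
    (hR : IsBranch L a b e R) {m₀ m₁ : ℂ → Mat2} (ht : 0 ≤ t)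
    (hm₀ : IsRHSolution L a b e R 0 t m₀) (hm₁ : IsRHSolution L a b e R L t m₁) {z : ℂ}
    (hz : z ∉ contour e) (hp : ¬ IsPole R z) (hp' : ¬ IsPole (schwarz R) z) :
    m₀ z * matP a b R t z = m₁ z * matPhat L a b R t z := by
  obtain ⟨F₀, A₀, hF₀, hd₀, hdet₀, hA₀, h₀, -⟩ :=
    exists_entire_asymptotics hS he hR hm₀ ⟨le_rfl, hL⟩ ht
  obtain ⟨F₁, A₁, hF₁, hd₁, hdet₁, hA₁, h₁, -⟩ :=
    exists_entire_asymptotics hS he hR hm₁ ⟨hL, le_rfl⟩ ht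
  have hzr : z ∈ regSet e R := by
    rw [regSet, Set.mem_compl_iff]
    rintro (h | ⟨-, h | h⟩)
    · exact hz h
    · exact hp h.2
    · exact hp' h.2
  obtain ⟨hre, him, hc, -⟩ := off_axes_of_mem_regSet hzr
  have hid := hR.identities hS hc hp hp'
  have hF := entire_eq_mul_monodromy hL hS he hR hF₀ hF₁ hdet₀ hA₀ hA₁ h₀ h₁ z
  rw [hd₀ z hzr, hd₁ z hzr] at hF
  rcases hre.lt_or_gt with h | h
  · have hP : matPhat L a b R t z = 1 := by
      rw [matPhat, if_neg fun h' => h.not_gt h'.1, if_neg fun h' => h.not_gt h'.1]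
    refine matrix_cancel_right (C := dress L a b R L t z * monodromy L a b z) ?_ ?_
    · rw [Matrix.det_mul, det_dress hS, monodromy_det hS, one_mul]
    · rw [Matrix.mul_assoc, ← dress_mul_monodromy h him hid, hF, hP, Matrix.mul_one,
        Matrix.mul_assoc]
  · have hP : matP a b R t z = 1 := by
      rw [matP, if_neg fun h' => h.not_gt h'.1, if_neg fun h' => h.not_gt h'.1]
    refine matrix_cancel_right (C := dress L a b R 0 t z) (det_dress hS _ _ _) ?_
    rw [Matrix.mul_assoc (m₁ z), matPhat_mul_dress h him hid, hP, Matrix.mul_one, hF,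
      Matrix.mul_assoc]

end

end

end PeriodicNLS

namespace PeriodicNLS

noncomputable section

/-! ### An estimate for the factorisation of a loop close to the identity -/

theorem norm_circleAverage_le {f : ℂ → ℂ} {g : ℂ → ℝ} {ρ : ℝ} (hg : CircleIntegrable g 0 ρ)
    (h : ∀ w ∈ Metric.sphere (0 : ℂ) |ρ|, ‖f w‖ ≤ g w) :
    ‖Real.circleAverage f 0 ρ‖ ≤ Real.circleAverage g 0 ρ := by
  rw [Real.circleAverage, Real.circleAverage, norm_smul, smul_eq_mul, norm_inv,
    Real.norm_of_nonneg Real.two_pi_pos.le]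
  refine mul_le_mul_of_nonneg_left ?_ (inv_nonneg.2 Real.two_pi_pos.le)
  exact intervalIntegral.norm_integral_le_of_norm_le Real.two_pi_pos.le
    (Eventually.of_forall fun θ _ => h _ (circleMap_mem_sphere' 0 ρ θ)) hg

theorem circleAverage_analytic {f : ℂ → ℂ} {ρ : ℝ} (hρ : 0 < ρ)
    (hf : ∀ w ∈ Metric.closedBall (0 : ℂ) ρ, DifferentiableAt ℂ f w) :
    Real.circleAverage f 0 ρ = f 0 := by
  refine DiffContOnCl.circleAverage ?_
  rw [abs_of_pos hρ]
  refine ⟨fun w hw => (hf w (Metric.ball_subset_closedBall hw)).differentiableWithinAt, ?_⟩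
  rw [closure_ball _ hρ.ne']
  exact fun w hw => (hf w hw).continuousAt.continuousWithinAt

theorem differentiableAt_dslope_zero {f : ℂ → ℂ} {ρ : ℝ} (hρ : 0 < ρ)
    (hf : ∀ w ∈ Metric.closedBall (0 : ℂ) ρ, AnalyticAt ℂ f w) :
    ∀ w ∈ Metric.closedBall (0 : ℂ) ρ, DifferentiableAt ℂ (dslope f 0) w := by
  intro w hw
  rcases eq_or_ne w 0 with rfl | h0
  · have h1 : DifferentiableOn ℂ f (Metric.closedBall 0 ρ) := fun z hz =>
      (hf z hz).differentiableAt.differentiableWithinAt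
    have hn : Metric.closedBall (0 : ℂ) ρ ∈ 𝓝 0 := Metric.closedBall_mem_nhds _ hρ
    exact ((Complex.differentiableOn_dslope hn).2 h1).differentiableAt hn
  · exact (differentiableAt_dslope_of_ne h0).2 (hf w hw).differentiableAt

/-- Expand `|b̄ - u|²` and drop `|b|²`. The cross term is the real part of the holomorphic product
`u b`, which averages to its value at the centre. -/
theorem sq_norm_le_of_sub {u b σ : ℂ} (h : u + σ = (starRingEnd ℂ) b) :
    ‖u‖ ^ 2 ≤ ‖σ‖ ^ 2 + 2 * (u * b).re := by
  have h1 : σ = (starRingEnd ℂ) b - u := by rw [← h]; ring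
  rw [h1, ← Complex.normSq_eq_norm_sq, ← Complex.normSq_eq_norm_sq, Complex.normSq_apply,
    Complex.normSq_apply]
  simp only [Complex.sub_re, Complex.sub_im, Complex.conj_re, Complex.conj_im, Complex.mul_re]
  nlinarith [sq_nonneg b.re, sq_nonneg b.im]

theorem row_bound {u v p q : ℂ} {δ : ℝ} (hp : ‖p‖ ≤ δ) (hq : ‖q‖ ≤ δ) :
    ‖(1 + u) * p + v * q‖ ^ 2 ≤ δ ^ 2 * (4 + 4 * ‖u‖ ^ 2 + 2 * ‖v‖ ^ 2) := by
  have hδ : 0 ≤ δ := (norm_nonneg p).trans hp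
  have h1 : ‖(1 + u) * p + v * q‖ ≤ δ * (1 + ‖u‖ + ‖v‖) := by
    refine (norm_add_le _ _).trans ?_
    rw [norm_mul, norm_mul]
    have h2 : ‖1 + u‖ ≤ 1 + ‖u‖ := (norm_add_le _ _).trans (by simp)
    have h3 := mul_le_mul h2 hp (norm_nonneg _) (by positivity)
    have h4 := mul_le_mul_of_nonneg_left hq (norm_nonneg v)
    linarith
  calc ‖(1 + u) * p + v * q‖ ^ 2 ≤ (δ * (1 + ‖u‖ + ‖v‖)) ^ 2 :=
        pow_le_pow_left₀ (norm_nonneg _) h1 2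
    _ = δ ^ 2 * (1 + ‖u‖ + ‖v‖) ^ 2 := by ring
    _ ≤ _ := by
        refine mul_le_mul_of_nonneg_left ?_ (sq_nonneg _)
        nlinarith [sq_nonneg (1 - ‖u‖), sq_nonneg (1 + ‖u‖ - ‖v‖)]

/-- First-order expansion of the outer factor of a loop `1 + ε` close to the identity:
if the row `(1 + u, v)`, with `u`, `v` entire, times `1 + ε` is the row `(1 + b₀*, b₁*)`,
where `b₀*`, `b₁*` are boundary values of functions analytic outside the circle which vanish at
infinity, then the leading coefficient of `b₁*` at infinity is that of `ε₀₁`, up to a quadratic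
error. -/
theorem factorization_estimate {ρ δ : ℝ} (hρ : 0 < ρ) (hδ : 16 * δ ^ 2 ≤ 1)
    {u v b₀ b₁ ε₀₀ ε₀₁ ε₁₀ ε₁₁ : ℂ → ℂ} (hu : Differentiable ℂ u) (hv : Differentiable ℂ v)
    (hb₀ : ∀ w ∈ Metric.closedBall (0 : ℂ) ρ, AnalyticAt ℂ b₀ w)
    (hb₁ : ∀ w ∈ Metric.closedBall (0 : ℂ) ρ, AnalyticAt ℂ b₁ w) (hb₀' : b₀ 0 = 0)
    (hb₁' : b₁ 0 = 0) (hε : ContinuousOn ε₀₁ (Metric.sphere 0 ρ))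
    (hbd : ∀ w ∈ Metric.sphere (0 : ℂ) ρ, ‖ε₀₀ w‖ ≤ δ ∧ ‖ε₀₁ w‖ ≤ δ ∧ ‖ε₁₀ w‖ ≤ δ ∧ ‖ε₁₁ w‖ ≤ δ)
    (h₀ : ∀ w ∈ Metric.sphere (0 : ℂ) ρ,
      u w + ((1 + u w) * ε₀₀ w + v w * ε₁₀ w) = (starRingEnd ℂ) (b₀ w))
    (h₁ : ∀ w ∈ Metric.sphere (0 : ℂ) ρ,
      v w + ((1 + u w) * ε₀₁ w + v w * ε₁₁ w) = (starRingEnd ℂ) (b₁ w)) :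
    ‖(ρ : ℂ) ^ 2 * (starRingEnd ℂ) (deriv b₁ 0) -
      Real.circleAverage (fun w => w * ε₀₁ w) 0 ρ‖ ≤ 9 * ρ * δ ^ 2 := by
  have habs : |ρ| = ρ := abs_of_pos hρ
  have hsub : Metric.sphere (0 : ℂ) ρ ⊆ Metric.closedBall 0 ρ := Metric.sphere_subset_closedBall
  -- The pointwise majorant is the real part of a holomorphic function, so its circle average is the
  -- value at `0`, where `b₀` and `b₁` vanish.
  set G : ℂ → ℂ := fun w => (ρ : ℂ) * ((9 * δ ^ 2 : ℝ) + 2 * (u w * b₀ w + v w * b₁ w)) with hG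
  have hGd : ∀ w ∈ Metric.closedBall (0 : ℂ) ρ, DifferentiableAt ℂ G w := fun w hw => by
    have h1 := (hb₀ w hw).differentiableAt
    have h2 := (hb₁ w hw).differentiableAt
    have h3 := hu w
    have h4 := hv w
    simp only [hG]
    fun_prop
  have hGc : ContinuousOn G (Metric.sphere 0 ρ) := fun w hw =>
    (hGd w (hsub hw)).continuousAt.continuousWithinAt
  have hds := differentiableAt_dslope_zero hρ hb₁
  have hdc : ContinuousOn (fun w => (ρ : ℂ) ^ 2 * dslope b₁ 0 w) (Metric.sphere 0 ρ) := fun w hw =>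
    ((hds w (hsub hw)).continuousAt.const_mul ((ρ : ℂ) ^ 2)).continuousWithinAt
  -- `k` is the quadratic error `w (u ε₀₁ + v ε₁₁)`. Its first two terms average to the leading
  -- coefficient and to zero.
  set k : ℂ → ℂ := fun w => (starRingEnd ℂ) ((ρ : ℂ) ^ 2 * dslope b₁ 0 w) - w * v w - w * ε₀₁ w
    with hk
  have hbound : ∀ w ∈ Metric.sphere (0 : ℂ) |ρ|, ‖k w‖ ≤ (G w).re := by
    intro w hw
    rw [habs] at hw
    have hwn : ‖w‖ = ρ := by simpa using hw
    have hw0 : w ≠ 0 := fun h => by rw [h, norm_zero] at hwn; exact hρ.ne hwn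
    have hwc : (ρ : ℂ) ^ 2 = w * (starRingEnd ℂ) w := by
      rw [Complex.mul_conj, Complex.normSq_eq_norm_sq, hwn]; push_cast; rfl
    obtain ⟨e1, e2, e3, e4⟩ := hbd w hw
    have hkw : k w = w * (u w * ε₀₁ w + v w * ε₁₁ w) := by
      have hsl : dslope b₁ 0 w = b₁ w / w := by
        rw [dslope_of_ne _ hw0, slope_def_field, hb₁']; simp
      have h2 : (ρ : ℂ) ^ 2 * dslope b₁ 0 w = (starRingEnd ℂ) w * b₁ w := by
        rw [hwc, hsl]; field_simp
      simp only [hk]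
      rw [h2, map_mul, Complex.conj_conj, ← h₁ w hw]; ring
    -- With `16 δ² ≤ 1` the terms in `u`, `v` from `row_bound` amount to at most half of the left
    -- side and are absorbed.
    have hf : ‖u w‖ ^ 2 + ‖v w‖ ^ 2 ≤ 16 * δ ^ 2 + 4 * (u w * b₀ w + v w * b₁ w).re := by
      have h2 := sq_norm_le_of_sub (h₀ w hw)
      have h3 := sq_norm_le_of_sub (h₁ w hw)
      have h4 := row_bound (u := u w) (v := v w) e1 e3
      have h5 := row_bound (u := u w) (v := v w) e2 e4
      rw [Complex.add_re]
      nlinarith [sq_nonneg ‖u w‖, sq_nonneg ‖v w‖]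
    have hre : (G w).re = ρ * (9 * δ ^ 2 + 2 * (u w * b₀ w + v w * b₁ w).re) := by
      simp only [hG]
      rw [Complex.re_ofReal_mul, Complex.add_re, Complex.ofReal_re]
      simp
    rw [hkw, hre, norm_mul, hwn]
    refine mul_le_mul_of_nonneg_left ?_ hρ.le
    have h2 : ‖u w * ε₀₁ w + v w * ε₁₁ w‖ ≤ ‖u w‖ * δ + ‖v w‖ * δ := by
      refine (norm_add_le _ _).trans ?_
      rw [norm_mul, norm_mul]
      gcongr
    nlinarith [sq_nonneg (‖u w‖ - δ), sq_nonneg (‖v w‖ - δ)]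
  have hGre : Real.circleAverage (fun w => (G w).re) 0 ρ = 9 * ρ * δ ^ 2 := by
    have h1 := Complex.reCLM.circleAverage_comp_comm (f := G) (c := 0) (R := ρ)
      (hGc.circleIntegrable hρ.le)
    rw [circleAverage_analytic hρ hGd] at h1
    have h2 : G 0 = ((9 * ρ * δ ^ 2 : ℝ) : ℂ) := by
      simp only [hG, hb₀', hb₁']; push_cast; ring
    rw [h2] at h1
    exact h1
  have hkavg : Real.circleAverage k 0 ρ = (ρ : ℂ) ^ 2 * (starRingEnd ℂ) (deriv b₁ 0) -
      Real.circleAverage (fun w => w * ε₀₁ w) 0 ρ := by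
    have c1 : CircleIntegrable (fun w => (starRingEnd ℂ) ((ρ : ℂ) ^ 2 * dslope b₁ 0 w)) 0 ρ :=
      (Complex.continuous_conj.comp_continuousOn hdc).circleIntegrable hρ.le
    have c2 : CircleIntegrable (fun w => w * v w) 0 ρ :=
      (continuous_id.mul hv.continuous).continuousOn.circleIntegrable hρ.le
    have c3 : CircleIntegrable (fun w => w * ε₀₁ w) 0 ρ :=
      (continuousOn_id.mul hε).circleIntegrable hρ.le
    have h1 := (Complex.conjCLE : ℂ →L[ℝ] ℂ).circleAverage_comp_comm
      (f := fun w => (ρ : ℂ) ^ 2 * dslope b₁ 0 w) (c := 0) (R := ρ) (hdc.circleIntegrable hρ.le)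
    have h2 : Real.circleAverage (fun w => (ρ : ℂ) ^ 2 * dslope b₁ 0 w) 0 ρ =
        (ρ : ℂ) ^ 2 * deriv b₁ 0 := by
      rw [circleAverage_analytic hρ fun w hw => (hds w hw).const_mul _, dslope_same]
    have h3 : Real.circleAverage (fun w => w * v w) 0 ρ = 0 := by
      have := circleAverage_analytic (f := fun w => w * v w) hρ fun w _ =>
        differentiableAt_id.mul (hv w)
      rw [this, zero_mul]
    rw [h2] at h1
    have h4 : Real.circleAverage (fun w => (starRingEnd ℂ) ((ρ : ℂ) ^ 2 * dslope b₁ 0 w)) 0 ρ =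
        (ρ : ℂ) ^ 2 * (starRingEnd ℂ) (deriv b₁ 0) := by
      refine h1.trans ?_
      simp
    have c4 : CircleIntegrable
        (fun w => (starRingEnd ℂ) ((ρ : ℂ) ^ 2 * dslope b₁ 0 w) - w * v w) 0 ρ := c1.sub c2
    simp only [hk]
    rw [Real.circleAverage_fun_sub c4 c3, Real.circleAverage_fun_sub c1 c2, h3, h4,
      sub_zero]
  rw [← hkavg, ← hGre]
  refine norm_circleAverage_le ?_ hbound
  exact (Complex.continuous_re.comp_continuousOn hGc).circleIntegrable hρ.le

end

end PeriodicNLS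

namespace PeriodicNLS

noncomputable section

/-! ### Functions analytic near infinity -/

/-- Reflection in the circle of radius `ρ` turns a function which is analytic outside a smaller
circle and vanishes at infinity into an analytic function in the disc. -/
theorem exists_reflection {β : ℂ → ℂ} {ρ₀ ρ : ℝ} (hρ₀ : 0 < ρ₀) (hρ : ρ₀ < ρ)
    (hβ : ∀ z, ρ₀ < ‖z‖ → AnalyticAt ℂ β z) {S : Set ℂ} (hS : Dense S)
    (h : Tendsto β (cocompact ℂ ⊓ 𝓟 S) (𝓝 0)) :
    ∃ b : ℂ → ℂ, (∀ w ∈ Metric.closedBall (0 : ℂ) ρ, AnalyticAt ℂ b w) ∧ b 0 = 0 ∧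
      (∀ w ∈ Metric.sphere (0 : ℂ) ρ, (starRingEnd ℂ) (b w) = β w) ∧
      Tendsto (fun z => z * β z) (cocompact ℂ) (𝓝 ((ρ : ℂ) ^ 2 * (starRingEnd ℂ) (deriv b 0))) := by
  have hρpos : 0 < ρ := hρ₀.trans hρ
  have hρC : (ρ : ℂ) ≠ 0 := Complex.ofReal_ne_zero.2 hρpos.ne'
  -- Analyticity near infinity upgrades the limit along the dense set to a limit in all directions.
  have hlim : Tendsto β (cocompact ℂ) (𝓝 0) := by
    rw [← Metric.cobounded_eq_cocompact, ← comap_norm_atTop] at h ⊢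
    rw [Metric.tendsto_nhds] at h ⊢
    intro η hη
    have h1 := h (η / 2) (half_pos hη)
    rw [eventually_inf_principal, eventually_comap] at h1
    obtain ⟨r, hr⟩ := eventually_atTop.1 h1
    rw [eventually_comap]
    filter_upwards [eventually_gt_atTop (max r ρ₀)] with s hs z hz
    subst hz
    have : (𝓝[S] z).NeBot := mem_closure_iff_nhdsWithin_neBot.1 (hS z)
    have hc := (hβ z (lt_of_le_of_lt (le_max_right _ _) hs)).continuousAt
    have h2 : dist (β z) 0 ≤ η / 2 := by
      refine le_of_tendsto ((hc.tendsto.dist tendsto_const_nhds).mono_left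
        (nhdsWithin_le_nhds (s := S))) ?_
      filter_upwards [self_mem_nhdsWithin, nhdsWithin_le_nhds
        ((isOpen_lt continuous_const continuous_norm).mem_nhds
          (lt_of_le_of_lt (le_max_left _ _) hs))] with w h3 h4
      exact (hr _ (le_of_lt h4) w rfl h3).le
    linarith
  -- Inversion moves infinity to `0`, where the vanishing limit removes the singularity; Schwarz
  -- reflection then matches `β` on the circle.
  set f : ℂ → ℂ := Function.update (fun ζ => β ((ρ : ℂ) ^ 2 / ζ)) 0 0 with hf
  have hf0 : f 0 = 0 := by simp [hf]
  have hfne : ∀ ζ, ζ ≠ 0 → f ζ = β ((ρ : ℂ) ^ 2 / ζ) := fun ζ h => by simp [hf, h]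
  have hinv : Tendsto (fun ζ : ℂ => (ρ : ℂ) ^ 2 / ζ) (𝓝[≠] 0) (cocompact ℂ) := by
    rw [← Metric.cobounded_eq_cocompact]
    have h1 : Tendsto (fun ζ : ℂ => ζ⁻¹) (𝓝[≠] 0) (Bornology.cobounded ℂ) :=
      tendsto_inv₀_nhdsNE_zero
    refine tendsto_norm_atTop_iff_cobounded.1 ?_
    have h2 := (tendsto_norm_atTop_iff_cobounded.2 h1).const_mul_atTop
      (norm_pos_iff.2 (pow_ne_zero 2 hρC))
    refine h2.congr fun ζ => ?_
    rw [div_eq_mul_inv, norm_mul]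
  have hfa : ∀ w, w ≠ 0 → w ∈ Metric.closedBall (0 : ℂ) ρ → AnalyticAt ℂ f w := by
    intro w hw hwρ
    have hn : ‖w‖ ≤ ρ := by simpa using hwρ
    have h1 : AnalyticAt ℂ β ((ρ : ℂ) ^ 2 / w) := by
      apply hβ
      rw [norm_div, norm_pow, Complex.norm_real, Real.norm_of_nonneg hρpos.le,
        lt_div_iff₀ (norm_pos_iff.2 hw)]
      nlinarith [norm_pos_iff.2 hw]
    have h2 : AnalyticAt ℂ (fun ζ => β ((ρ : ℂ) ^ 2 / ζ)) w :=
      AnalyticAt.fun_comp h1 (analyticAt_const.div analyticAt_id hw)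
    refine h2.congr ?_
    filter_upwards [isOpen_ne.mem_nhds hw] with ζ hζ using (hfne ζ hζ).symm
  have hfa0 : AnalyticAt ℂ f 0 := by
    refine Complex.analyticAt_of_differentiable_on_punctured_nhds_of_continuousAt ?_ ?_
    · filter_upwards [self_mem_nhdsWithin,
        nhdsWithin_le_nhds (Metric.closedBall_mem_nhds (0 : ℂ) hρpos)] with w h1 h2
      exact (hfa w h1 h2).differentiableAt
    · rw [continuousAt_iff_punctured_nhds, hf0]
      refine (hlim.comp hinv).congr' ?_
      filter_upwards [self_mem_nhdsWithin] with w hw using (hfne w hw).symm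
  have hfall : ∀ w ∈ Metric.closedBall (0 : ℂ) ρ, AnalyticAt ℂ f w := fun w hw => by
    rcases eq_or_ne w 0 with rfl | h
    · exact hfa0
    · exact hfa w h hw
  refine ⟨schwarz f, fun w hw => (hfall _ (by simpa using hw)).schwarz, by simp [schwarz, hf0],
    fun w hw => ?_, ?_⟩
  · have hn : ‖w‖ = ρ := by simpa using hw
    have hw0 : (starRingEnd ℂ) w ≠ 0 := by
      rw [Ne, map_eq_zero]
      intro h; rw [h, norm_zero] at hn; exact hρpos.ne hn
    rw [schwarz, Complex.conj_conj, hfne _ hw0]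
    congr 1
    rw [div_eq_iff hw0, Complex.mul_conj, Complex.normSq_eq_norm_sq, hn]
    push_cast; rfl
  · have hd : deriv (schwarz f) 0 = (starRingEnd ℂ) (deriv f 0) := by
      have h1 := hfa0.differentiableAt.hasDerivAt
      have h2 : HasDerivAt f (deriv f 0) 0 := h1
      have h3 := h2.conj_conj
      rw [map_zero] at h3
      exact h3.deriv
    rw [hd, Complex.conj_conj]
    have hsl := hasDerivAt_iff_tendsto_slope.1 hfa0.differentiableAt.hasDerivAt
    have hinv' : Tendsto (fun z : ℂ => (ρ : ℂ) ^ 2 / z) (cocompact ℂ) (𝓝[≠] 0) := by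
      rw [← Metric.cobounded_eq_cocompact]
      have h1 : Tendsto (fun z : ℂ => z⁻¹) (Bornology.cobounded ℂ) (𝓝[≠] 0) :=
        tendsto_inv₀_cobounded'
      rw [tendsto_nhdsWithin_iff] at h1 ⊢
      constructor
      · have h2 := h1.1.const_mul ((ρ : ℂ) ^ 2)
        rw [mul_zero] at h2
        exact h2.congr fun z => (div_eq_mul_inv _ _).symm
      · filter_upwards [h1.2] with z hz
        rw [Set.mem_compl_iff, Set.mem_singleton_iff] at hz ⊢
        exact div_ne_zero (pow_ne_zero 2 hρC) (fun h => hz (by rw [h, inv_zero]))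
    have h1 := (hsl.comp hinv').const_mul ((ρ : ℂ) ^ 2)
    refine h1.congr' ?_
    have h2 : ∀ᶠ z in cocompact ℂ, z ≠ 0 :=
      (isCompact_singleton (x := (0 : ℂ))).compl_mem_cocompact
    filter_upwards [h2] with z hz
    have h3 : (ρ : ℂ) ^ 2 / z ≠ 0 := div_ne_zero (pow_ne_zero 2 hρC) hz
    simp only [Function.comp_apply, slope_def_field, hf0, sub_zero, hfne _ h3]
    rw [div_div_cancel₀ (pow_ne_zero 2 hρC)]
    field_simp

/-! ### The loop of a translation -/

/-- Conjugation of the diagonal matrix `diag (c, d)` by `V`. -/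
theorem conj_diag_entry (V W : Mat2) (c d : ℂ) (i j : Fin 2) :
    (V * !![c, 0; 0, d] * W) i j = V i 0 * c * W 0 j + V i 1 * d * W 1 j := by
  simp [Matrix.mul_apply, Fin.sum_univ_two]

theorem loop_sub_one {V W : Mat2} (h : V * W = 1) (w : ℂ) :
    V * expσ₃ w * W - 1 = V * !![Complex.exp w - 1, 0; 0, Complex.exp (-w) - 1] * W := by
  have h1 : expσ₃ w = !![Complex.exp w - 1, 0; 0, Complex.exp (-w) - 1] + 1 := by
    rw [expσ₃]; ext i j; fin_cases i <;> fin_cases j <;> simp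
  rw [h1, Matrix.mul_add, Matrix.add_mul, Matrix.mul_one, h, add_sub_cancel_right]

theorem norm_conj_diag_le {V W : Mat2} {K κ : ℝ} (hV : ∀ i j, ‖V i j‖ ≤ K)
    (hW : ∀ i j, ‖W i j‖ ≤ K) {c d : ℂ} (hc : ‖c‖ ≤ κ) (hd : ‖d‖ ≤ κ) (i j : Fin 2) :
    ‖(V * !![c, 0; 0, d] * W) i j‖ ≤ 2 * K ^ 2 * κ := by
  have hK : 0 ≤ K := (norm_nonneg _).trans (hV 0 0)
  have hκ : 0 ≤ κ := (norm_nonneg _).trans hc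
  rw [conj_diag_entry]
  have key : ∀ k (c : ℂ), ‖c‖ ≤ κ → ‖V i k * c * W k j‖ ≤ K * κ * K := fun k c hc => by
    rw [norm_mul, norm_mul]
    gcongr
    · exact hV i k
    · exact hW k j
  linarith [norm_add_le (V i 0 * c * W 0 j) (V i 1 * d * W 1 j), key 0 c hc, key 1 d hd]

theorem loop_bounds {V W : Mat2} {K r : ℝ} (hVW : V * W = 1) (hV : ∀ i j, ‖V i j‖ ≤ K)
    (hW : ∀ i j, ‖W i j‖ ≤ K) {w : ℂ} (hw : ‖w‖ ≤ r) (hr : r ≤ 1) (i j : Fin 2) :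
    ‖(V * expσ₃ w * W - 1) i j‖ ≤ 4 * K ^ 2 * r ∧
      ‖(V * expσ₃ w * W - 1) i j - (V * !![w, 0; 0, -w] * W) i j‖ ≤ 2 * K ^ 2 * r ^ 2 := by
  have hw' : ‖-w‖ ≤ r := by rwa [norm_neg]
  have key1 : ∀ w : ℂ, ‖w‖ ≤ r → ‖Complex.exp w - 1‖ ≤ 2 * r := fun w hw =>
    (Complex.norm_exp_sub_one_le (hw.trans hr)).trans (by linarith)
  have key2 : ∀ w : ℂ, ‖w‖ ≤ r → ‖Complex.exp w - 1 - w‖ ≤ r ^ 2 := fun w hw =>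
    (Complex.norm_exp_sub_one_sub_id_le (hw.trans hr)).trans
      (pow_le_pow_left₀ (norm_nonneg _) hw 2)
  rw [loop_sub_one hVW]
  constructor
  · exact (norm_conj_diag_le hV hW (key1 w hw) (key1 _ hw') i j).trans (by linarith)
  · have h1 : (V * !![Complex.exp w - 1, 0; 0, Complex.exp (-w) - 1] * W) i j -
        (V * !![w, 0; 0, -w] * W) i j =
        (V * !![Complex.exp w - 1 - w, 0; 0, Complex.exp (-w) - 1 - -w] * W) i j := by
      simp only [conj_diag_entry]; ring
    rw [h1]
    exact norm_conj_diag_le hV hW (key2 w hw) (key2 _ hw') i j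

end

end PeriodicNLS

namespace PeriodicNLS

noncomputable section

section

variable {N : ℕ} {L : ℝ} {a b R : ℂ → ℂ} {e : Fin (N + 1) → ℂ} {t : ℝ}

/-! ### Translations in `x` and the derivative of the potential -/

/-- The generator of the loop of translations. -/
def loopGen (F : ℂ → Mat2) (R : ℂ → ℂ) (w : ℂ) : Mat2 :=
  F w * blochMat R w * !![Complex.I * w, 0; 0, -(Complex.I * w)] * (F w * blochMat R w)⁻¹

theorem blochNorm_comm (a b R : ℂ → ℂ) (z w : ℂ) :
    blochNorm a b R z * expσ₃ w = expσ₃ w * blochNorm a b R z := by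
  rw [blochNorm]
  split_ifs
  · rw [Matrix.one_mul, Matrix.mul_one]
  · rw [expσ₃, Matrix.mul_fin_two, Matrix.mul_fin_two]
    apply mat_ext <;> ring

/-- The entire solutions at two points are related by a translation. -/
theorem translation_eq {x x₀ : ℝ} {z : ℂ} {F F₀ A A₀ : Mat2} (hdet : F₀.det = 1)
    (hV : (F₀ * blochMat R z).det ≠ 0) (hA₀ : A₀ * A₀⁻¹ = 1)
    (h : F * blochMat R z = A * expσ₃ (-phase x t z) * blochNorm a b R z)
    (h₀ : F₀ * blochMat R z = A₀ * expσ₃ (-phase x₀ t z) * blochNorm a b R z) :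
    F * F₀.adjugate * (F₀ * blochMat R z * expσ₃ (Complex.I * z * (x - x₀ : ℝ)) *
      (F₀ * blochMat R z)⁻¹) = A * A₀⁻¹ := by
  have hph : -phase x t z + Complex.I * z * (x - x₀ : ℝ) = -phase x₀ t z := by
    simp only [phase]; push_cast; ring
  have h1 : F * F₀.adjugate * (F₀ * blochMat R z) = F * blochMat R z := by
    rw [Matrix.mul_assoc, ← Matrix.mul_assoc F₀.adjugate, Matrix.adjugate_mul, hdet, one_smul,
      Matrix.one_mul]
  have h2 : F * blochMat R z * expσ₃ (Complex.I * z * (x - x₀ : ℝ)) =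
      A * A₀⁻¹ * (F₀ * blochMat R z) := by
    have h3 : A₀⁻¹ * (F₀ * blochMat R z) = expσ₃ (-phase x₀ t z) * blochNorm a b R z := by
      rw [h₀, Matrix.mul_assoc, ← Matrix.mul_assoc A₀⁻¹, mul_eq_one_comm.1 hA₀, Matrix.one_mul]
    rw [Matrix.mul_assoc A A₀⁻¹, h3, h, Matrix.mul_assoc, blochNorm_comm, ← Matrix.mul_assoc,
      Matrix.mul_assoc A, expσ₃_mul, hph, Matrix.mul_assoc]
  rw [← Matrix.mul_assoc, ← Matrix.mul_assoc, h1, h2, Matrix.mul_assoc,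
    Matrix.mul_nonsing_inv _ (isUnit_iff_ne_zero.2 hV), Matrix.mul_one]

theorem mAnalyticAt_inv {V : ℂ → Mat2} {z : ℂ} (hV : MAnalyticAt V z) (h : (V z).det ≠ 0) :
    MAnalyticAt (fun w => (V w)⁻¹) z := by
  have hdet : AnalyticAt ℂ (fun w => (V w).det) z := by
    simp only [Matrix.det_fin_two]
    exact ((hV 0 0).mul (hV 1 1)).sub ((hV 0 1).mul (hV 1 0))
  have hadj : MAnalyticAt (fun w => (V w).adjugate) z := by
    simp only [Matrix.adjugate_fin_two]
    exact mAnalyticAt_of (hV 1 1) (hV 0 1).neg (hV 1 0).neg (hV 0 0)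
  refine ((hadj.smul (hdet.inv h))).congr (Eventually.of_forall fun w => ?_)
  rw [Matrix.inv_def, Ring.inverse_eq_inv', Pi.inv_apply]

theorem exists_entry_bound {V : ℂ → Mat2} {ρ : ℝ}
    (hV : ∀ w ∈ Metric.sphere (0 : ℂ) ρ, MAnalyticAt V w) :
    ∃ K, ∀ w ∈ Metric.sphere (0 : ℂ) ρ, ∀ i j, ‖V w i j‖ ≤ K := by
  have h : ∀ i j, ∃ K, ∀ w ∈ Metric.sphere (0 : ℂ) ρ, ‖V w i j‖ ≤ K := fun i j =>
    (isCompact_sphere (0 : ℂ) ρ).exists_bound_of_continuousOn fun w hw =>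
      (hV w hw i j).continuousAt.continuousWithinAt
  choose K hK using h
  refine ⟨∑ i, ∑ j, |K i j|, fun w hw i j => (hK i j w hw).trans ((le_abs_self _).trans ?_)⟩
  exact (Finset.single_le_sum (f := fun j => |K i j|) (fun _ _ => abs_nonneg _)
    (Finset.mem_univ j)).trans (Finset.single_le_sum (f := fun i => ∑ j, |K i j|)
      (fun _ _ => Finset.sum_nonneg fun _ _ => abs_nonneg _) (Finset.mem_univ i))

variable {M : ℝ → ℝ → ℂ → Mat2} {q : ℝ → ℝ → ℂ}

/-- To leading order the `12` entry of `A A₀⁻¹` is the difference of the `12` entries, because `A`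
and `A₀` tend to the identity. In `Q1` these entries are those of `M`. -/
theorem tendsto_potential_difference {x x₀ : ℝ} (hx : x ∈ Set.Icc 0 L) (hx₀ : x₀ ∈ Set.Icc 0 L)
    (ht : 0 ≤ t) (hq : IsPotentialOf L M q) {A A₀ : ℂ → Mat2}
    (hA : Tendsto A (cocompact ℂ ⊓ 𝓟 (contour e)ᶜ) (𝓝 1))
    (hA₀ : Tendsto A₀ (cocompact ℂ ⊓ 𝓟 (contour e)ᶜ) (𝓝 1))
    (hAM : ∀ z ∈ Q1, A z 0 1 = M x t z 0 1) (hAM₀ : ∀ z ∈ Q1, A₀ z 0 1 = M x₀ t z 0 1) :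
    Tendsto (fun z => 2 * Complex.I * (z * (A z * (A₀ z)⁻¹) 0 1))
      (cocompact ℂ ⊓ 𝓟 ((contour e)ᶜ ∩ Q1)) (𝓝 (q x t - q x₀ t)) := by
  set l := cocompact ℂ ⊓ 𝓟 ((contour e)ᶜ ∩ Q1) with hl
  have hl1 : l ≤ cocompact ℂ ⊓ 𝓟 (contour e)ᶜ :=
    inf_le_inf_left _ (principal_mono.2 Set.inter_subset_left)
  have hl2 : l ≤ cocompact ℂ ⊓ 𝓟 Q1 :=
    inf_le_inf_left _ (principal_mono.2 Set.inter_subset_right)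
  have hlQ : ∀ᶠ z in l, z ∈ Q1 := mem_inf_of_right (by
    rw [mem_principal]; exact Set.inter_subset_right)
  have h1 := (hq x hx t ht).mono_left hl2
  have h2 := (hq x₀ hx₀ t ht).mono_left hl2
  have hdet : Tendsto (fun z => (A₀ z).det) l (𝓝 1) := by
    have := ((continuous_id.matrix_det).tendsto (1 : Mat2)).comp (hA₀.mono_left hl1)
    rwa [id, Matrix.det_one] at this
  have hA' := tendsto_entry (hA.mono_left hl1) 0 0
  have hA₀' := tendsto_entry (hA₀.mono_left hl1) 0 0
  rw [Matrix.one_apply_eq] at hA' hA₀'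
  have h3 := ((h1.mul hA₀').sub (h2.mul hA')).mul (hdet.inv₀ one_ne_zero)
  rw [mul_one, mul_one, inv_one, mul_one] at h3
  refine h3.congr' ?_
  filter_upwards [hlQ] with z hz
  rw [← hAM z hz, ← hAM₀ z hz, Matrix.inv_def, Ring.inverse_eq_inv', Matrix.adjugate_fin_two]
  simp [Matrix.mul_apply, Fin.sum_univ_two]
  ring

theorem mAnalyticAt_blochMat {z : ℂ} (h : AnalyticAt ℂ R z) (h' : AnalyticAt ℂ (schwarz R) z) :
    MAnalyticAt (blochMat R) z :=
  mAnalyticAt_of analyticAt_const h h'.neg analyticAt_const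

/-- A quadratic estimate for the potential near a base point. -/
theorem exists_potential_estimate (hS : SpectralData L a b) (he : IsMainSpectrum L a e)
    (hR : IsBranch L a b e R) (ht : 0 ≤ t)
    (hM : ∀ x ∈ Set.Icc (0 : ℝ) L, IsRHSolution L a b e R x t (M x t))
    (hq : IsPotentialOf L M q) {x₀ : ℝ} (hx₀ : x₀ ∈ Set.Icc 0 L) {F₀ A₀ : ℂ → Mat2}
    (hF₀ : ∀ i j, Differentiable ℂ fun z => F₀ z i j) (hdet : ∀ z, (F₀ z).det = 1)
    (hA₀ : Tendsto A₀ (cocompact ℂ ⊓ 𝓟 (contour e)ᶜ) (𝓝 1))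
    (h₀ : ∀ᶠ z in cocompact ℂ ⊓ 𝓟 (contour e)ᶜ,
      F₀ z * blochMat R z = A₀ z * expσ₃ (-phase x₀ t z) * blochNorm a b R z)
    (hAM₀ : ∀ z ∈ Q1, A₀ z 0 1 = M x₀ t z 0 1) {ρ₀ ρ : ℝ} (hρ₀ : 0 < ρ₀) (hρ : ρ₀ < ρ)
    (hreg : ∀ z, ρ₀ < ‖z‖ →
      AnalyticAt ℂ R z ∧ AnalyticAt ℂ (schwarz R) z ∧ 1 + R z * schwarz R z ≠ 0) :
    ∃ C η : ℝ, 0 < η ∧ ∀ x ∈ Set.Icc (0 : ℝ) L, |x - x₀| < η →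
      ‖q x t - q x₀ t - ((x - x₀ : ℝ) : ℂ) *
        (2 * Complex.I * Real.circleAverage (fun w => w * loopGen F₀ R w 0 1) 0 ρ)‖
        ≤ C * (x - x₀) ^ 2 := by
  have hρpos : 0 < ρ := hρ₀.trans hρ
  set V : ℂ → Mat2 := fun z => F₀ z * blochMat R z with hV
  have hVdet : ∀ z, ρ₀ < ‖z‖ → (V z).det ≠ 0 := fun z hz => by
    rw [hV, Matrix.det_mul, hdet, one_mul, blochMat_det]; exact (hreg z hz).2.2
  have hF₀a : ∀ z, MAnalyticAt F₀ z := fun z i j => (hF₀ i j).analyticAt z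
  have hVa : ∀ z, ρ₀ < ‖z‖ → MAnalyticAt V z := fun z hz =>
    (hF₀a z).mul (mAnalyticAt_blochMat (hreg z hz).1 (hreg z hz).2.1)
  have hWa : ∀ z, ρ₀ < ‖z‖ → MAnalyticAt (fun z => (V z)⁻¹) z := fun z hz =>
    mAnalyticAt_inv (hVa z hz) (hVdet z hz)
  have hVW : ∀ z, ρ₀ < ‖z‖ → V z * (V z)⁻¹ = 1 := fun z hz =>
    Matrix.mul_nonsing_inv _ (isUnit_iff_ne_zero.2 (hVdet z hz))
  have hsph : ∀ w ∈ Metric.sphere (0 : ℂ) ρ, ‖w‖ = ρ ∧ ρ₀ < ‖w‖ := fun w hw => by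
    have : ‖w‖ = ρ := by simpa using hw
    exact ⟨this, this ▸ hρ⟩
  obtain ⟨K₁, hK₁⟩ := exists_entry_bound fun w hw => hVa w (hsph w hw).2
  obtain ⟨K₂, hK₂⟩ := exists_entry_bound fun w hw => hWa w (hsph w hw).2
  set K := max 1 (max K₁ K₂) with hK
  have hK1 : 1 ≤ K := le_max_left _ _
  have hVK : ∀ w ∈ Metric.sphere (0 : ℂ) ρ, ∀ i j, ‖V w i j‖ ≤ K := fun w hw i j =>
    (hK₁ w hw i j).trans ((le_max_left _ _).trans (le_max_right _ _))
  have hWK : ∀ w ∈ Metric.sphere (0 : ℂ) ρ, ∀ i j, ‖(V w)⁻¹ i j‖ ≤ K := fun w hw i j =>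
    (hK₂ w hw i j).trans ((le_max_right _ _).trans (le_max_right _ _))
  -- The radius makes `δ = 4K²ρ|x - x₀|` at most `1/4`, as the factorisation estimate needs. The two
  -- parts of the constant are its error and that of linearising the exponential on the circle.
  refine ⟨2 * (9 * ρ * (4 * K ^ 2 * ρ) ^ 2 + 2 * K ^ 2 * ρ ^ 3), (16 * K ^ 2 * ρ)⁻¹,
    by positivity, fun x hx hxη => ?_⟩
  obtain ⟨F, A, hF, -, -, hA, h, hAM⟩ := exists_entire_asymptotics hS he hR (hM x hx) hx ht
  set y : ℝ := x - x₀ with hy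
  have hr : ρ * |y| * (16 * K ^ 2) ≤ 1 := by
    have h1 : |y| * (16 * K ^ 2 * ρ) < 1 := by
      rwa [← lt_div_iff₀ (by positivity), one_div]
    nlinarith
  have hr1 : ρ * |y| ≤ 1 := by
    have h1 : 0 ≤ ρ * |y| := by positivity
    nlinarith [one_le_pow₀ hK1 (n := 2)]
  have hnorm : ∀ w ∈ Metric.sphere (0 : ℂ) ρ, ‖Complex.I * w * (y : ℝ)‖ ≤ ρ * |y| := fun w hw => by
    rw [norm_mul, norm_mul, Complex.norm_I, one_mul, (hsph w hw).1, Complex.norm_real,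
      Real.norm_eq_abs]
  set δ : ℝ := 4 * K ^ 2 * (ρ * |y|) with hδ
  have hδ1 : 16 * δ ^ 2 ≤ 1 := by
    have h1 : 0 ≤ δ := by positivity
    have h2 : 4 * δ ≤ 1 := by rw [hδ]; linarith
    nlinarith
  set γ : ℂ → Mat2 := fun z => V z * expσ₃ (Complex.I * z * (y : ℝ)) * (V z)⁻¹ with hγ
  have hbounds : ∀ w ∈ Metric.sphere (0 : ℂ) ρ, ∀ i j, _ := fun w hw i j =>
    loop_bounds (hVW w (hsph w hw).2) (hVK w hw) (hWK w hw) (hnorm w hw) hr1 i j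
  have hexpa : ∀ z, MAnalyticAt (fun z => expσ₃ (Complex.I * z * (y : ℝ))) z :=
    mAnalyticAt_expσ₃ (by fun_prop)
  have hγa : ∀ z, ρ₀ < ‖z‖ → MAnalyticAt γ z := fun z hz =>
    ((hVa z hz).mul (hexpa z)).mul (hWa z hz)
  set T : ℂ → Mat2 := fun z => F z * (F₀ z).adjugate with hT
  have hTd : ∀ i j, Differentiable ℂ fun z => T z i j :=
    differentiable_mul_entry hF (differentiable_adjugate_entry hF₀)
  have hTa : ∀ z, MAnalyticAt T z := fun z i j => (hTd i j).analyticAt z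
  -- By `translation_eq` this is `A A₀⁻¹ - 1` near infinity: `T γ = 1 + β` factorises the loop with
  -- `T` entire and `β` analytic outside the circle. Only its first row is needed.
  set β : ℂ → Mat2 := fun z => T z * γ z - 1 with hβ
  have hβa : ∀ z, ρ₀ < ‖z‖ → ∀ i j, AnalyticAt ℂ (fun z => β z i j) z := fun z hz i j =>
    ((hTa z).mul (hγa z hz) i j).sub analyticAt_const
  obtain ⟨hB, hB'⟩ := tendsto_inv_matrix hA₀
  have hρ₀ev : ∀ᶠ z in cocompact ℂ, ρ₀ < ‖z‖ :=
    tendsto_norm_cocompact_atTop.eventually_gt_atTop ρ₀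
  have hβeq : ∀ᶠ z in cocompact ℂ ⊓ 𝓟 (contour e)ᶜ, T z * γ z = A z * (A₀ z)⁻¹ := by
    filter_upwards [h, h₀, hB', mem_inf_of_left hρ₀ev] with z h1 h2 h3 h4
    exact translation_eq (hdet z) (hVdet z h4) h3 h1 h2
  have hβ0 : Tendsto β (cocompact ℂ ⊓ 𝓟 (contour e)ᶜ) (𝓝 0) := by
    have h1 := (hA.mul hB).sub_const 1
    rw [one_mul, sub_self] at h1
    refine h1.congr' ?_
    filter_upwards [hβeq] with z hz
    simp only [hβ, hz]
  have hdc : Dense (contour e)ᶜ := (dense_regSet hS he hR).mono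
    fun z hz => (off_axes_of_mem_regSet hz).2.2.2.2
  obtain ⟨b₀, hb₀, hb₀0, hb₀c, -⟩ := exists_reflection hρ₀ hρ (fun z hz => hβa z hz 0 0) hdc
    (tendsto_entry hβ0 0 0)
  obtain ⟨b₁, hb₁, hb₁0, hb₁c, hb₁l⟩ := exists_reflection hρ₀ hρ (fun z hz => hβa z hz 0 1) hdc
    (tendsto_entry hβ0 0 1)
  have hεc : ContinuousOn (fun w => (γ w - 1) 0 1) (Metric.sphere 0 ρ) := fun w hw =>
    ((hγa w (hsph w hw).2 0 1).sub analyticAt_const).continuousAt.continuousWithinAt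
  have est := factorization_estimate (u := fun z => T z 0 0 - 1) (v := fun z => T z 0 1)
    (ε₀₀ := fun z => (γ z - 1) 0 0) (ε₀₁ := fun z => (γ z - 1) 0 1)
    (ε₁₀ := fun z => (γ z - 1) 1 0) (ε₁₁ := fun z => (γ z - 1) 1 1)
    hρpos hδ1 ((hTd 0 0).sub_const 1) (hTd 0 1) hb₀ hb₁ hb₀0 hb₁0 hεc
    (fun w hw => ⟨(hbounds w hw 0 0).1, (hbounds w hw 0 1).1, (hbounds w hw 1 0).1,
      (hbounds w hw 1 1).1⟩)
    (fun w hw => by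
      rw [hb₀c w hw]
      simp [hβ, Matrix.mul_apply, Fin.sum_univ_two]; ring)
    (fun w hw => by
      rw [hb₁c w hw]
      simp [hβ, Matrix.mul_apply, Fin.sum_univ_two]; ring)
  have hneBot : (cocompact ℂ ⊓ 𝓟 ((contour e)ᶜ ∩ Q1)).NeBot := (eventually_diagonal e).neBot
  -- The coefficient of `1/z` in `β` computed by reflection is compared with the potential read off
  -- in `Q1`.
  have hqd : q x t - q x₀ t =
      2 * Complex.I * ((ρ : ℂ) ^ 2 * (starRingEnd ℂ) (deriv b₁ 0)) := by
    refine tendsto_nhds_unique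
      (tendsto_potential_difference hx hx₀ ht hq hA hA₀ hAM hAM₀) ?_
    refine ((hb₁l.mono_left inf_le_left).const_mul (2 * Complex.I)).congr' ?_
    have hle : cocompact ℂ ⊓ 𝓟 ((contour e)ᶜ ∩ Q1) ≤ cocompact ℂ ⊓ 𝓟 (contour e)ᶜ :=
      inf_le_inf_left _ (principal_mono.2 Set.inter_subset_left)
    filter_upwards [hle hβeq] with z hz
    simp [hβ, hz]
  have hgc : ContinuousOn (fun w => loopGen F₀ R w 0 1) (Metric.sphere 0 ρ) := fun w hw => by
    have h1 : MAnalyticAt (fun w => !![Complex.I * w, 0; 0, -(Complex.I * w)]) w :=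
      mAnalyticAt_of (analyticAt_const.mul analyticAt_id) analyticAt_const analyticAt_const
        (analyticAt_const.mul analyticAt_id).neg
    exact ((((hVa w (hsph w hw).2).mul h1).mul (hWa w (hsph w hw).2)) 0
      1).continuousAt.continuousWithinAt
  have havg : ‖Real.circleAverage (fun w => w * (γ w - 1) 0 1) 0 ρ -
      (y : ℂ) * Real.circleAverage (fun w => w * loopGen F₀ R w 0 1) 0 ρ‖ ≤
      ρ * (2 * K ^ 2 * (ρ * |y|) ^ 2) := by
    have c1 : CircleIntegrable (fun w => w * (γ w - 1) 0 1) 0 ρ :=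
      (continuousOn_id.mul hεc).circleIntegrable hρpos.le
    have c2 : CircleIntegrable (fun w => (y : ℂ) • (w * loopGen F₀ R w 0 1)) 0 ρ :=
      ((continuousOn_id.mul hgc).const_smul (y : ℂ)).circleIntegrable hρpos.le
    rw [← smul_eq_mul, ← Real.circleAverage_fun_smul, ← Real.circleAverage_fun_sub c1 c2]
    refine (norm_circleAverage_le (g := fun _ => ρ * (2 * K ^ 2 * (ρ * |y|) ^ 2))
      (circleIntegrable_const _ _ _) fun w hw => ?_).trans (Real.circleAverage_const _ _ _).le
    rw [abs_of_pos hρpos] at hw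
    have h1 : loopGen F₀ R w 0 1 * y = (V w * !![Complex.I * w * (y : ℝ), 0;
        0, -(Complex.I * w * (y : ℝ))] * (V w)⁻¹) 0 1 := by
      rw [loopGen, conj_diag_entry, conj_diag_entry]; ring
    have h2 : w * (γ w - 1) 0 1 - (y : ℂ) • (w * loopGen F₀ R w 0 1) =
        w * ((γ w - 1) 0 1 - loopGen F₀ R w 0 1 * y) := by
      rw [smul_eq_mul]; ring
    rw [h2, h1, norm_mul, (hsph w hw).1]
    exact mul_le_mul_of_nonneg_left (hbounds w hw 0 1).2 hρpos.le
  have h1 : q x t - q x₀ t - (y : ℂ) *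
      (2 * Complex.I * Real.circleAverage (fun w => w * loopGen F₀ R w 0 1) 0 ρ) =
      2 * Complex.I * (((ρ : ℂ) ^ 2 * (starRingEnd ℂ) (deriv b₁ 0) -
        Real.circleAverage (fun w => w * (γ w - 1) 0 1) 0 ρ) +
        (Real.circleAverage (fun w => w * (γ w - 1) 0 1) 0 ρ -
      (y : ℂ) * Real.circleAverage (fun w => w * loopGen F₀ R w 0 1) 0 ρ)) := by
    rw [hqd]; ring
  rw [h1, norm_mul, norm_mul, Complex.norm_I, Complex.norm_two, mul_one, mul_assoc]
  refine mul_le_mul_of_nonneg_left ((norm_add_le _ _).trans ((add_le_add est havg).trans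
    (le_of_eq ?_))) zero_le_two
  rw [hδ, ← sq_abs y]; ring

theorem hasDerivWithinAt_of_quadratic {f : ℝ → ℂ} {d : ℂ} {s : Set ℝ} {x₀ C η : ℝ} (hη : 0 < η)
    (h : ∀ x ∈ s, |x - x₀| < η → ‖f x - f x₀ - ((x - x₀ : ℝ) : ℂ) * d‖ ≤ C * (x - x₀) ^ 2) :
    HasDerivWithinAt f d s x₀ := by
  rw [hasDerivWithinAt_iff_isLittleO]
  have h1 : (fun x => f x - f x₀ - (x - x₀) • d) =O[𝓝[s] x₀] fun x => (x - x₀) ^ 2 := by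
    refine IsBigO.of_bound C ?_
    filter_upwards [self_mem_nhdsWithin, nhdsWithin_le_nhds (Metric.ball_mem_nhds x₀ hη)]
      with x h2 h3
    have h4 := h x h2 (by simpa [Real.dist_eq] using h3)
    rw [Complex.real_smul, Real.norm_of_nonneg (sq_nonneg _)]
    exact h4
  refine h1.trans_isLittleO ?_
  have h2 : (fun x : ℝ => (x - x₀) ^ 2) =o[𝓝 x₀] fun x => x - x₀ := by
    have h3 : Tendsto (fun x => x - x₀) (𝓝 x₀) (𝓝 0) := by
      have : Continuous fun x : ℝ => x - x₀ := by fun_prop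
      simpa using this.tendsto x₀
    exact (isLittleO_pow_id one_lt_two).comp_tendsto h3
  exact h2.mono nhdsWithin_le_nhds

/-- The monodromy matrix multiplies the Bloch frame on the right by a diagonal matrix, which
commutes with the diagonal generator and drops out of the conjugation. -/
theorem loopGen_mul_monodromy {F₁ : ℂ → Mat2} {z : ℂ} (h : BranchIdentities L a b R z) :
    loopGen (fun z => F₁ z * monodromy L a b z) R z = loopGen F₁ R z := by
  rw [loopGen, loopGen]
  set G : Mat2 := !![Complex.exp (Complex.I * z * L) * (schwarz a z + schwarz b z * R z), 0;
        0, Complex.exp (-(Complex.I * z * L)) * (a z + b z * schwarz R z)] with hG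
  have hGdet : IsUnit G.det := by
    have h4 := exp_mul_exp_neg (Complex.I * z * L)
    have : G.det = 1 := by
      rw [hG, Matrix.det_fin_two_of]
      linear_combination h.multiplier + ((schwarz a z + schwarz b z * R z) *
        (a z + b z * schwarz R z)) * h4
    rw [this]; exact isUnit_one
  have h1 : F₁ z * monodromy L a b z * blochMat R z = F₁ z * blochMat R z * G := by
    rw [Matrix.mul_assoc, monodromy_mul_blochMat h, Matrix.mul_assoc]
  have h2 : G * !![Complex.I * z, 0; 0, -(Complex.I * z)] =
      !![Complex.I * z, 0; 0, -(Complex.I * z)] * G := by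
    rw [hG, Matrix.mul_fin_two, Matrix.mul_fin_two]
    apply mat_ext <;> ring
  rw [h1, Matrix.mul_inv_rev, Matrix.mul_assoc (F₁ z * blochMat R z) G, h2]
  simp only [Matrix.mul_assoc]
  rw [Matrix.mul_nonsing_inv_cancel_left _ _ hGdet]

/-- The potential and its one-sided derivative take the same values at the two end points. -/
theorem potential_endpoints (hL : 0 ≤ L) (hS : SpectralData L a b) (he : IsMainSpectrum L a e)
    (hR : IsBranch L a b e R) (ht : 0 ≤ t)
    (hM : ∀ x ∈ Set.Icc (0 : ℝ) L, IsRHSolution L a b e R x t (M x t))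
    (hq : IsPotentialOf L M q) :
    q 0 t = q L t ∧ ∃ d : ℂ, HasDerivWithinAt (fun x => q x t) d (Set.Icc 0 L) 0 ∧
      HasDerivWithinAt (fun x => q x t) d (Set.Icc 0 L) L := by
  have h0L : (0 : ℝ) ∈ Set.Icc 0 L := ⟨le_rfl, hL⟩
  have hLL : L ∈ Set.Icc 0 L := ⟨hL, le_rfl⟩
  constructor
  -- In `Q1` the transformed equality multiplies the `12` entry by the single multiplier `a + bR*`,
  -- which tends to one along the diagonal.
  · set l : Filter ℂ := Filter.map (fun s : ℝ => (s : ℂ) * (1 + Complex.I)) atTop with hl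
    have hlc : l ≤ cocompact ℂ ⊓ 𝓟 ((contour e)ᶜ ∩ Q1) := eventually_diagonal e
    have hlQ : l ≤ cocompact ℂ ⊓ 𝓟 Q1 :=
      hlc.trans (inf_le_inf_left _ (principal_mono.2 Set.inter_subset_right))
    have him : Tendsto Complex.im l atTop := by
      rw [hl, tendsto_map'_iff]
      exact tendsto_id.congr fun s => by simp
    have h1 := (hq 0 h0L t ht).mono_left hlQ
    have h2 := ((hq L hLL t ht).mono_left hlQ).mul
      (tendsto_multiplier hS hR (hlQ.trans inf_le_left) him).1
    rw [mul_one] at h2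
    refine tendsto_nhds_unique h1 (h2.congr' ?_)
    have hmem : ∀ᶠ z in l, z ∈ (contour e)ᶜ ∩ Q1 :=
      hlc (mem_inf_of_right (mem_principal_self _))
    filter_upwards [hmem, (hlc.trans inf_le_left) hR.eventually_analyticAt_cocompact] with z hz hz'
    have h3 := transformed_eq hL hS he hR ht (hM 0 h0L) (hM L hLL) hz.1 hz'.2.1.not_isPole
      hz'.2.2.not_isPole
    have h4 : matP a b R t z = 1 := by
      rw [matP, if_neg fun h' => hz.2.1.not_gt h'.1, if_neg fun h' => hz.2.1.not_gt h'.1]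
    rw [h4, Matrix.mul_one, matPhat, if_pos hz.2] at h3
    rw [h3]
    simp [Matrix.mul_apply, Fin.sum_univ_two]
    ring
  obtain ⟨F₀, A₀, hF₀, -, hdet₀, hA₀, h₀, hAM₀⟩ :=
    exists_entire_asymptotics hS he hR (hM 0 h0L) h0L ht
  obtain ⟨F₁, A₁, hF₁, -, hdet₁, hA₁, h₁, hAM₁⟩ :=
    exists_entire_asymptotics hS he hR (hM L hLL) hLL ht
  have hF := entire_eq_mul_monodromy hL hS he hR hF₀ hF₁ hdet₀ hA₀ hA₁ h₀ h₁
  have hRR : ∀ᶠ z in cocompact ℂ, 1 + R z * schwarz R z ≠ 0 := by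
    have h2 := (hR.decay.mul hR.decay_schwarz).const_add 1
    rw [mul_zero, add_zero] at h2
    exact h2.eventually_ne one_ne_zero
  have hev := (hR.eventually_analyticAt_cocompact.and hRR).and (hR.eventually_identities hS)
  rw [← Metric.cobounded_eq_cocompact, ← comap_norm_atTop, eventually_comap] at hev
  obtain ⟨r, hr⟩ := eventually_atTop.1 hev
  set ρ₀ := max r 1 with hρ₀
  have hreg : ∀ z : ℂ, ρ₀ < ‖z‖ → _ := fun z hz => hr ‖z‖ ((le_max_left _ _).trans hz.le) z rfl
  have hρ₀pos : 0 < ρ₀ := lt_of_lt_of_le one_pos (le_max_right _ _)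
  have hreg' : ∀ z, ρ₀ < ‖z‖ →
      AnalyticAt ℂ R z ∧ AnalyticAt ℂ (schwarz R) z ∧ 1 + R z * schwarz R z ≠ 0 := fun z hz =>
    ⟨(hreg z hz).1.1.2.1, (hreg z hz).1.1.2.2, (hreg z hz).1.2⟩
  obtain ⟨C₀, η₀, hη₀, hC₀⟩ := exists_potential_estimate hS he hR ht hM hq h0L hF₀ hdet₀ hA₀ h₀
    hAM₀ hρ₀pos (lt_add_one ρ₀) hreg'
  obtain ⟨C₁, η₁, hη₁, hC₁⟩ := exists_potential_estimate hS he hR ht hM hq hLL hF₁ hdet₁ hA₁ h₁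
    hAM₁ hρ₀pos (lt_add_one ρ₀) hreg'
  -- Both estimates use the same circle, so `F₀ = F₁ T` makes the two candidate derivatives
  -- literally equal.
  have havg : Real.circleAverage (fun w => w * loopGen F₁ R w 0 1) 0 (ρ₀ + 1) =
      Real.circleAverage (fun w => w * loopGen F₀ R w 0 1) 0 (ρ₀ + 1) := by
    refine Real.circleAverage_congr_sphere fun w hw => ?_
    have hwn : ‖w‖ = ρ₀ + 1 := by
      rw [abs_of_pos (by linarith)] at hw
      simpa using hw
    have h2 := loopGen_mul_monodromy (F₁ := F₁) (hreg w (by linarith)).2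
    rw [show (fun z => F₁ z * monodromy L a b z) = F₀ from funext fun z => (hF z).symm] at h2
    simp only [h2]
  rw [havg] at hC₁
  exact ⟨_, hasDerivWithinAt_of_quadratic hη₀ hC₀, hasDerivWithinAt_of_quadratic hη₁ hC₁⟩

end

end

end PeriodicNLS

theorem proposition4p2 (L : ℝ) (hL : 0 < L) (q₀ : ℝ → ℂ) (hq₀ : ContinuousOn q₀ (Set.Icc 0 L))
    (a b : ℂ → ℂ) (hab : PeriodicNLS.IsSpectralPair L q₀ a b)
    (N : ℕ) (e : Fin (N + 1) → ℂ) (he : PeriodicNLS.IsMainSpectrum L a e)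
    (R : ℂ → ℂ) (hR : PeriodicNLS.IsBranch L a b e R)
    (M : ℝ → ℝ → ℂ → PeriodicNLS.Mat2)
    (hM : ∀ x ∈ Set.Icc (0 : ℝ) L, ∀ t : ℝ, 0 ≤ t →
      PeriodicNLS.IsRHSolution L a b e R x t (M x t))
    (q : ℝ → ℝ → ℂ) (hq : PeriodicNLS.IsPotentialOf L M q) :
    (∀ t : ℝ, 0 ≤ t → ∀ z ∉ PeriodicNLS.contour e,
      ¬ PeriodicNLS.IsPole R z → ¬ PeriodicNLS.IsPole (PeriodicNLS.schwarz R) z →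
        M 0 t z * PeriodicNLS.matP a b R t z = M L t z * PeriodicNLS.matPhat L a b R t z) ∧
    (∀ t : ℝ, 0 ≤ t → q 0 t = q L t ∧
      ∃ d : ℂ, HasDerivWithinAt (fun x => q x t) d (Set.Icc 0 L) 0 ∧
        HasDerivWithinAt (fun x => q x t) d (Set.Icc 0 L) L) := by
  have hS := hab.spectralData hL hq₀
  refine ⟨fun t ht z hz hp hp' => ?_, fun t ht => ?_⟩
  · exact PeriodicNLS.transformed_eq hL.le hS he hR ht (hM 0 ⟨le_rfl, hL.le⟩ t ht)
      (hM L ⟨hL.le, le_rfl⟩ t ht) hz hp hp'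
  · exact PeriodicNLS.potential_endpoints hL.le hS he hR ht (fun x hx => hM x hx t ht) hq
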